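/- **Theorem 1.1 (Exact formulas for variances).** Let $n\ge 1$, let $\omega_0,\dots,\omega_n$ be independent standard normal random variables, and let $P_n(x)=\sum_{j=0}^n \omega_j\sqrt{\binom nj}\,x^j$. For $-\infty\le a<b\le\infty$ let $N_n(a,b)$ be the number of real zeros of $P_n$ in $(a,b)$. This number is almost surely finite and has a finite second moment. Put $$\Delta_n(s)=(1+s^2)^{-n/2}\,\frac{(1+s^2)\left[1-(1+s^2)^{-n}\right]-ns^2}{1-(1+s^2)^{-n}-ns^2(1+s^2)^{-n}},\qquad \Gamma_n(s)=\frac{1-(1+s^2)^{-n}-ns^2(1+s^2)^{-n}}{\left[1-(1+s^2)^{-n}\right]^{3/2}},$$ $$F_n(s)=\left(\sqrt{1-\Delta_n^2(s)}+\Delta_n(s)\arcsin\Delta_n(s)\right)\Gamma_n(s)-1\qquad(s>0),$$ where for $n=1$ (when $\Gamma_1=0$ and the quotient in $\Delta_1$ is $0/0$) one reads $F_1=-1$. Let $\alpha(a,b)=(b-a)/(1+ab)$, where infinite endpoints are understood as limits, that is, $\alpha(a,\infty)=1/a$ and $\alpha(-\infty,b)=-1/b$ for finite nonzero $a,b$,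 and $\alpha(-\infty,\infty)=0$; moreover $\alpha(a,b)=+\infty$ if $a,b$ are finite with $ab=-1$, and $\alpha(0,\infty)=\alpha(-\infty,0)=+\infty$. Define $$K_n(a,b)=\frac2\pi\int_0^{\sqrt n|\alpha(a,b)|}\frac{F_n(s/\sqrt n)}{1+s^2/n}\,ds,\qquad L_n(a,b)=\frac2{\pi^2}\int_0^{\sqrt n|\alpha(a,b)|}\frac{F_n(s/\sqrt n)}{1+s^2/n}\,\sqrt n\arctan(s/\sqrt n)\,ds,$$ and let $K_n$ denote the first expression with upper limit $\infty$ in place of $\sqrt n|\alpha(a,b)|$. Both integrands are absolutely integrable on $(0,\infty)$, and the following holds. 1. If $\alpha(a,b)>0$ (the value $+\infty$ included), then $$\operatorname{Var}[N_n(a,b)]=(1+K_n(a,b))\,\mathbb E[N_n(a,b)]-L_n(a,b).$$ 2. If $\alpha(a,b)=0$, then $(a,b)=\mathbb R$ and $$\operatorname{Var}[N_n(\mathbb R)]=(1+K_n)\,\mathbb E[N_n(\mathbb R)]=(1+K_n)\sqrt n,\qquad \mathbb E[N_n(\mathbb R)]=\sqrt n.$$ 3. If $\alpha(a,b)<0$,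 then $$\operatorname{Var}[N_n(a,b)]=(1+K_n)\,\mathbb E[N_n(a,b)]+\left(K_n-K_n(a,b)\right)\left(\mathbb E[N_n(a,b)]-\sqrt n\right)-L_n(a,b).$$ -/

import Mathlib

open MeasureTheory ProbabilityTheory

namespace EllipticPolynomial

noncomputable section

/-- The elliptic (binomial) polynomial `∑ j, c j * √(n choose j) * x ^ j` with coefficients `c`,
evaluated at the real point `x`. -/
def poly (n : ℕ) (c : Fin (n + 1) → ℝ) (x : ℝ) : ℝ :=
  ∑ j : Fin (n + 1), c j * Real.sqrt (n.choose (j : ℕ) : ℝ) * x ^ (j : ℕ)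

/-- The set of real zeros of the elliptic polynomial with coefficients `c` in the open interval
`(a, b)`, whose endpoints may be infinite. -/
def zeros (n : ℕ) (a b : EReal) (c : Fin (n + 1) → ℝ) : Set ℝ :=
  {x : ℝ | a < (x : EReal) ∧ (x : EReal) < b ∧ poly n c x = 0}

/-- The number `N_n(a, b)` of real zeros in `(a, b)`. -/
def numZeros (n : ℕ) (a b : EReal) (c : Fin (n + 1) → ℝ) : ℝ :=
  ((zeros n a b c).ncard : ℝ)

/-- `Δ_n(s)`. For `n = 1` the quotient is `0 / 0 = 0`; this value is irrelevant, since `Δ_n` only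
enters through the product with `Γ_n`, and `Γ_1 = 0`. -/
def Delta (n : ℕ) (s : ℝ) : ℝ :=
  (1 + s ^ 2) ^ (-(n : ℝ) / 2) *
    (((1 + s ^ 2) * (1 - (1 + s ^ 2) ^ (-(n : ℤ))) - (n : ℝ) * s ^ 2) /
      (1 - (1 + s ^ 2) ^ (-(n : ℤ)) - (n : ℝ) * s ^ 2 * (1 + s ^ 2) ^ (-(n : ℤ))))

/-- `Γ_n(s)`. -/
def Gam (n : ℕ) (s : ℝ) : ℝ :=
  (1 - (1 + s ^ 2) ^ (-(n : ℤ)) - (n : ℝ) * s ^ 2 * (1 + s ^ 2) ^ (-(n : ℤ))) /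
    (1 - (1 + s ^ 2) ^ (-(n : ℤ))) ^ (3 / 2 : ℝ)

/-- `F_n(s)`. -/
def F (n : ℕ) (s : ℝ) : ℝ :=
  (Real.sqrt (1 - Delta n s ^ 2) + Delta n s * Real.arcsin (Delta n s)) * Gam n s - 1

/-- `α(a, b) = (b - a) / (1 + a b)`, extended to infinite endpoints by taking limits. When the
denominator vanishes the value is infinite; for `a < b` this infinite value is read as `+∞`, since
the numerator is then positive. -/
def alpha : EReal → EReal → EReal
  | (a : ℝ), (b : ℝ) => if 1 + a * b = 0 then ⊤ else (((b - a) / (1 + a * b) : ℝ) : EReal)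
  | (a : ℝ), ⊤ => if a = 0 then ⊤ else ((1 / a : ℝ) : EReal)
  | (a : ℝ), ⊥ => if a = 0 then ⊤ else ((1 / a : ℝ) : EReal)
  | ⊤, (b : ℝ) => if b = 0 then ⊤ else ((-1 / b : ℝ) : EReal)
  | ⊥, (b : ℝ) => if b = 0 then ⊤ else ((-1 / b : ℝ) : EReal)
  | ⊤, ⊤ => 0
  | ⊤, ⊥ => 0
  | ⊥, ⊤ => 0
  | ⊥, ⊥ => 0

/-- The integrand of `K_n`. -/
def kIntegrand (n : ℕ) (s : ℝ) : ℝ :=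
  F n (s / Real.sqrt n) / (1 + s ^ 2 / n)

/-- The integrand of `L_n`. -/
def lIntegrand (n : ℕ) (s : ℝ) : ℝ :=
  F n (s / Real.sqrt n) / (1 + s ^ 2 / n) * (Real.sqrt n * Real.arctan (s / Real.sqrt n))

/-- `(2 / π) ∫_0^T F_n(s / √n) / (1 + s² / n) ds`, with an upper limit `T` that may be `∞`. -/
def KUpTo (n : ℕ) (T : EReal) : ℝ :=
  2 / Real.pi * ∫ s in {s : ℝ | 0 < s ∧ (s : EReal) < T}, kIntegrand n s

/-- `(2 / π²) ∫_0^T F_n(s / √n) / (1 + s² / n) √n arctan (s / √n) ds`, with an upper limit `T` that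
may be `∞`. -/
def LUpTo (n : ℕ) (T : EReal) : ℝ :=
  2 / Real.pi ^ 2 * ∫ s in {s : ℝ | 0 < s ∧ (s : EReal) < T}, lIntegrand n s

/-- The upper limit of integration `√n |α(a, b)|`, where `|x| = max x (-x)`. -/
def upperLimit (n : ℕ) (a b : EReal) : EReal :=
  ((Real.sqrt n : ℝ) : EReal) * max (alpha a b) (-alpha a b)

/-- `K_n(a, b)`. -/
def K (n : ℕ) (a b : EReal) : ℝ := KUpTo n (upperLimit n a b)

/-- `L_n(a, b)`. -/
def L (n : ℕ) (a b : EReal) : ℝ := LUpTo n (upperLimit n a b)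

/-- `K_n`: the upper limit `√n |α(a, b)|` is replaced by `∞`. -/
def KInf (n : ℕ) : ℝ := KUpTo n ⊤

end

end EllipticPolynomial

/-!
Write the polynomial in the angle `θ = arctan x`: up to the factor `cos θ ^ n` it is the scalar
product of the coefficient vector `c` with the unit vector
`frame n θ = (√(n choose j) sin θ ^ j cos θ ^ (n - j))_j`. This curve is an orbit of a
one-parameter group `rot n` of orthogonal maps (`rot_single_zero`), and the standard Gaussian law
of `c` is invariant under it. So zeros, seen as angles, form a stationary point process, and the
interval `(a, b)` becomes an interval of length `ℓ = arctan b - arctan a`, whose tangent is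
`α(a, b)` (`alpha_eq_tan`).

The first two factorial moments of the number of zeros are computed without conditioning. The set
of pairs (coefficients, zero) is parametrized by a map `zeroMap` from a space of the same dimension
as that of the coefficients: take a form that vanishes at the angle `0` and rotate it. Similarly,
`pairMap` parametrizes the coefficients with two zeros `θ` and `θ + φ`. The fibres of these maps
count zeros and pairs of zeros, so the area formula with multiplicities, `lintegral_tsum_fiber_eq`,
turns the moments into Gaussian integrals of explicit Jacobians. For single zeros this gives the
constant density `√n / π` (`lintegral_encard_trigZeros`). For pairs, the Jacobian is a product
`|U| |V|` of two linear functionals of a Gaussian vector; its weighted expectation is computed in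
polar coordinates (`lintegral_exp_neg_sq_mul_abs_mul_abs`) and equals `n / π² * (F_n(tan φ) + 1)`
by an algebraic identity for the Gram matrix (`Gam_and_Delta_sq_of_gram`,
`lintegral_pair_density`).

Hence `Var N = √n / π * ℓ + 2n / π² * ∫_0^ℓ (ℓ - t) F_n(tan t) dt` (`variance_numZeros`). The
integrability of `F_n ∘ tan` needs no estimate: the second factorial moment on the whole line is
finite, because a polynomial of degree `n` has at most `n` zeros. The substitution `s = √n tan t`
turns the integrals over `(0, θ)` with `θ ≤ π / 2` into `K_n` and `L_n`; for `ℓ > π / 2`, that is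
for `α ≤ 0`, the symmetry of `F_n ∘ tan` about `π / 2` reduces to this case (`variance_formulas`).
-/

namespace EllipticPolynomial

open Set Function
open scoped ENNReal NNReal

/-! ### The area formula with multiplicities -/

/-- **Area formula with multiplicities**, between spaces of equal dimension. The domain is cut into
countably many pieces on which the map is injective, and the change of variables formula is applied
to each of them; by Sard's lemma the critical points contribute nothing. The fibre sum on the left
need not be measurable, only almost everywhere measurable. -/
theorem lintegral_tsum_fiber_eq {E : Type*} [NormedAddCommGroup E] [NormedSpace ℝ E]
    [FiniteDimensional ℝ E] [MeasurableSpace E] [BorelSpace E] (μ : Measure E) [μ.IsAddHaarMeasure]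
    {f : E → E} {f' : E → E →L[ℝ] E} {s : Set E} (hs : MeasurableSet s)
    (hf' : ∀ x ∈ s, HasFDerivWithinAt f (f' x) s x)
    (hdet : MeasurableSet {x | x ∈ s ∧ (f' x).det ≠ 0}) {h : E → ℝ≥0∞} (hh : Measurable h) :
    AEMeasurable (fun y => ∑' x : ↥(s ∩ f ⁻¹' {y}), h x) μ ∧
      ∫⁻ y, ∑' x : ↥(s ∩ f ⁻¹' {y}), h x ∂μ =
        ∫⁻ x in s, ENNReal.ofReal |(f' x).det| * h x ∂μ := by
  classical
  set S : Set E := {x | x ∈ s ∧ (f' x).det ≠ 0} with hS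
  have hSs : S ⊆ s := fun x hx => hx.1
  have hfS : ∀ x ∈ S, HasFDerivWithinAt f (f' x) S x := fun x hx => (hf' x hx.1).mono hSs
  -- on pieces where `f` is close to an invertible linear map, `f` is injective
  have hr : ∀ A : E →L[ℝ] E, ∃ r : ℝ≥0, r ≠ 0 ∧
      (A.det ≠ 0 → ∀ t, ApproximatesLinearOn f A t r → InjOn f t) := by
    intro A
    by_cases hA : A.det = 0
    · exact ⟨1, one_ne_zero, fun h => absurd hA h⟩
    · let A' := A.toContinuousLinearEquivOfDetNeZero hA
      have hA' : (A' : E →L[ℝ] E) = A := by ext; simp [A']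
      rcases subsingleton_or_nontrivial E with hE | hE
      · exact ⟨1, one_ne_zero, fun _ t _ => fun x _ y _ _ => Subsingleton.elim x y⟩
      have hpos : 0 < ‖(A'.symm : E →L[ℝ] E)‖₊⁻¹ := by
        rw [inv_pos]; exact A'.nnnorm_symm_pos
      refine ⟨‖(A'.symm : E →L[ℝ] E)‖₊⁻¹ / 2, (half_pos hpos).ne', fun _ t ht => ?_⟩
      rw [← hA'] at ht
      exact ht.injOn (Or.inr (half_lt_self hpos))
  choose r hr0 hrinj using hr
  obtain ⟨t, A, hdisj, htm, hcov, happ, hA⟩ :=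
    exists_partition_approximatesLinearOn_of_hasFDerivWithinAt f S f' hfS r hr0
  have hinj : ∀ n, InjOn f (S ∩ t n) := by
    intro n
    rcases S.eq_empty_or_nonempty with hE | hne
    · simp [hE]
    · obtain ⟨y, hy, hAy⟩ := hA hne n
      exact hrinj (A n) (hAy ▸ hy.2) _ (happ n)
  have hm : ∀ n, MeasurableSet (S ∩ t n) := fun n => hdet.inter (htm n)
  have hfn : ∀ n, ∀ x ∈ S ∩ t n, HasFDerivWithinAt f (f' x) (S ∩ t n) x :=
    fun n x hx => (hfS x hx.1).mono inter_subset_left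
  let g : ℕ → E → ℝ≥0∞ := fun n y => ∑' x : ↥(S ∩ t n ∩ f ⁻¹' {y}), h x
  have hgx : ∀ n, ∀ x ∈ S ∩ t n, g n (f x) = h x := by
    intro n x hx
    have : S ∩ t n ∩ f ⁻¹' {f x} = {x} := by
      ext z
      simp only [mem_inter_iff, mem_preimage, mem_singleton_iff]
      constructor
      · rintro ⟨hz, hzx⟩; exact hinj n hz hx hzx
      · rintro rfl; exact ⟨hx, rfl⟩
    change ∑' z : ↥(S ∩ t n ∩ f ⁻¹' {f x}), h z = h x
    rw [this]
    exact tsum_singleton x h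
  have hg0 : ∀ n, ∀ y ∉ f '' (S ∩ t n), g n y = 0 := by
    intro n y hy
    have : S ∩ t n ∩ f ⁻¹' {y} = ∅ := by
      ext z
      simp only [mem_inter_iff, mem_preimage, mem_singleton_iff, mem_empty_iff_false, iff_false]
      rintro ⟨hz, hzy⟩
      exact hy ⟨z, hz, hzy⟩
    simp [g, this]
  have hgm : ∀ n, Measurable (g n) := by
    intro n
    have hemb := measurableEmbedding_of_fderivWithin (hm n) (hfn n) (hinj n)
    have := hemb.measurable_extend (g := fun x : ↥(S ∩ t n) => h x) (g' := fun _ => 0)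
      (hh.comp measurable_subtype_coe) measurable_const
    convert this using 1
    funext y
    by_cases hy : y ∈ f '' (S ∩ t n)
    · obtain ⟨x, hx, rfl⟩ := hy
      rw [hgx n x hx]
      exact (hemb.injective.extend_apply (fun x : ↥(S ∩ t n) => h x) (fun _ => 0) ⟨x, hx⟩).symm
    · rw [hg0 n y hy, Function.extend_apply']
      rintro ⟨x, hx⟩
      exact hy ⟨x, x.2, hx⟩
  have hgi : ∀ n, ∫⁻ y, g n y ∂μ = ∫⁻ x in S ∩ t n, ENNReal.ofReal |(f' x).det| * h x ∂μ := by
    intro n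
    have himg := measurable_image_of_fderivWithin (hm n) (hfn n) (hinj n)
    rw [← setLIntegral_eq_of_support_subset (s := f '' (S ∩ t n)),
      lintegral_image_eq_lintegral_abs_det_fderiv_mul μ (hm n) (hfn n) (hinj n)]
    · exact setLIntegral_congr_fun (hm n) fun x hx => by simp only [hgx n x hx]
    · intro y hy
      by_contra hy'
      exact hy (hg0 n y hy')
  -- the critical values form a null set
  have hsard : μ (f '' (s \ S)) = 0 := by
    refine addHaar_image_eq_zero_of_det_fderivWithin_eq_zero μ (f' := f')
      (fun x hx => (hf' x hx.1).mono sdiff_subset) fun x hx => ?_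
    by_contra hne
    exact hx.2 ⟨hx.1, hne⟩
  have hae : (fun y => ∑' x : ↥(s ∩ f ⁻¹' {y}), h x) =ᵐ[μ] fun y => ∑' n, g n y := by
    have : ∀ᵐ y ∂μ, y ∉ f '' (s \ S) := by
      rw [ae_iff]; simpa only [not_not, ofPred_mem_eq] using hsard
    filter_upwards [this] with y hy
    simp only [g, tsum_subtype _ h]
    rw [ENNReal.tsum_comm]
    refine tsum_congr fun x => ?_
    by_cases hx : x ∈ s ∩ f ⁻¹' {y}
    · have hxS : x ∈ S := by
        by_contra hxS
        exact hy ⟨x, ⟨hx.1, hxS⟩, hx.2⟩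
      obtain ⟨k, hk⟩ := mem_iUnion.1 (hcov hxS)
      rw [tsum_eq_single k]
      · have hx' : x ∈ S ∩ t k ∩ f ⁻¹' {y} := ⟨⟨hxS, hk⟩, hx.2⟩
        rw [indicator_of_mem hx, indicator_of_mem hx']
      · intro j hj
        rw [indicator_of_notMem]
        rintro ⟨⟨-, hxj⟩, -⟩
        exact (hdisj hj).le_bot ⟨hxj, hk⟩
    · rw [indicator_of_notMem hx]
      symm
      rw [ENNReal.tsum_eq_zero]
      intro j
      rw [indicator_of_notMem]
      rintro ⟨⟨h1, -⟩, h2⟩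
      exact hx ⟨h1.1, h2⟩
  refine ⟨(AEMeasurable.congr (Measurable.tsum hgm).aemeasurable hae.symm), ?_⟩
  rw [lintegral_congr_ae hae, lintegral_tsum fun n => (hgm n).aemeasurable]
  simp_rw [hgi]
  have hSU : S = ⋃ n, S ∩ t n := by
    rw [← inter_iUnion]; exact (inter_eq_left.2 hcov).symm
  rw [← lintegral_iUnion hm (fun i j hij => (hdisj hij).mono inter_subset_right inter_subset_right),
    ← hSU, ← lintegral_inter_add_sdiff _ s hdet, inter_eq_right.2 hSs]
  have : ∫⁻ x in s \ S, ENNReal.ofReal |(f' x).det| * h x ∂μ = 0 := by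
    refine setLIntegral_eq_zero (hs.diff hdet) fun x hx => ?_
    have : (f' x).det = 0 := by
      by_contra hne
      exact hx.2 ⟨hx.1, hne⟩
    simp [this]
  rw [this, add_zero]

/-! ### Rotations acting on coefficient vectors -/

/-- The skew-symmetric matrix by which the rotation of the plane acts infinitesimally on the
coefficients of a binary form of degree `n`, in the basis
`√(n choose j) * sin θ ^ j * cos θ ^ (n - j)`. It is tridiagonal with zero diagonal. -/
noncomputable def genMatrix (n : ℕ) : Matrix (Fin (n + 1)) (Fin (n + 1)) ℝ :=
  Matrix.of fun i j =>
    if (i : ℕ) = j + 1 then Real.sqrt (((j : ℕ) + 1) * ((n : ℝ) - (j : ℕ)))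
    else if (j : ℕ) = i + 1 then -Real.sqrt (((i : ℕ) + 1) * ((n : ℝ) - (i : ℕ)))
    else 0

/-- The matrix `genMatrix n` as a continuous linear map. -/
noncomputable def gen (n : ℕ) : (Fin (n + 1) → ℝ) →L[ℝ] (Fin (n + 1) → ℝ) :=
  (Matrix.toLin' (genMatrix n)).toContinuousLinearMap

theorem gen_apply (n : ℕ) (x : Fin (n + 1) → ℝ) : gen n x = (genMatrix n).mulVec x := rfl

theorem genMatrix_transpose (n : ℕ) : (genMatrix n).transpose = -genMatrix n := by
  ext i j
  simp only [genMatrix, Matrix.transpose_apply, Matrix.of_apply, Matrix.neg_apply]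
  split_ifs <;> first | omega | simp

theorem gen_dotProduct (n : ℕ) (x y : Fin (n + 1) → ℝ) :
    gen n x ⬝ᵥ y = -(x ⬝ᵥ gen n y) := by
  rw [gen_apply, gen_apply, Matrix.dotProduct_mulVec, ← Matrix.mulVec_transpose,
    genMatrix_transpose, Matrix.neg_mulVec, neg_dotProduct, neg_neg]

/-- The one-parameter group of orthogonal maps generated by `gen n`: the action of the rotation by
`θ` on coefficient vectors. -/
noncomputable def rot (n : ℕ) (θ : ℝ) : (Fin (n + 1) → ℝ) →L[ℝ] (Fin (n + 1) → ℝ) :=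
  NormedSpace.exp (θ • gen n)

theorem rot_zero (n : ℕ) : rot n 0 = 1 := by simp [rot]

theorem rot_add (n : ℕ) (s t : ℝ) : rot n (s + t) = rot n s * rot n t := by
  rw [rot, rot, rot, add_smul]
  let _ : NormedAlgebra ℚ ((Fin (n + 1) → ℝ) →L[ℝ] (Fin (n + 1) → ℝ)) :=
    NormedAlgebra.restrictScalars ℚ ℝ _
  exact NormedSpace.exp_add_of_commute (((Commute.refl _).smul_left s).smul_right t)

theorem rot_add_apply (n : ℕ) (s t : ℝ) (x : Fin (n + 1) → ℝ) :
    rot n (s + t) x = rot n s (rot n t x) := by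
  rw [rot_add]; rfl

theorem rot_neg_rot (n : ℕ) (s : ℝ) (x : Fin (n + 1) → ℝ) : rot n (-s) (rot n s x) = x := by
  rw [← rot_add_apply, neg_add_cancel, rot_zero]; rfl

theorem rot_rot_neg (n : ℕ) (s : ℝ) (x : Fin (n + 1) → ℝ) : rot n s (rot n (-s) x) = x := by
  rw [← rot_add_apply, add_neg_cancel, rot_zero]; rfl

theorem hasDerivAt_rot (n : ℕ) (θ : ℝ) : HasDerivAt (rot n) (rot n θ * gen n) θ :=
  hasDerivAt_exp_smul_const (𝕂 := ℝ) (gen n) θ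

theorem hasDerivAt_rot' (n : ℕ) (θ : ℝ) : HasDerivAt (rot n) (gen n * rot n θ) θ :=
  hasDerivAt_exp_smul_const' (𝕂 := ℝ) (gen n) θ

theorem hasDerivAt_rot_apply (n : ℕ) (θ : ℝ) (x : Fin (n + 1) → ℝ) :
    HasDerivAt (fun t => rot n t x) (gen n (rot n θ x)) θ := by
  have := (hasDerivAt_rot' n θ).clm_apply (hasDerivAt_const θ x)
  simpa using this

theorem rot_dotProduct_rot (n : ℕ) (θ : ℝ) (x y : Fin (n + 1) → ℝ) :
    rot n θ x ⬝ᵥ rot n θ y = x ⬝ᵥ y := by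
  have hd : ∀ t, HasDerivAt (fun t => rot n t x ⬝ᵥ rot n t y) 0 t := by
    intro t
    have h := HasDerivAt.fun_sum (u := Finset.univ) fun i _ =>
      ((hasDerivAt_pi.1 (hasDerivAt_rot_apply n t x) i).mul
        (hasDerivAt_pi.1 (hasDerivAt_rot_apply n t y) i))
    refine h.congr_deriv ?_
    rw [Finset.sum_add_distrib]
    have := gen_dotProduct n (rot n t x) (rot n t y)
    simp only [dotProduct] at this
    rw [this]; ring
  have hc := is_const_of_deriv_eq_zero (fun t => (hd t).differentiableAt)
    (fun t => (hd t).deriv) θ 0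
  simpa [rot_zero] using hc

theorem dotProduct_rot (n : ℕ) (θ : ℝ) (x y : Fin (n + 1) → ℝ) :
    x ⬝ᵥ rot n (-θ) y = rot n θ x ⬝ᵥ y := by
  rw [← rot_dotProduct_rot n θ, rot_rot_neg]

theorem abs_det_rot (n : ℕ) (θ : ℝ) : |(rot n θ).det| = 1 := by
  have h : (LinearMap.toMatrix' (rot n θ : (Fin (n + 1) → ℝ) →ₗ[ℝ] _)).transpose *
      LinearMap.toMatrix' (rot n θ : (Fin (n + 1) → ℝ) →ₗ[ℝ] _) = 1 := by
    ext i j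
    have := rot_dotProduct_rot n θ (Pi.single i 1) (Pi.single j 1)
    simp only [Matrix.mul_apply, Matrix.transpose_apply, LinearMap.toMatrix'_apply]
    simp only [dotProduct] at this
    rw [Matrix.one_apply]
    simpa [Pi.single_apply, eq_comm] using this
  have h2 := congrArg Matrix.det h
  rw [Matrix.det_mul, Matrix.det_transpose, Matrix.det_one, LinearMap.det_toMatrix'] at h2
  have h3 : (rot n θ).det ^ 2 = 1 := by rw [sq]; exact h2
  rw [← sq_abs] at h3
  exact (pow_eq_one_iff_of_nonneg (abs_nonneg _) two_ne_zero).1 h3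

/-- The vector `(√(n choose j) * sin θ ^ j * cos θ ^ (n - j))_j`. The polynomial with coefficients
`c` vanishes at `tan θ` (where `cos θ ≠ 0`) if and only if `c` is orthogonal to `frame n θ`. -/
noncomputable def frame (n : ℕ) (θ : ℝ) : Fin (n + 1) → ℝ := fun j =>
  Real.sqrt (n.choose j : ℝ) * (Real.sin θ ^ (j : ℕ) * Real.cos θ ^ (n - j : ℕ))

theorem sqrt_choose_succ (n j : ℕ) (hj : j < n) :
    Real.sqrt (((j : ℝ) + 1) * ((n : ℝ) - j)) * Real.sqrt (n.choose (j + 1)) =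
      ((n : ℝ) - j) * Real.sqrt (n.choose j) := by
  have h0 : (0 : ℝ) ≤ (n : ℝ) - j := by
    have : (j : ℝ) < n := by exact_mod_cast hj
    linarith
  have h := Nat.choose_succ_right_eq n j
  have h' : (n.choose (j + 1) : ℝ) * ((j : ℝ) + 1) = n.choose j * ((n : ℝ) - j) := by
    have := congrArg (Nat.cast : ℕ → ℝ) h
    push_cast [Nat.cast_sub hj.le] at this
    exact this
  rw [← Real.sqrt_mul (by positivity), show ((j : ℝ) + 1) * ((n : ℝ) - j) * n.choose (j + 1) =
    ((n : ℝ) - j) ^ 2 * n.choose j by rw [sq]; linear_combination ((n : ℝ) - j) * h',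
    Real.sqrt_mul (sq_nonneg _), Real.sqrt_sq h0]

theorem sqrt_choose_pred (n j : ℕ) (hj : j < n) :
    Real.sqrt (((j : ℝ) + 1) * ((n : ℝ) - j)) * Real.sqrt (n.choose j) =
      ((j : ℝ) + 1) * Real.sqrt (n.choose (j + 1)) := by
  have h0 : (0 : ℝ) ≤ (n : ℝ) - j := by
    have : (j : ℝ) < n := by exact_mod_cast hj
    linarith
  have h := Nat.choose_succ_right_eq n j
  have h' : (n.choose (j + 1) : ℝ) * ((j : ℝ) + 1) = n.choose j * ((n : ℝ) - j) := by
    have := congrArg (Nat.cast : ℕ → ℝ) h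
    push_cast [Nat.cast_sub hj.le] at this
    exact this
  rw [← Real.sqrt_mul (by positivity), show ((j : ℝ) + 1) * ((n : ℝ) - j) * n.choose j =
    ((j : ℝ) + 1) ^ 2 * n.choose (j + 1) by rw [sq]; linear_combination -((j : ℝ) + 1) * h',
    Real.sqrt_mul (sq_nonneg _), Real.sqrt_sq (by positivity)]

theorem genMatrix_mulVec_apply (n : ℕ) (x : ℕ → ℝ) (i : Fin (n + 1)) :
    (genMatrix n).mulVec (fun j => x j) i =
      (if (i : ℕ) = 0 then 0 else Real.sqrt ((i : ℕ) * ((n : ℝ) - ((i : ℕ) - 1 : ℕ))) *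
        x ((i : ℕ) - 1)) -
      (if (i : ℕ) = n then 0 else Real.sqrt (((i : ℕ) + 1) * ((n : ℝ) - (i : ℕ))) *
        x ((i : ℕ) + 1)) := by
  have hsplit : (genMatrix n).mulVec (fun j => x j) i =
      ∑ j ∈ Finset.range (n + 1), ((if j + 1 = (i : ℕ) then
        Real.sqrt ((j + 1 : ℝ) * ((n : ℝ) - j)) * x j else 0) -
        (if j = (i : ℕ) + 1 then Real.sqrt (((i : ℕ) + 1) * ((n : ℝ) - (i : ℕ))) * x j
          else 0)) := by
    rw [Finset.sum_range]
    simp only [Matrix.mulVec, dotProduct, genMatrix, Matrix.of_apply]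
    refine Finset.sum_congr rfl fun j _ => ?_
    split_ifs <;> first | omega | ring
  rw [hsplit, Finset.sum_sub_distrib]
  congr 1
  · split_ifs with h
    · refine Finset.sum_eq_zero fun j _ => ?_
      rw [if_neg (by omega)]
    · rw [Finset.sum_eq_single ((i : ℕ) - 1)]
      · rw [if_pos (Nat.sub_add_cancel (Nat.pos_of_ne_zero h))]
        have : (((i : ℕ) - 1 : ℕ) : ℝ) + 1 = (i : ℕ) := by
          have : (i : ℕ) - 1 + 1 = i := by omega
          exact_mod_cast this
        rw [this]
      · intro j _ hj; rw [if_neg (by omega)]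
      · intro hi; exact absurd (Finset.mem_range.2 (by omega)) hi
  · split_ifs with h
    · refine Finset.sum_eq_zero fun j hj => ?_
      rw [Finset.mem_range] at hj
      rw [if_neg (by omega)]
    · rw [Finset.sum_eq_single ((i : ℕ) + 1)]
      · rw [if_pos rfl]
      · intro j _ hj; rw [if_neg hj]
      · intro hi; exact absurd (Finset.mem_range.2 (by omega)) hi

/-- `frame n` is an orbit of the one-parameter group: it solves the same linear equation. -/
theorem hasDerivAt_frame (n : ℕ) (θ : ℝ) : HasDerivAt (frame n) (gen n (frame n θ)) θ := by
  rw [hasDerivAt_pi]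
  intro i
  have h := (((Real.hasDerivAt_sin θ).pow (i : ℕ)).mul
    ((Real.hasDerivAt_cos θ).pow (n - i : ℕ))).const_mul (Real.sqrt (n.choose i : ℝ))
  refine h.congr_deriv ?_
  rw [gen_apply]
  symm
  have := genMatrix_mulVec_apply n (fun j => Real.sqrt (n.choose j : ℝ) *
    (Real.sin θ ^ j * Real.cos θ ^ (n - j))) i
  change (genMatrix n).mulVec (fun j => Real.sqrt (n.choose j : ℝ) *
    (Real.sin θ ^ (j : ℕ) * Real.cos θ ^ (n - j : ℕ))) i = _
  rw [this]
  have hi := i.2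
  obtain ⟨k, hk⟩ : ∃ k : ℕ, k = i := ⟨_, rfl⟩
  rw [← hk] at hi ⊢
  have e1 : (if k = 0 then 0 else Real.sqrt (k * ((n : ℝ) - (k - 1 : ℕ))) *
      (Real.sqrt (n.choose (k - 1) : ℝ) * (Real.sin θ ^ (k - 1) * Real.cos θ ^ (n - (k - 1))))) =
      Real.sqrt (n.choose k) * (k * Real.sin θ ^ (k - 1) * Real.cos θ * Real.cos θ ^ (n - k)) := by
    rcases k with _ | k
    · simp
    · have h1 := sqrt_choose_pred n k (by omega)
      have h2 : n - k = n - (k + 1) + 1 := by omega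
      simp only [Nat.add_sub_cancel, Nat.succ_ne_zero, if_false, h2, pow_succ]
      push_cast
      linear_combination Real.sin θ ^ k * Real.cos θ ^ (n - (k + 1)) * Real.cos θ * h1
  have e2 : (if k = n then 0 else Real.sqrt ((k + 1) * ((n : ℝ) - k)) *
      (Real.sqrt (n.choose (k + 1) : ℝ) * (Real.sin θ ^ (k + 1) * Real.cos θ ^ (n - (k + 1))))) =
      Real.sqrt (n.choose k) * (Real.sin θ ^ k * ((n - k : ℕ) * Real.cos θ ^ (n - k - 1) *
        Real.sin θ)) := by
    split_ifs with hkn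
    · simp [hkn]
    · have h1 := sqrt_choose_succ n k (by omega)
      have h2 : n - (k + 1) = n - k - 1 := by omega
      rw [h2, Nat.cast_sub (by omega), pow_succ]
      linear_combination Real.sin θ ^ k * Real.sin θ * Real.cos θ ^ (n - k - 1) * h1
  rw [e1, e2]
  simp only [Pi.pow_apply]
  ring

theorem rot_single_zero (n : ℕ) (θ : ℝ) : rot n θ (Pi.single 0 1) = frame n θ := by
  -- both sides solve the same linear equation, so `rot n (-t) (frame n t)` is constant
  have hd : ∀ t, HasDerivAt (fun t => rot n (-t) (frame n t)) 0 t := by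
    intro t
    have h1 : HasDerivAt (fun t => rot n (-t)) (-(rot n (-t) * gen n)) t := by
      refine ((hasDerivAt_rot n (-t)).scomp t (hasDerivAt_neg t)).congr_deriv ?_
      rw [neg_one_smul]
    refine (h1.clm_apply (hasDerivAt_frame n t)).congr_deriv ?_
    simp
  have hc := is_const_of_deriv_eq_zero (fun t => (hd t).differentiableAt)
    (fun t => (hd t).deriv) θ 0
  have h0 : frame n 0 = Pi.single 0 1 := by
    ext j
    rcases Fin.eq_zero_or_eq_succ j with rfl | ⟨k, rfl⟩
    · simp [frame]
    · simp [frame]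
  simp only [neg_zero, rot_zero, h0] at hc
  rw [← rot_rot_neg n θ (frame n θ), hc]; rfl

/-- The trigonometric form `∑ j, c j * √(n choose j) * sin θ ^ j * cos θ ^ (n - j)` of the elliptic
polynomial with coefficients `c`. -/
noncomputable def trigPoly (n : ℕ) (c : Fin (n + 1) → ℝ) (θ : ℝ) : ℝ := frame n θ ⬝ᵥ c

theorem rot_neg_apply_zero (n : ℕ) (θ : ℝ) (c : Fin (n + 1) → ℝ) :
    rot n (-θ) c 0 = trigPoly n c θ := by
  have := dotProduct_rot n θ (Pi.single 0 1) c
  rwa [single_dotProduct, one_mul, rot_single_zero] at this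

/-- Rotating the coefficients shifts the zeros. -/
theorem trigPoly_rot (n : ℕ) (θ φ : ℝ) (c : Fin (n + 1) → ℝ) :
    trigPoly n (rot n θ c) (θ + φ) = trigPoly n c φ := by
  rw [← rot_neg_apply_zero, ← rot_neg_apply_zero, neg_add_rev, rot_add_apply, rot_neg_rot]

theorem trigPoly_eq_cos_pow_mul_poly (n : ℕ) (c : Fin (n + 1) → ℝ) {θ : ℝ} (h : Real.cos θ ≠ 0) :
    trigPoly n c θ = Real.cos θ ^ n * poly n c (Real.tan θ) := by
  rw [trigPoly, poly, dotProduct, Finset.mul_sum]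
  refine Finset.sum_congr rfl fun j _ => ?_
  have : Real.cos θ ^ n = Real.cos θ ^ (n - j : ℕ) * Real.cos θ ^ (j : ℕ) := by
    rw [← pow_add]; congr 1; have := j.2; omega
  rw [frame, this, Real.tan_eq_sin_div_cos, div_pow]
  field_simp

/-! ### Coefficient vectors with a distinguished zero -/

/-- Setting the constant coefficient to zero. -/
noncomputable def dropZero (n : ℕ) : (Fin (n + 1) → ℝ) →L[ℝ] (Fin (n + 1) → ℝ) :=
  ContinuousLinearMap.id ℝ _ -
    (ContinuousLinearMap.proj (R := ℝ) (φ := fun _ : Fin (n + 1) => ℝ) 0).smulRight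
      (Pi.single 0 1 : Fin (n + 1) → ℝ)

theorem dropZero_apply (n : ℕ) (v : Fin (n + 1) → ℝ) : dropZero n v = update v 0 0 := by
  ext i
  rcases Fin.eq_zero_or_eq_succ i with rfl | ⟨k, rfl⟩ <;> simp [dropZero, Fin.succ_ne_zero]

theorem gen_apply_zero (m : ℕ) (w : Fin (m + 2) → ℝ) :
    gen (m + 1) w 0 = -(Real.sqrt (m + 1 : ℕ) * w 1) := by
  rw [gen_apply, Matrix.mulVec, dotProduct, Fin.sum_univ_succ, Fin.sum_univ_succ]
  simp [genMatrix]

theorem det_id_add_smulRight {E : Type*} [NormedAddCommGroup E]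
    [NormedSpace ℝ E] [FiniteDimensional ℝ E] (f : E →L[ℝ] ℝ) (v : E) :
    (ContinuousLinearMap.id ℝ E + f.smulRight v).det = 1 + f v := by
  exact LinearMap.transvection.det (f : E →ₗ[ℝ] ℝ) v

/-- The coefficient vectors together with one of their zeros: a vector `v` is read as an angle
`θ = v 0` followed by the coefficients `v 1, …, v n` of a form that vanishes at the angle `0`, and
is sent to the rotation by `θ` of this form, which vanishes at `θ`. -/
noncomputable def zeroMap (n : ℕ) (v : Fin (n + 1) → ℝ) : Fin (n + 1) → ℝ :=
  rot n (v 0) (dropZero n v)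

/-- The derivative of `zeroMap`: a rotation composed with a rank-one perturbation of the identity,
whose determinant is explicit. -/
noncomputable def zeroMapDeriv (n : ℕ) (v : Fin (n + 1) → ℝ) :
    (Fin (n + 1) → ℝ) →L[ℝ] (Fin (n + 1) → ℝ) :=
  (rot n (v 0)).comp (ContinuousLinearMap.id ℝ _ +
    (ContinuousLinearMap.proj (R := ℝ) (φ := fun _ : Fin (n + 1) => ℝ) 0).smulRight
      (gen n (dropZero n v) - Pi.single 0 1))

theorem hasFDerivAt_zeroMap (n : ℕ) (v : Fin (n + 1) → ℝ) :
    HasFDerivAt (zeroMap n) (zeroMapDeriv n v) v := by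
  have h1 := HasFDerivAt.comp (g := rot n) v (hasDerivAt_rot n (v 0)).hasFDerivAt
    (ContinuousLinearMap.proj (R := ℝ) (φ := fun _ : Fin (n + 1) => ℝ) 0).hasFDerivAt
  refine (h1.clm_apply (dropZero n).hasFDerivAt).congr_fderiv ?_
  ext1 w
  simp [zeroMapDeriv, dropZero, map_sub, smul_sub]
  module

theorem abs_det_zeroMapDeriv (m : ℕ) (v : Fin (m + 2) → ℝ) :
    |(zeroMapDeriv (m + 1) v).det| = Real.sqrt (m + 1 : ℕ) * |v 1| := by
  have : (zeroMapDeriv (m + 1) v).det = (rot (m + 1) (v 0)).det *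
      (ContinuousLinearMap.id ℝ _ +
    (ContinuousLinearMap.proj (R := ℝ) (φ := fun _ : Fin (m + 1 + 1) => ℝ) 0).smulRight
      (gen (m + 1) (dropZero (m + 1) v) - Pi.single 0 1)).det := LinearMap.det_comp _ _
  rw [this, abs_mul, abs_det_rot, one_mul, det_id_add_smulRight]
  simp only [ContinuousLinearMap.proj_apply, Pi.sub_apply, gen_apply_zero, dropZero_apply]
  simp [abs_mul, abs_of_nonneg (Real.sqrt_nonneg _)]

theorem zeroMap_eq_iff (n : ℕ) (v c : Fin (n + 1) → ℝ) :
    zeroMap n v = c ↔ update v 0 0 = rot n (-(v 0)) c := by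
  rw [zeroMap, dropZero_apply]
  constructor
  · rintro rfl; rw [rot_neg_rot]
  · intro h; rw [h, rot_rot_neg]

theorem trigPoly_of_zeroMap_eq {n : ℕ} {v c : Fin (n + 1) → ℝ} (h : zeroMap n v = c) :
    trigPoly n c (v 0) = 0 := by
  rw [zeroMap_eq_iff] at h
  rw [← rot_neg_apply_zero, ← h, update_self]

theorem zeroMap_update_rot {n : ℕ} {c : Fin (n + 1) → ℝ} {θ : ℝ} (h : trigPoly n c θ = 0) :
    zeroMap n (update (rot n (-θ) c) 0 θ) = c := by
  rw [zeroMap_eq_iff, update_idem, update_self, update_eq_self_iff, rot_neg_apply_zero, h]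

theorem injOn_zeroMap_fiber (n : ℕ) (c : Fin (n + 1) → ℝ) :
    InjOn (fun v : Fin (n + 1) → ℝ => v 0) (zeroMap n ⁻¹' {c}) := by
  intro v hv w hw (hvw : v 0 = w 0)
  have hv' := (zeroMap_eq_iff n v c).1 hv
  have hw' := (zeroMap_eq_iff n w c).1 hw
  rw [hvw, ← hw'] at hv'
  ext i
  by_cases hi : i = 0
  · rw [hi, hvw]
  · simpa [hi] using congrFun hv' i

/-- The zeros in `I` of the trigonometric form with coefficients `c`. -/
def trigZeros (n : ℕ) (I : Set ℝ) (c : Fin (n + 1) → ℝ) : Set ℝ :=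
  {θ | θ ∈ I ∧ trigPoly n c θ = 0}

theorem encard_zeroMap_fiber (n : ℕ) (I : Set ℝ) (c : Fin (n + 1) → ℝ) :
    ({v : Fin (n + 1) → ℝ | v 0 ∈ I} ∩ zeroMap n ⁻¹' {c}).encard = (trigZeros n I c).encard := by
  rw [← ((injOn_zeroMap_fiber n c).mono inter_subset_right).encard_image]
  congr 1
  ext θ
  constructor
  · rintro ⟨v, ⟨hv, hvc⟩, rfl⟩
    exact ⟨hv, trigPoly_of_zeroMap_eq hvc⟩
  · rintro ⟨hI, hθ⟩
    exact ⟨_, ⟨by simpa using hI, zeroMap_update_rot hθ⟩, by simp⟩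

/-- The density of the standard Gaussian measure on `Fin d → ℝ`, with values in `ℝ≥0∞`. -/
noncomputable def stdDensity {d : ℕ} (c : Fin d → ℝ) : ℝ≥0∞ := ∏ i, gaussianPDF 0 1 (c i)

theorem measurable_stdDensity {d : ℕ} : Measurable (stdDensity (d := d)) :=
  Finset.measurable_prod _ fun i _ => (measurable_gaussianPDF 0 1).comp (measurable_pi_apply i)

theorem stdDensity_eq {d : ℕ} (c : Fin d → ℝ) :
    stdDensity c = ENNReal.ofReal ((Real.sqrt (2 * Real.pi))⁻¹ ^ d * Real.exp (-(c ⬝ᵥ c) / 2)) := by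
  simp only [stdDensity, gaussianPDF]
  rw [← ENNReal.ofReal_prod_of_nonneg fun i _ => gaussianPDFReal_nonneg _ _ _]
  simp only [gaussianPDFReal]
  rw [Finset.prod_mul_distrib, ← Real.exp_sum]
  simp only [Finset.prod_const, Finset.card_univ, Fintype.card_fin, NNReal.coe_one, mul_one,
    sub_zero, dotProduct, neg_div, Finset.sum_neg_distrib, Finset.sum_div, sq]

theorem stdDensity_rot (n : ℕ) (θ : ℝ) (c : Fin (n + 1) → ℝ) :
    stdDensity (rot n θ c) = stdDensity c := by
  rw [stdDensity_eq, stdDensity_eq, rot_dotProduct_rot]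

theorem tsum_zeroMap_fiber (n : ℕ) (I : Set ℝ) (c : Fin (n + 1) → ℝ) :
    ∑' v : ↥({v : Fin (n + 1) → ℝ | v 0 ∈ I} ∩ zeroMap n ⁻¹' {c}),
      stdDensity (dropZero n v) = stdDensity c * (trigZeros n I c).encard := by
  have : ∀ v : ↥({v : Fin (n + 1) → ℝ | v 0 ∈ I} ∩ zeroMap n ⁻¹' {c}),
      stdDensity (dropZero n v) = stdDensity c * 1 := by
    intro v
    have hv : rot n (v.1 0) (dropZero n v) = c := v.2.2
    rw [mul_one, ← stdDensity_rot n (v.1 0), hv]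
  rw [tsum_congr this, ENNReal.tsum_mul_left, ENNReal.tsum_set_one, encard_zeroMap_fiber]

/-- The area formula for `zeroMap`: the Gaussian density is invariant under rotations, so the fibre
sum is the density times the number of zeros. -/
theorem lintegral_stdDensity_mul_encard (m : ℕ) {I : Set ℝ} (hI : MeasurableSet I) :
    AEMeasurable (fun c : Fin (m + 2) → ℝ =>
        stdDensity c * ((trigZeros (m + 1) I c).encard : ℝ≥0∞)) ∧
      ∫⁻ c : Fin (m + 2) → ℝ, stdDensity c * ((trigZeros (m + 1) I c).encard : ℝ≥0∞) =
        ∫⁻ v in {v : Fin (m + 2) → ℝ | v 0 ∈ I},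
          ENNReal.ofReal (Real.sqrt (m + 1 : ℕ) * |v 1|) * stdDensity (dropZero (m + 1) v) := by
  have hs : MeasurableSet {v : Fin (m + 2) → ℝ | v 0 ∈ I} := measurable_pi_apply 0 hI
  have hdet : MeasurableSet {v | v ∈ {v : Fin (m + 2) → ℝ | v 0 ∈ I} ∧
      (zeroMapDeriv (m + 1) v).det ≠ 0} := by
    refine hs.inter ?_
    have : {v : Fin (m + 2) → ℝ | (zeroMapDeriv (m + 1) v).det ≠ 0} =
        {v | Real.sqrt (m + 1 : ℕ) * |v 1| ≠ 0} := by
      ext v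
      simp only [mem_ofPred_eq, ← abs_det_zeroMapDeriv, ne_eq, abs_eq_zero]
    change MeasurableSet {v : Fin (m + 2) → ℝ | (zeroMapDeriv (m + 1) v).det ≠ 0}
    rw [this]
    exact (measurableSet_eq_fun (by fun_prop) measurable_const).compl
  have := lintegral_tsum_fiber_eq volume hs
    (fun v _ => (hasFDerivAt_zeroMap (m + 1) v).hasFDerivWithinAt) hdet
    (h := fun v => stdDensity (dropZero (m + 1) v))
    (measurable_stdDensity.comp (dropZero (m + 1)).continuous.measurable)
  simp only [tsum_zeroMap_fiber, abs_det_zeroMapDeriv] at this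
  exact this

/-! ### Coefficient vectors with two distinguished zeros -/

/-- The contribution of the coefficients of index at least two to the form that vanishes at the
angle `0`: if `w 0 = 0`, then the form with coefficients `w` at `φ` is
`cos φ ^ (m + 1) * tan φ * (√(m + 1) * w 1 + tailSum m φ (tail2 w))`. -/
noncomputable def tailSum (m : ℕ) (φ : ℝ) (y : Fin m → ℝ) : ℝ :=
  ∑ j, y j * (Real.sqrt ((m + 1).choose (j + 2)) * Real.tan φ ^ ((j : ℕ) + 1))

/-- The derivative of `tailSum m φ y` in `φ`. -/
noncomputable def tailSumDeriv (m : ℕ) (φ : ℝ) (y : Fin m → ℝ) : ℝ :=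
  ∑ j, y j * (Real.sqrt ((m + 1).choose (j + 2)) *
    (((j : ℕ) + 1) * Real.tan φ ^ (j : ℕ) * (1 + Real.tan φ ^ 2)))

/-- The coordinates of index at least two. -/
def tail2 {m : ℕ} (v : Fin (m + 2) → ℝ) : Fin m → ℝ := fun j => v j.succ.succ

@[simp] theorem tail2_update_zero {m : ℕ} (v : Fin (m + 2) → ℝ) (x : ℝ) :
    tail2 (update v 0 x) = tail2 v := by
  ext j; simp [tail2]

@[simp] theorem tail2_update_one {m : ℕ} (v : Fin (m + 2) → ℝ) (x : ℝ) :
    tail2 (update v 1 x) = tail2 v := by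
  ext j
  have : j.succ.succ ≠ (1 : Fin (m + 2)) := by
    intro h; simpa using congrArg Fin.val h
  simp [tail2, this]

theorem trigPoly_of_apply_zero {m : ℕ} {w : Fin (m + 2) → ℝ} (hw : w 0 = 0) {φ : ℝ}
    (hφ : Real.cos φ ≠ 0) :
    trigPoly (m + 1) w φ = Real.cos φ ^ (m + 1) * Real.tan φ *
      (Real.sqrt (m + 1 : ℕ) * w 1 + tailSum m φ (tail2 w)) := by
  rw [trigPoly_eq_cos_pow_mul_poly _ _ hφ, poly, Fin.sum_univ_succ, Fin.sum_univ_succ, hw, tailSum,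
    mul_assoc]
  simp only [Fin.val_zero, Fin.val_succ, zero_mul, zero_add, pow_one, Nat.choose_one_right, tail2]
  rw [mul_assoc (Real.cos φ ^ (m + 1)), mul_add (Real.tan φ), Finset.mul_sum]
  congr 2
  · rw [Fin.succ_zero_eq_one]; ring
  · refine Finset.sum_congr rfl fun j _ => ?_
    rw [show (j : ℕ) + 1 + 1 = j + 2 from rfl, pow_succ]; ring

theorem trigPoly_of_cos_eq_zero {n : ℕ} (w : Fin (n + 1) → ℝ) {φ : ℝ} (hφ : Real.cos φ = 0) :
    trigPoly n w φ = Real.sin φ ^ n * w (Fin.last n) := by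
  rw [trigPoly, dotProduct, Finset.sum_eq_single (Fin.last n)]
  · simp [frame]
  · intro j _ hj
    have : n - (j : ℕ) ≠ 0 := by
      have := Fin.val_lt_last hj; omega
    simp [frame, hφ, this]
  · simp

/-- In a vector `v` whose coordinate `v 1` is an angle `φ`, replace this coordinate by the linear
coefficient which makes the form with constant coefficient zero vanish at `φ`. -/
noncomputable def solveOne (m : ℕ) (v : Fin (m + 2) → ℝ) : Fin (m + 2) → ℝ :=
  update v 1 (-(tailSum m (v 1) (tail2 v)) / Real.sqrt (m + 1 : ℕ))

/-- The coefficient vectors together with two of their zeros: a vector `v` is read as an angle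
`θ = v 0`, an angle `φ = v 1`, and the coefficients `v 2, …` of a form that vanishes at `0` and at
`φ`; it is sent to the rotation by `θ` of this form, which vanishes at `θ` and at `θ + φ`. -/
noncomputable def pairMap (m : ℕ) (v : Fin (m + 2) → ℝ) : Fin (m + 2) → ℝ :=
  zeroMap (m + 1) (solveOne m v)

/-- The derivative of the coordinate `1` of `solveOne m`. -/
noncomputable def solveOneGrad (m : ℕ) (v : Fin (m + 2) → ℝ) : (Fin (m + 2) → ℝ) →L[ℝ] ℝ :=
  -(Real.sqrt (m + 1 : ℕ))⁻¹ • (tailSumDeriv m (v 1) (tail2 v) •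
      ContinuousLinearMap.proj (R := ℝ) (φ := fun _ : Fin (m + 2) => ℝ) 1 +
    ∑ j : Fin m, (Real.sqrt ((m + 1).choose (j + 2)) * Real.tan (v 1) ^ ((j : ℕ) + 1)) •
      ContinuousLinearMap.proj (R := ℝ) (φ := fun _ : Fin (m + 2) => ℝ) j.succ.succ)

theorem hasFDerivAt_solveOne_one (m : ℕ) (v : Fin (m + 2) → ℝ) (hv : Real.cos (v 1) ≠ 0) :
    HasFDerivAt (fun v : Fin (m + 2) → ℝ => -(tailSum m (v 1) (tail2 v)) / Real.sqrt (m + 1 : ℕ))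
      (solveOneGrad m v) v := by
  have hp : ∀ i : Fin (m + 2), HasFDerivAt (fun v : Fin (m + 2) → ℝ => v i)
      (ContinuousLinearMap.proj (R := ℝ) (φ := fun _ : Fin (m + 2) => ℝ) i) v := fun i =>
    (ContinuousLinearMap.proj (R := ℝ) (φ := fun _ : Fin (m + 2) => ℝ) i).hasFDerivAt
  have hsec : 1 / Real.cos (v 1) ^ 2 = 1 + Real.tan (v 1) ^ 2 := by
    rw [← Real.inv_one_add_tan_sq hv]; simp
  have ht : ∀ j : Fin m, HasDerivAt
      (fun x => Real.sqrt ((m + 1).choose (j + 2)) * Real.tan x ^ ((j : ℕ) + 1))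
      (Real.sqrt ((m + 1).choose (j + 2)) *
        (((j : ℕ) + 1) * Real.tan (v 1) ^ (j : ℕ) * (1 + Real.tan (v 1) ^ 2))) (v 1) := fun j => by
    have := ((Real.hasDerivAt_tan hv).pow ((j : ℕ) + 1)).const_mul
      (Real.sqrt ((m + 1).choose (j + 2)))
    rw [hsec] at this
    simpa using this
  have hs := HasFDerivAt.fun_sum (u := Finset.univ) fun (j : Fin m) _ =>
    (hp j.succ.succ).mul ((ht j).comp_hasFDerivAt v (hp 1))
  have h := (hs.neg).mul_const (Real.sqrt (m + 1 : ℕ))⁻¹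
  refine h.congr_fderiv ?_
  ext1 w
  simp only [solveOneGrad, tailSumDeriv, tail2, smul_apply, neg_apply,
    sum_apply, add_apply, ContinuousLinearMap.proj_apply, smul_eq_mul, Function.comp,
    Finset.sum_add_distrib, Finset.sum_mul]
  have e : ∀ a b c d x : ℝ, a = c → b = d → x * -(a + b) = -x * (c + d) := by
    rintro a b c d x rfl rfl; ring
  refine e _ _ _ _ _ (Finset.sum_congr rfl fun j _ => ?_) (Finset.sum_congr rfl fun j _ => ?_)
  all_goals ring

theorem solveOneGrad_single (m : ℕ) (v : Fin (m + 2) → ℝ) :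
    solveOneGrad m v (Pi.single 1 1) =
      -(tailSumDeriv m (v 1) (tail2 v)) / Real.sqrt (m + 1 : ℕ) := by
  have : ∀ j : Fin m, (Pi.single (1 : Fin (m + 2)) (1 : ℝ) : Fin (m + 2) → ℝ) j.succ.succ = 0 :=
    fun j => Pi.single_eq_of_ne (fun h => by simpa using congrArg Fin.val h) _
  simp [solveOneGrad, this]
  ring

/-- The derivative of `pairMap`. -/
noncomputable def pairMapDeriv (m : ℕ) (v : Fin (m + 2) → ℝ) :
    (Fin (m + 2) → ℝ) →L[ℝ] (Fin (m + 2) → ℝ) :=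
  (zeroMapDeriv (m + 1) (solveOne m v)).comp (ContinuousLinearMap.id ℝ _ +
    (solveOneGrad m v -
      ContinuousLinearMap.proj (R := ℝ) (φ := fun _ : Fin (m + 2) => ℝ) 1).smulRight
      (Pi.single 1 1 : Fin (m + 2) → ℝ))

theorem hasFDerivAt_pairMap (m : ℕ) (v : Fin (m + 2) → ℝ) (hv : Real.cos (v 1) ≠ 0) :
    HasFDerivAt (pairMap m) (pairMapDeriv m v) v := by
  refine (hasFDerivAt_zeroMap (m + 1) (solveOne m v)).comp v ?_
  rw [hasFDerivAt_pi']
  intro i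
  by_cases hi : i = 1
  · subst hi
    refine ((hasFDerivAt_solveOne_one m v hv).congr_of_eventuallyEq
      (Filter.Eventually.of_forall fun w => by simp [solveOne])).congr_fderiv ?_
    ext1 w
    simp
  · have h := (ContinuousLinearMap.proj (R := ℝ) (φ := fun _ : Fin (m + 2) => ℝ) i).hasFDerivAt
      (x := v)
    refine (h.congr_of_eventuallyEq
      (Filter.Eventually.of_forall fun w => by simp [solveOne, hi])).congr_fderiv ?_
    ext1 w
    simp [hi]

/-- The factor `√(m + 1) * |c₁|` from `zeroMap`, where `c₁ = -tailSum / √(m + 1)`, multiplies the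
partial derivative `|∂c₁/∂φ| = |tailSumDeriv| / √(m + 1)`. -/
theorem abs_det_pairMapDeriv (m : ℕ) (v : Fin (m + 2) → ℝ) :
    |(pairMapDeriv m v).det| =
      |tailSum m (v 1) (tail2 v)| * |tailSumDeriv m (v 1) (tail2 v)| / Real.sqrt (m + 1 : ℕ) := by
  have h : (pairMapDeriv m v).det = (zeroMapDeriv (m + 1) (solveOne m v)).det *
      (ContinuousLinearMap.id ℝ _ +
    (solveOneGrad m v -
      ContinuousLinearMap.proj (R := ℝ) (φ := fun _ : Fin (m + 2) => ℝ) 1).smulRight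
      (Pi.single 1 1 : Fin (m + 2) → ℝ)).det := LinearMap.det_comp _ _
  have hpos : 0 < Real.sqrt (m + 1 : ℕ) := Real.sqrt_pos.2 (by positivity)
  rw [h, abs_mul, abs_det_zeroMapDeriv, det_id_add_smulRight]
  simp only [sub_apply, ContinuousLinearMap.proj_apply, Pi.single_eq_same,
    add_sub_cancel, solveOneGrad_single, solveOne, update_self, abs_div, abs_neg, abs_of_pos hpos]
  field_simp

theorem pairMap_eq_iff {m : ℕ} {v c : Fin (m + 2) → ℝ} (hc : Real.cos (v 1) ≠ 0)
    (hs : Real.sin (v 1) ≠ 0) :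
    pairMap m v = c ↔ trigPoly (m + 1) c (v 0) = 0 ∧ trigPoly (m + 1) c (v 0 + v 1) = 0 ∧
      tail2 v = tail2 (rot (m + 1) (-(v 0)) c) := by
  have hpos : 0 < Real.sqrt (m + 1 : ℕ) := Real.sqrt_pos.2 (by positivity)
  have htan : Real.tan (v 1) ≠ 0 := by
    rw [Real.tan_eq_sin_div_cos]; exact div_ne_zero hs hc
  have h0 : solveOne m v 0 = v 0 := by simp [solveOne]
  set w := rot (m + 1) (-(v 0)) c with hw
  have hcw : trigPoly (m + 1) c (v 0 + v 1) = trigPoly (m + 1) w (v 1) := by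
    rw [← trigPoly_rot (m + 1) (v 0) (v 1) w, hw, rot_rot_neg]
  rw [pairMap, zeroMap_eq_iff, h0, hcw, ← rot_neg_apply_zero, ← hw]
  have key : w 0 = 0 → (trigPoly (m + 1) w (v 1) = 0 ↔
      w 1 = -(tailSum m (v 1) (tail2 w)) / Real.sqrt (m + 1 : ℕ)) := by
    intro hw0
    rw [trigPoly_of_apply_zero hw0 hc, eq_div_iff hpos.ne']
    simp only [mul_eq_zero, htan, hc, ne_eq, pow_eq_zero_iff, Nat.succ_ne_zero,
      not_false_eq_true, false_or, or_false]
    constructor <;> intro h <;> linarith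
  constructor
  · intro h
    have hw0 : w 0 = 0 := by rw [← h]; simp
    have ht : tail2 v = tail2 w := by rw [← h]; simp [solveOne]
    refine ⟨hw0, (key hw0).2 ?_, ht⟩
    rw [← ht, ← h]; simp [solveOne]
  · rintro ⟨hw0, hw1, ht⟩
    rw [key hw0, ← ht] at hw1
    ext i
    refine Fin.cases ?_ (fun i => Fin.cases ?_ (fun j => ?_) i) i
    · simp [hw0]
    · simp [solveOne, hw1]
    · have h1 : j.succ.succ ≠ (1 : Fin (m + 2)) := by
        intro h; simpa using congrArg Fin.val h
      simpa [solveOne, h1, tail2] using congrFun ht j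

/-- The domain of `pairMap` over pairs of angles in `I`: both angles lie in `I`, and their
difference is not a multiple of `π / 2`. -/
def pairDomain (m : ℕ) (I : Set ℝ) : Set (Fin (m + 2) → ℝ) :=
  {v | v 0 ∈ I ∧ v 0 + v 1 ∈ I ∧ Real.sin (v 1) ≠ 0 ∧ Real.cos (v 1) ≠ 0}

theorem encard_pairMap_fiber (m : ℕ) (I : Set ℝ) (c : Fin (m + 2) → ℝ) :
    (pairDomain m I ∩ pairMap m ⁻¹' {c}).encard =
      {p : ℝ × ℝ | p.1 ∈ trigZeros (m + 1) I c ∧ p.2 ∈ trigZeros (m + 1) I c ∧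
        Real.sin (p.2 - p.1) ≠ 0 ∧ Real.cos (p.2 - p.1) ≠ 0}.encard := by
  have hinj : InjOn (fun v : Fin (m + 2) → ℝ => (v 0, v 0 + v 1))
      (pairDomain m I ∩ pairMap m ⁻¹' {c}) := by
    rintro v ⟨⟨-, -, hvs, hvc⟩, hv⟩ w ⟨⟨-, -, hws, hwc⟩, hw⟩ hvw
    obtain ⟨-, -, hv⟩ := (pairMap_eq_iff hvc hvs).1 hv
    obtain ⟨-, -, hw⟩ := (pairMap_eq_iff hwc hws).1 hw
    simp only [Prod.mk.injEq] at hvw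
    obtain ⟨h0, h1⟩ := hvw
    rw [h0, ← hw] at hv
    ext i
    refine Fin.cases ?_ (fun i => Fin.cases ?_ (fun j => ?_) i) i
    · exact h0
    · change v 1 = w 1; linarith
    · exact congrFun hv j
  rw [← hinj.encard_image]
  congr 1
  ext ⟨θ, θ'⟩
  constructor
  · rintro ⟨v, ⟨⟨h0, h1, hs, hc⟩, hv⟩, hvp⟩
    obtain ⟨hz0, hz1, -⟩ := (pairMap_eq_iff hc hs).1 hv
    simp only [Prod.mk.injEq] at hvp
    obtain ⟨rfl, rfl⟩ := hvp
    exact ⟨⟨h0, hz0⟩, ⟨h1, hz1⟩, by simpa using hs, by simpa using hc⟩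
  · rintro ⟨⟨h0, hz0⟩, ⟨h1, hz1⟩, hs, hc⟩
    simp only at h0 h1 hz0 hz1 hs hc
    refine ⟨update (update (rot (m + 1) (-θ) c) 1 (θ' - θ)) 0 θ, ⟨⟨?_, ?_, ?_, ?_⟩, ?_⟩, ?_⟩
    · simpa using h0
    · simpa using h1
    · simpa using hs
    · simpa using hc
    · refine (pairMap_eq_iff (by simpa using hc) (by simpa using hs)).2 ⟨?_, ?_, ?_⟩
      · simpa using hz0
      · simpa using hz1
      · simp
    · simp

theorem tsum_pairMap_fiber (m : ℕ) (I : Set ℝ) (c : Fin (m + 2) → ℝ) :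
    ∑' v : ↥(pairDomain m I ∩ pairMap m ⁻¹' {c}),
      stdDensity (dropZero (m + 1) (solveOne m v)) =
      stdDensity c * {p : ℝ × ℝ | p.1 ∈ trigZeros (m + 1) I c ∧ p.2 ∈ trigZeros (m + 1) I c ∧
        Real.sin (p.2 - p.1) ≠ 0 ∧ Real.cos (p.2 - p.1) ≠ 0}.encard := by
  have : ∀ v : ↥(pairDomain m I ∩ pairMap m ⁻¹' {c}),
      stdDensity (dropZero (m + 1) (solveOne m v)) = stdDensity c * 1 := by
    intro v
    have hv : rot (m + 1) (solveOne m v.1 0) (dropZero (m + 1) (solveOne m v)) = c := v.2.2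
    rw [mul_one, ← stdDensity_rot (m + 1) (solveOne m v.1 0), hv]
  rw [tsum_congr this, ENNReal.tsum_mul_left, ENNReal.tsum_set_one, encard_pairMap_fiber]

theorem measurable_tailSum (m : ℕ) :
    Measurable fun v : Fin (m + 2) → ℝ => tailSum m (v 1) (tail2 v) := by
  simp only [tailSum, tail2, Real.tan_eq_sin_div_cos]
  fun_prop

theorem measurable_tailSumDeriv (m : ℕ) :
    Measurable fun v : Fin (m + 2) → ℝ => tailSumDeriv m (v 1) (tail2 v) := by
  simp only [tailSumDeriv, tail2, Real.tan_eq_sin_div_cos]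
  fun_prop

theorem measurable_solveOne (m : ℕ) : Measurable (solveOne m) := by
  rw [measurable_pi_iff]
  intro i
  by_cases hi : i = 1
  · subst hi
    simp only [solveOne, update_self]
    exact (measurable_tailSum m).neg.div_const _
  · simp only [solveOne, update_of_ne hi]
    fun_prop

theorem lintegral_stdDensity_mul_encard_pairs (m : ℕ) {I : Set ℝ} (hI : MeasurableSet I) :
    ∫⁻ c : Fin (m + 2) → ℝ, stdDensity c *
        ({p : ℝ × ℝ | p.1 ∈ trigZeros (m + 1) I c ∧ p.2 ∈ trigZeros (m + 1) I c ∧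
        Real.sin (p.2 - p.1) ≠ 0 ∧ Real.cos (p.2 - p.1) ≠ 0}.encard : ℝ≥0∞) =
      ∫⁻ v in pairDomain m I,
          ENNReal.ofReal (|tailSum m (v 1) (tail2 v)| * |tailSumDeriv m (v 1) (tail2 v)| /
            Real.sqrt (m + 1 : ℕ)) * stdDensity (dropZero (m + 1) (solveOne m v)) := by
  have hs : MeasurableSet (pairDomain m I) :=
    (measurable_pi_apply 0 hI).inter
      ((((measurable_pi_apply 0).add (measurable_pi_apply 1)) hI).inter
        ((measurableSet_eq_fun (by fun_prop) measurable_const).compl.inter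
          (measurableSet_eq_fun (by fun_prop) measurable_const).compl))
  have hdet : MeasurableSet {v | v ∈ pairDomain m I ∧ (pairMapDeriv m v).det ≠ 0} := by
    refine hs.inter ?_
    have : {v : Fin (m + 2) → ℝ | (pairMapDeriv m v).det ≠ 0} =
        {v | |tailSum m (v 1) (tail2 v)| * |tailSumDeriv m (v 1) (tail2 v)| /
          Real.sqrt (m + 1 : ℕ) ≠ 0} := by
      ext v
      simp only [mem_ofPred_eq, ← abs_det_pairMapDeriv, ne_eq, abs_eq_zero]
    change MeasurableSet {v : Fin (m + 2) → ℝ | (pairMapDeriv m v).det ≠ 0}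
    rw [this]
    refine (measurableSet_eq_fun ?_ measurable_const).compl
    exact (((measurable_tailSum m).abs).mul ((measurable_tailSumDeriv m).abs)).div_const _
  have := (lintegral_tsum_fiber_eq volume hs
    (fun v hv => (hasFDerivAt_pairMap m v hv.2.2.2).hasFDerivWithinAt) hdet
    (h := fun v => stdDensity (dropZero (m + 1) (solveOne m v)))
    (measurable_stdDensity.comp
      ((dropZero (m + 1)).continuous.measurable.comp (measurable_solveOne m)))).2
  simp only [tsum_pairMap_fiber, abs_det_pairMapDeriv] at this
  exact this

/-- Almost surely no two zeros differ by an odd multiple of `π / 2`: such coefficient vectors are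
the image under `zeroMap` of the hyperplane on which the leading coefficient vanishes. -/
theorem ae_cos_sub_ne_zero (n : ℕ) (hn : n ≠ 0) : ∀ᵐ c : Fin (n + 1) → ℝ, ∀ θ θ' : ℝ,
    trigPoly n c θ = 0 → trigPoly n c θ' = 0 → Real.cos (θ' - θ) ≠ 0 := by
  have h0 : volume {v : Fin (n + 1) → ℝ | v (Fin.last n) = 0} = 0 :=
    Measure.pi_hyperplane (fun _ => volume) _ _
  have himg := addHaar_image_eq_zero_of_differentiableOn_of_addHaar_eq_zero volume
    (f := zeroMap n) (fun v _ => (hasFDerivAt_zeroMap n v).differentiableAt.differentiableWithinAt)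
    h0
  rw [ae_iff]
  refine measure_mono_null ?_ himg
  intro c hc
  simp only [mem_ofPred_eq, not_forall, not_not] at hc
  obtain ⟨θ, θ', h1, h2, h3⟩ := hc
  refine ⟨_, ?_, zeroMap_update_rot h1⟩
  have hl : Fin.last n ≠ 0 := by
    intro h; exact hn (by simpa using congrArg Fin.val h)
  have h4 := trigPoly_rot n θ (θ' - θ) (rot n (-θ) c)
  rw [rot_rot_neg, add_sub_cancel, h2, trigPoly_of_cos_eq_zero _ h3] at h4
  have h5 : Real.sin (θ' - θ) ≠ 0 := by
    intro h; have := Real.sin_sq_add_cos_sq (θ' - θ); simp [h, h3] at this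
  simpa [hl, h5] using h4.symm

/-! ### Absolute moments of a Gaussian pair -/

theorem charFun_stdGaussian_one (t : ℝ) :
    charFun (gaussianReal 0 1) t = Complex.exp (-(t ^ 2 / 2 : ℝ)) := by
  rw [charFun_gaussianReal]; congr 1; push_cast; ring

theorem charFunDual_real (μ : Measure ℝ) (L : StrongDual ℝ ℝ) :
    charFunDual μ L = charFun μ (L 1) := by
  rw [charFunDual_apply, charFun_apply_real]
  refine integral_congr_ae (Filter.Eventually.of_forall fun x => ?_)
  have : L x = L 1 * x := by
    have := L.map_smul x 1
    rw [smul_eq_mul, mul_one, smul_eq_mul] at this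
    rw [this, mul_comm]
  simp only [this]; push_cast; rfl

/-- Two linear functionals of a standard Gaussian vector have the law of two linear combinations of
two independent standard Gaussian variables, with the same covariance matrix. -/
theorem map_pi_gaussianReal_dotProduct {m : ℕ} (a b : Fin m → ℝ) {α β τ : ℝ}
    (h1 : α ^ 2 = a ⬝ᵥ a) (h2 : α * β = a ⬝ᵥ b) (h3 : β ^ 2 + τ ^ 2 = b ⬝ᵥ b) :
    (Measure.pi fun _ : Fin m => gaussianReal 0 1).map (fun y => (a ⬝ᵥ y, b ⬝ᵥ y)) =
      ((gaussianReal 0 1).prod (gaussianReal 0 1)).map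
        (fun p : ℝ × ℝ => (α * p.1, β * p.1 + τ * p.2)) := by
  let L1 : (Fin m → ℝ) →L[ℝ] ℝ × ℝ := LinearMap.toContinuousLinearMap
    { toFun := fun y => (a ⬝ᵥ y, b ⬝ᵥ y)
      map_add' := fun x y => by simp [dotProduct_add]
      map_smul' := fun c y => by simp [dotProduct_smul] }
  let L2 : ℝ × ℝ →L[ℝ] ℝ × ℝ := LinearMap.toContinuousLinearMap
    { toFun := fun p => (α * p.1, β * p.1 + τ * p.2)
      map_add' := fun x y => by ext <;> simp <;> ring
      map_smul' := fun c y => by ext <;> simp <;> ring }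
  change Measure.map L1 _ = Measure.map L2 _
  have := Measure.isProbabilityMeasure_map (μ := Measure.pi fun _ : Fin m => gaussianReal 0 1)
    (f := L1) (by fun_prop)
  have := Measure.isProbabilityMeasure_map (μ := (gaussianReal 0 1).prod (gaussianReal 0 1))
    (f := L2) (by fun_prop)
  refine Measure.ext_of_charFunDual ?_
  ext L
  rw [charFunDual_map, charFunDual_map, charFunDual_pi, charFunDual_prod]
  simp only [charFunDual_real, charFun_stdGaussian_one]
  rw [← Complex.exp_sum, ← Complex.exp_add]
  congr 1
  have hL : ∀ p : ℝ × ℝ, L p = L (1, 0) * p.1 + L (0, 1) * p.2 := by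
    intro p
    have : p = p.1 • ((1 : ℝ), (0 : ℝ)) + p.2 • ((0 : ℝ), (1 : ℝ)) := by ext <;> simp
    have h := congrArg L this
    rw [map_add, map_smul, map_smul, smul_eq_mul, smul_eq_mul] at h
    rw [h]; ring
  set s := L (1, 0)
  set t := L (0, 1)
  have e1 : ∀ i, ((L.comp L1).comp (ContinuousLinearMap.single ℝ (fun _ : Fin m => ℝ) i)) 1 =
      s * a i + t * b i := by
    intro i
    simp [L1, hL]
  have e2 : ((L.comp L2).comp (ContinuousLinearMap.inl ℝ ℝ ℝ)) 1 = s * α + t * β := by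
    simp [L2, hL]
  have e3 : ((L.comp L2).comp (ContinuousLinearMap.inr ℝ ℝ ℝ)) 1 = t * τ := by
    simp [L2, hL]
  simp only [e1, e2, e3]
  norm_cast
  simp only [dotProduct] at h1 h2 h3
  have : ∑ i, (s * a i + t * b i) ^ 2 = s ^ 2 * α ^ 2 + 2 * s * t * (α * β) +
      t ^ 2 * (β ^ 2 + τ ^ 2) := by
    rw [h1, h2, h3, Finset.mul_sum, Finset.mul_sum, Finset.mul_sum, ← Finset.sum_add_distrib,
      ← Finset.sum_add_distrib]
    exact Finset.sum_congr rfl fun i _ => by ring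
  rw [Finset.sum_neg_distrib, ← Finset.sum_div, this]
  ring

theorem integral_pow_mul_exp_neg_sq (k : ℕ) :
    IntegrableOn (fun x : ℝ => x ^ k * Real.exp (-x ^ 2 / 2)) (Ioi 0) ∧
    ∫ x in Ioi (0 : ℝ), x ^ k * Real.exp (-x ^ 2 / 2) =
      (1 / 2) ^ (-((k : ℝ) + 1) / 2) * (1 / 2) * Real.Gamma (((k : ℝ) + 1) / 2) := by
  have hk : (-1 : ℝ) < k := by have : (0 : ℝ) ≤ k := k.cast_nonneg; linarith
  have e : ∀ x : ℝ, x ^ (k : ℝ) * Real.exp (-(1 / 2) * x ^ (2 : ℝ)) =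
      x ^ k * Real.exp (-x ^ 2 / 2) := by
    intro x
    rw [Real.rpow_natCast, Real.rpow_two]; congr 2; ring
  have h1 := integrableOn_rpow_mul_exp_neg_mul_rpow hk (by norm_num : (0 : ℝ) < 2)
    (by norm_num : (0 : ℝ) < 1 / 2)
  have h2 := integral_rpow_mul_exp_neg_mul_rpow (by norm_num : (0 : ℝ) < 2) hk
    (by norm_num : (0 : ℝ) < 1 / 2)
  simp only [e] at h1 h2
  exact ⟨h1, h2⟩

theorem lintegral_Ioi_mul_exp_neg_sq :
    ∫⁻ x in Ioi (0 : ℝ), ENNReal.ofReal (x * Real.exp (-x ^ 2 / 2)) = 1 := by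
  obtain ⟨h1, h2⟩ := integral_pow_mul_exp_neg_sq 1
  simp only [pow_one] at h1 h2
  rw [← ofReal_integral_eq_lintegral_ofReal h1
    ((ae_restrict_mem measurableSet_Ioi).mono fun x hx =>
      mul_nonneg (le_of_lt hx) (Real.exp_nonneg _)), h2]
  norm_num [Real.rpow_neg_one]

theorem lintegral_Ioi_pow_three_mul_exp_neg_sq :
    ∫⁻ x in Ioi (0 : ℝ), ENNReal.ofReal (x ^ 3 * Real.exp (-x ^ 2 / 2)) = 2 := by
  obtain ⟨h1, h2⟩ := integral_pow_mul_exp_neg_sq 3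
  rw [← ofReal_integral_eq_lintegral_ofReal h1
    ((ae_restrict_mem measurableSet_Ioi).mono fun x hx =>
      mul_nonneg (pow_nonneg (le_of_lt hx) _) (Real.exp_nonneg _)), h2]
  have : ((1 : ℝ) / 2) ^ (-((3 : ℕ) + 1 : ℝ) / 2) = 4 := by
    rw [show -((3 : ℕ) + 1 : ℝ) / 2 = ((-2 : ℤ) : ℝ) by norm_num, Real.rpow_intCast]; norm_num
  rw [this]
  norm_num [Real.Gamma_two]

/-- `E |X| = √(2 / π)` for a standard Gaussian variable. -/
theorem lintegral_gaussianPDF_mul_abs :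
    ∫⁻ x, gaussianPDF 0 1 x * ENNReal.ofReal |x| =
      ENNReal.ofReal (2 / Real.sqrt (2 * Real.pi)) := by
  have h : ∀ x : ℝ, gaussianPDF 0 1 x * ENNReal.ofReal |x| =
      ENNReal.ofReal (Real.sqrt (2 * Real.pi))⁻¹ *
        ENNReal.ofReal (|x| * Real.exp (-|x| ^ 2 / 2)) := by
    intro x
    rw [gaussianPDF, gaussianPDFReal, ← ENNReal.ofReal_mul (by positivity),
      ← ENNReal.ofReal_mul (by positivity)]
    congr 1
    simp only [NNReal.coe_one, mul_one, sub_zero, sq_abs]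
    ring
  simp only [h]
  rw [lintegral_const_mul _ (by fun_prop),
    ← lintegral_add_compl _ (measurableSet_Ioi (a := (0 : ℝ))),
    compl_Ioi]
  have e1 : ∫⁻ x in Ioi (0 : ℝ), ENNReal.ofReal (|x| * Real.exp (-|x| ^ 2 / 2)) = 1 := by
    rw [← lintegral_Ioi_mul_exp_neg_sq]
    refine setLIntegral_congr_fun measurableSet_Ioi fun x hx => ?_
    simp only [abs_of_pos (show (0 : ℝ) < x from hx)]
  have e2 : ∫⁻ x in Iic (0 : ℝ), ENNReal.ofReal (|x| * Real.exp (-|x| ^ 2 / 2)) = 1 := by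
    rw [← e1, ← (Measure.measurePreserving_neg (volume : Measure ℝ)).setLIntegral_comp_preimage_emb
      (MeasurableEquiv.neg ℝ).measurableEmbedding, setLIntegral_congr Ioi_ae_eq_Ici]
    simp
  rw [e1, e2, show (1 : ℝ≥0∞) + 1 = ENNReal.ofReal 2 by norm_num,
    ← ENNReal.ofReal_mul (by positivity)]
  congr 1; ring

/-- With `2 cos θ cos (θ - δ) = cos (2θ - δ) + cos δ`, this is an integral of `|cos u + cos δ|`
over two periods. -/
theorem integral_abs_cos_mul_cos {δ : ℝ} (h0 : 0 ≤ δ) (h1 : δ ≤ Real.pi) :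
    ∫ θ in (-Real.pi)..Real.pi, |Real.cos θ * Real.cos (θ - δ)| =
      2 * Real.sin δ + (Real.pi - 2 * δ) * Real.cos δ := by
  have e : ∀ θ, |Real.cos θ * Real.cos (θ - δ)| =
      (1 / 2) * |Real.cos (2 * θ - δ) + Real.cos δ| := by
    intro θ
    rw [← abs_of_pos (by norm_num : (0 : ℝ) < 1 / 2), ← abs_mul]
    congr 1
    have h1 : 2 * θ - δ = θ + (θ - δ) := by ring
    have h2 : Real.cos δ = Real.cos (θ - (θ - δ)) := by congr 1; ring
    rw [h1, h2, Real.cos_add, Real.cos_sub θ (θ - δ)]; ring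
  set h : ℝ → ℝ := fun u => |Real.cos u + Real.cos δ| with hh
  have hper : Function.Periodic h (2 * Real.pi) := fun u => by simp [hh]
  have hc : Continuous h := by fun_prop
  have hint : ∀ a b, IntervalIntegrable h volume a b := fun a b => hc.intervalIntegrable a b
  have e2 : ∫ θ in (-Real.pi)..Real.pi, h (2 * θ - δ) = ∫ u in (0 : ℝ)..(2 * Real.pi), h u := by
    rw [intervalIntegral.integral_comp_mul_sub h two_ne_zero]
    have s1 : ∫ u in (2 * -Real.pi - δ)..(2 * Real.pi - δ), h u =
        (∫ u in (2 * -Real.pi - δ)..(2 * -Real.pi - δ + 2 * Real.pi), h u) +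
        ∫ u in (2 * -Real.pi - δ + 2 * Real.pi)..(2 * -Real.pi - δ + 2 * Real.pi + 2 * Real.pi),
          h u := by
      rw [intervalIntegral.integral_add_adjacent_intervals (hint _ _) (hint _ _)]
      congr 1; ring
    rw [s1, hper.intervalIntegral_add_eq (2 * -Real.pi - δ) 0,
      hper.intervalIntegral_add_eq (2 * -Real.pi - δ + 2 * Real.pi) 0, zero_add, smul_eq_mul]
    ring
  have e3 : ∫ u in (0 : ℝ)..(2 * Real.pi), h u = 2 * ∫ u in (0 : ℝ)..Real.pi, h u := by
    rw [← intervalIntegral.integral_add_adjacent_intervals (hint 0 Real.pi) (hint _ _)]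
    have : ∫ u in Real.pi..(2 * Real.pi), h u = ∫ u in (0 : ℝ)..Real.pi, h u := by
      have := intervalIntegral.integral_comp_sub_left (a := 0) (b := Real.pi) h (2 * Real.pi)
      rw [show 2 * Real.pi - Real.pi = Real.pi by ring, sub_zero] at this
      rw [← this]
      refine intervalIntegral.integral_congr fun u _ => ?_
      simp [hh, Real.cos_two_pi_sub]
    rw [this]; ring
  have e4 : ∫ u in (0 : ℝ)..Real.pi, h u =
      2 * Real.sin δ + (Real.pi - 2 * δ) * Real.cos δ := by
    rw [← intervalIntegral.integral_add_adjacent_intervals (hint 0 (Real.pi - δ)) (hint _ _)]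
    have p1 : ∫ u in (0 : ℝ)..(Real.pi - δ), h u =
        ∫ u in (0 : ℝ)..(Real.pi - δ), (Real.cos u + Real.cos δ) := by
      refine intervalIntegral.integral_congr fun u hu => ?_
      rw [uIcc_of_le (by linarith)] at hu
      have : Real.cos (Real.pi - δ) ≤ Real.cos u :=
        Real.cos_le_cos_of_nonneg_of_le_pi hu.1 (by linarith) hu.2
      rw [Real.cos_pi_sub] at this
      exact abs_of_nonneg (by linarith)
    have p2 : ∫ u in (Real.pi - δ)..Real.pi, h u =
        ∫ u in (Real.pi - δ)..Real.pi, -(Real.cos u + Real.cos δ) := by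
      refine intervalIntegral.integral_congr fun u hu => ?_
      rw [uIcc_of_le (by linarith)] at hu
      have : Real.cos u ≤ Real.cos (Real.pi - δ) :=
        Real.cos_le_cos_of_nonneg_of_le_pi (by linarith) hu.2 hu.1
      rw [Real.cos_pi_sub] at this
      exact abs_of_nonpos (by linarith)
    rw [p1, p2, intervalIntegral.integral_neg, intervalIntegral.integral_add (by simp) (by simp),
      intervalIntegral.integral_add (by simp) (by simp)]
    simp
    ring
  simp only [e]
  rw [intervalIntegral.integral_const_mul, e2, e3, e4]
  ring

/-- `2π E |X| |βX + τY|` for independent standard Gaussian variables, computed in polar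
coordinates; here `(β, τ) = R (cos δ, sin δ)`. -/
theorem lintegral_exp_mul_abs_mul_abs {R δ : ℝ} (hR : 0 ≤ R) (h0 : 0 ≤ δ) (h1 : δ ≤ Real.pi) :
    ∫⁻ p : ℝ × ℝ, ENNReal.ofReal (Real.exp (-(p.1 ^ 2 + p.2 ^ 2) / 2) *
        (|p.1| * |R * Real.cos δ * p.1 + R * Real.sin δ * p.2|)) =
      ENNReal.ofReal (2 * R * (2 * Real.sin δ + (Real.pi - 2 * δ) * Real.cos δ)) := by
  rw [← lintegral_comp_polarCoord_symm]
  have e : ∀ p ∈ polarCoord.target, ENNReal.ofReal p.1 •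
      ENNReal.ofReal (Real.exp (-((polarCoord.symm p).1 ^ 2 + (polarCoord.symm p).2 ^ 2) / 2) *
        (|(polarCoord.symm p).1| *
          |R * Real.cos δ * (polarCoord.symm p).1 + R * Real.sin δ * (polarCoord.symm p).2|)) =
      ENNReal.ofReal (p.1 ^ 3 * Real.exp (-p.1 ^ 2 / 2)) *
        ENNReal.ofReal (R * |Real.cos p.2 * Real.cos (p.2 - δ)|) := by
    rintro ⟨r, θ⟩ ⟨hr, -⟩
    have hr : 0 < r := hr
    simp only [polarCoord_symm_apply, smul_eq_mul]
    rw [← ENNReal.ofReal_mul hr.le, ← ENNReal.ofReal_mul (by positivity)]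
    congr 1
    have a1 : (r * Real.cos θ) ^ 2 + (r * Real.sin θ) ^ 2 = r ^ 2 := by
      linear_combination r ^ 2 * Real.cos_sq_add_sin_sq θ
    have a2 : R * Real.cos δ * (r * Real.cos θ) + R * Real.sin δ * (r * Real.sin θ) =
        R * r * Real.cos (θ - δ) := by rw [Real.cos_sub]; ring
    rw [a1, a2, abs_mul, abs_mul, abs_mul, abs_mul, abs_of_pos hr, abs_of_nonneg hR]
    ring
  rw [setLIntegral_congr_fun (polarCoord.open_target.measurableSet) e]
  change ∫⁻ p in Ioi (0 : ℝ) ×ˢ Ioo (-Real.pi) Real.pi, _ = _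
  rw [Measure.volume_eq_prod, ← Measure.prod_restrict,
    lintegral_prod_mul (f := fun r : ℝ => ENNReal.ofReal (r ^ 3 * Real.exp (-r ^ 2 / 2)))
      (g := fun θ : ℝ => ENNReal.ofReal (R * |Real.cos θ * Real.cos (θ - δ)|))
      (by fun_prop) (by fun_prop), lintegral_Ioi_pow_three_mul_exp_neg_sq]
  have hc : Continuous fun θ => R * |Real.cos θ * Real.cos (θ - δ)| := by fun_prop
  have hi : IntegrableOn (fun θ => R * |Real.cos θ * Real.cos (θ - δ)|)
      (Ioc (-Real.pi) Real.pi) volume := (hc.intervalIntegrable _ _).1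
  rw [setLIntegral_congr Ioo_ae_eq_Ioc, ← ofReal_integral_eq_lintegral_ofReal hi
      (Filter.Eventually.of_forall fun θ => by positivity),
    ← intervalIntegral.integral_of_le (by linarith [Real.pi_pos]),
    intervalIntegral.integral_const_mul, integral_abs_cos_mul_cos h0 h1,
    show (2 : ℝ≥0∞) = ENNReal.ofReal 2 by norm_num, ← ENNReal.ofReal_mul (by norm_num)]
  congr 1; ring

theorem lintegral_comp_const_mul {κ : ℝ} (hκ : 0 < κ) (g : ℝ → ℝ≥0∞) :
    ∫⁻ x, g (κ * x) = ENNReal.ofReal κ⁻¹ * ∫⁻ x, g x := by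
  have h := (Homeomorph.mulLeft₀ κ hκ.ne').measurableEmbedding.lintegral_map g (μ := volume)
  simp only [Homeomorph.coe_mulLeft₀] at h
  rw [← h, Real.map_volume_mul_left hκ.ne', lintegral_smul_measure, abs_of_pos (inv_pos.2 hκ),
    smul_eq_mul]

/-- `E exp(-l U² / 2) |U| |V|` for the Gaussian pair `U = αX`, `V = βX + τY`. The exponential
weight rescales `X` by `κ⁻¹` with `κ² = 1 + l α²`; under the new law `V` has variance
`β² / κ² + τ²`, and its correlation with `X` appears in the arcsine. -/
theorem lintegral_exp_neg_sq_mul_abs_mul_abs {α β τ l : ℝ} (hα : 0 ≤ α) (hτ : 0 ≤ τ) (hl : 0 ≤ l) :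
    ∫⁻ p : ℝ × ℝ, ENNReal.ofReal (Real.exp (-(l * (α * p.1) ^ 2) / 2) *
        (|α * p.1| * |β * p.1 + τ * p.2|)) ∂((gaussianReal 0 1).prod (gaussianReal 0 1)) =
      ENNReal.ofReal (2 / Real.pi * (α / (1 + l * α ^ 2)) *
        (Real.sqrt (β ^ 2 / (1 + l * α ^ 2) + τ ^ 2) *
          (Real.sqrt (1 - (β / Real.sqrt (1 + l * α ^ 2) /
              Real.sqrt (β ^ 2 / (1 + l * α ^ 2) + τ ^ 2)) ^ 2) +
            (β / Real.sqrt (1 + l * α ^ 2) / Real.sqrt (β ^ 2 / (1 + l * α ^ 2) + τ ^ 2)) *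
              Real.arcsin (β / Real.sqrt (1 + l * α ^ 2) /
                Real.sqrt (β ^ 2 / (1 + l * α ^ 2) + τ ^ 2))))) := by
  set q := 1 + l * α ^ 2 with hq
  have hq0 : 0 < q := by positivity
  set κ := Real.sqrt q with hκ
  have hκ0 : 0 < κ := Real.sqrt_pos.2 hq0
  have hκ2 : κ ^ 2 = q := Real.sq_sqrt hq0.le
  set R := Real.sqrt (β ^ 2 / q + τ ^ 2) with hR
  have hR0 : 0 ≤ R := Real.sqrt_nonneg _
  have hR2 : R ^ 2 = β ^ 2 / q + τ ^ 2 := Real.sq_sqrt (by positivity)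
  set ρ := β / κ / R with hρ
  have hβκ : (β / κ) ^ 2 = β ^ 2 / q := by rw [div_pow, hκ2]
  have hρR : ρ * R = β / κ := by
    -- if `R = 0`, the quotient `ρ` is a junk value, but then `β = 0` as well
    rcases hR0.eq_or_lt with h | h
    · have : (β / κ) ^ 2 = 0 := by
        rw [← h] at hR2
        nlinarith [sq_nonneg τ, sq_nonneg (β / κ)]
      rw [← h, mul_zero]; exact (pow_eq_zero_iff two_ne_zero).1 this |>.symm
    · rw [hρ]; field_simp
  have hρ1 : ρ ^ 2 ≤ 1 := by
    rcases hR0.eq_or_lt with h | h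
    · rw [hρ, ← h]; norm_num
    · have : ρ ^ 2 * R ^ 2 ≤ 1 * R ^ 2 := by
        rw [← mul_pow, hρR, hβκ, one_mul, hR2]; nlinarith [sq_nonneg τ]
      exact le_of_mul_le_mul_right this (by positivity)
  have habs : |ρ| ≤ 1 := (sq_le_one_iff_abs_le_one ρ).1 hρ1
  set δ := Real.arccos ρ with hδ
  have hcos : Real.cos δ = ρ := Real.cos_arccos (abs_le.1 habs).1 (abs_le.1 habs).2
  have hsin : Real.sin δ = Real.sqrt (1 - ρ ^ 2) := Real.sin_arccos ρ
  have hRs : R * Real.sin δ = τ := by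
    rw [hsin]
    refine (sq_eq_sq₀ (by positivity) hτ).1 ?_
    rw [mul_pow, Real.sq_sqrt (sub_nonneg.2 hρ1)]
    have : ρ ^ 2 * R ^ 2 = β ^ 2 / q := by rw [← mul_pow, hρR, hβκ]
    nlinarith
  have hRc : R * Real.cos δ = β / κ := by rw [hcos, mul_comm, hρR]
  have hgauss : gaussianReal 0 1 = volume.withDensity (gaussianPDF 0 1) :=
    gaussianReal_of_var_ne_zero 0 one_ne_zero
  rw [hgauss, prod_withDensity (measurable_gaussianPDF 0 1) (measurable_gaussianPDF 0 1),
    lintegral_withDensity_eq_lintegral_mul _ (by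
      exact ((measurable_gaussianPDF 0 1).comp measurable_fst).mul
        ((measurable_gaussianPDF 0 1).comp measurable_snd)) (by fun_prop)]
  have e : ∀ p : ℝ × ℝ, ((fun z : ℝ × ℝ => gaussianPDF 0 1 z.1 * gaussianPDF 0 1 z.2) *
      fun p : ℝ × ℝ => ENNReal.ofReal (Real.exp (-(l * (α * p.1) ^ 2) / 2) *
        (|α * p.1| * |β * p.1 + τ * p.2|))) p =
      ENNReal.ofReal ((2 * Real.pi)⁻¹ * (α / κ)) *
        ENNReal.ofReal (Real.exp (-((κ * p.1) ^ 2 + p.2 ^ 2) / 2) *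
        (|κ * p.1| * |R * Real.cos δ * (κ * p.1) + R * Real.sin δ * p.2|)) := by
    intro p
    simp only [Pi.mul_apply, gaussianPDF, gaussianPDFReal, NNReal.coe_one, mul_one, sub_zero]
    rw [← ENNReal.ofReal_mul (by positivity), ← ENNReal.ofReal_mul (by positivity),
      ← ENNReal.ofReal_mul (by positivity)]
    congr 1
    have a1 : Real.exp (-((κ * p.1) ^ 2 + p.2 ^ 2) / 2) =
        Real.exp (-p.1 ^ 2 / 2) * Real.exp (-p.2 ^ 2 / 2) *
          Real.exp (-(l * (α * p.1) ^ 2) / 2) := by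
      rw [← Real.exp_add, ← Real.exp_add, mul_pow, hκ2, hq]; congr 1; ring
    have a2 : R * Real.cos δ * (κ * p.1) + R * Real.sin δ * p.2 = β * p.1 + τ * p.2 := by
      rw [hRc, hRs]; field_simp
    have a3 : (Real.sqrt (2 * Real.pi))⁻¹ * (Real.sqrt (2 * Real.pi))⁻¹ = (2 * Real.pi)⁻¹ := by
      rw [← mul_inv, Real.mul_self_sqrt (by positivity)]
    rw [a1, a2, ← a3, abs_mul, abs_mul, abs_of_nonneg hα, abs_of_pos hκ0]
    field_simp
  simp only [e]
  rw [lintegral_const_mul _ (by fun_prop), ← Measure.volume_eq_prod]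
  have e2 : ∫⁻ p : ℝ × ℝ, ENNReal.ofReal (Real.exp (-((κ * p.1) ^ 2 + p.2 ^ 2) / 2) *
        (|κ * p.1| * |R * Real.cos δ * (κ * p.1) + R * Real.sin δ * p.2|)) =
      ENNReal.ofReal κ⁻¹ * ∫⁻ p : ℝ × ℝ, ENNReal.ofReal (Real.exp (-(p.1 ^ 2 + p.2 ^ 2) / 2) *
        (|p.1| * |R * Real.cos δ * p.1 + R * Real.sin δ * p.2|)) := by
    rw [Measure.volume_eq_prod, lintegral_prod_symm _ (by fun_prop),
      lintegral_prod_symm _ (by fun_prop), ← lintegral_const_mul _ (by fun_prop)]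
    refine lintegral_congr fun y => ?_
    exact lintegral_comp_const_mul hκ0 (fun x => ENNReal.ofReal (Real.exp (-(x ^ 2 + y ^ 2) / 2) *
        (|x| * |R * Real.cos δ * x + R * Real.sin δ * y|)))
  rw [e2, lintegral_exp_mul_abs_mul_abs hR0 (Real.arccos_nonneg ρ) (Real.arccos_le_pi ρ),
    ← ENNReal.ofReal_mul (by positivity), ← ENNReal.ofReal_mul (by positivity)]
  congr 1
  have hδ2 : Real.pi - 2 * δ = 2 * Real.arcsin ρ := by
    rw [hδ, Real.arccos_eq_pi_div_two_sub_arcsin]; ring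
  rw [hδ2, hcos, hsin, ← hκ2]
  field_simp

/-! ### Gaussian integrals in coordinates, and the Gram matrix of the tail functionals -/

theorem lintegral_pi_succ {d : ℕ} (μ : Fin (d + 1) → Measure ℝ) [∀ i, SigmaFinite (μ i)]
    {f : (Fin (d + 1) → ℝ) → ℝ≥0∞} (hf : Measurable f) :
    ∫⁻ v, f v ∂Measure.pi μ =
      ∫⁻ x, ∫⁻ y, f (Fin.cons x y) ∂Measure.pi (fun i => μ i.succ) ∂μ 0 := by
  have h := (measurePreserving_piFinSuccAbove (α := fun _ => ℝ) μ 0).symm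
  rw [← h.lintegral_comp_emb (MeasurableEquiv.measurableEmbedding _), lintegral_prod]
  · simp [MeasurableEquiv.piFinSuccAbove, Fin.insertNthEquiv]
  · exact (hf.comp (MeasurableEquiv.measurable _)).aemeasurable

theorem lintegral_volume_succ {d : ℕ} {f : (Fin (d + 1) → ℝ) → ℝ≥0∞} (hf : Measurable f) :
    ∫⁻ v, f v = ∫⁻ x, ∫⁻ y : Fin d → ℝ, f (Fin.cons x y) :=
  lintegral_pi_succ (fun _ => volume) hf

theorem lintegral_pi_prod {d : ℕ} (μ : Fin d → Measure ℝ) [∀ i, SigmaFinite (μ i)]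
    {f : Fin d → ℝ → ℝ≥0∞} (hf : ∀ i, Measurable (f i)) :
    ∫⁻ v, ∏ i, f i (v i) ∂Measure.pi μ = ∏ i, ∫⁻ x, f i x ∂μ i := by
  induction d with
  | zero => simp
  | succ d ih =>
    rw [lintegral_pi_succ μ (f := fun v => ∏ i, f i (v i)) (Finset.measurable_prod _ fun i _ =>
      (hf i).comp (measurable_pi_apply i))]
    simp only [Fin.prod_univ_succ, Fin.cons_zero, Fin.cons_succ]
    have : ∀ x, ∫⁻ y : Fin d → ℝ, f 0 x * ∏ i, f i.succ (y i) ∂Measure.pi (fun i => μ i.succ) =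
        f 0 x * ∏ i : Fin d, ∫⁻ x, f i.succ x ∂μ i.succ := by
      intro x
      rw [lintegral_const_mul _ (Finset.measurable_prod _ fun i _ =>
        (hf i.succ).comp (measurable_pi_apply i)), ih (fun i => μ i.succ) (fun i => hf i.succ)]
    simp only [this]
    rw [lintegral_mul_const _ (hf 0)]

theorem pi_gaussianReal_eq_withDensity (d : ℕ) :
    (Measure.pi fun _ : Fin d => gaussianReal 0 1) = volume.withDensity stdDensity := by
  refine Measure.pi_eq fun s hs => ?_
  rw [withDensity_apply _ (MeasurableSet.univ_pi hs)]
  simp only [stdDensity]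
  rw [volume_pi, Measure.restrict_pi_pi, lintegral_pi_prod _ fun _ => measurable_gaussianPDF 0 1]
  refine Finset.prod_congr rfl fun i _ => ?_
  rw [gaussianReal_apply 0 one_ne_zero]

theorem lintegral_stdDensity_mul {d : ℕ} {f : (Fin d → ℝ) → ℝ≥0∞} (hf : Measurable f) :
    ∫⁻ y, stdDensity y * f y = ∫⁻ y, f y ∂Measure.pi fun _ : Fin d => gaussianReal 0 1 := by
  rw [pi_gaussianReal_eq_withDensity, lintegral_withDensity_eq_lintegral_mul _
    measurable_stdDensity hf]
  rfl

theorem sum_choose_pow (m : ℕ) (t : ℝ) :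
    ∑ j : Fin m, ((m + 1).choose (j + 2) : ℝ) * t ^ ((j : ℕ) + 2) =
      (1 + t) ^ (m + 1) - 1 - (m + 1) * t := by
  rw [Finset.sum_fin_eq_sum_range]
  have h := add_pow t 1 (m + 1)
  rw [Finset.sum_range_succ', Finset.sum_range_succ'] at h
  rw [add_comm 1 t, h, Finset.sum_congr rfl
    (g := fun i => ((m + 1).choose (i + 2) : ℝ) * t ^ (i + 2))
    fun i hi => by rw [dif_pos (Finset.mem_range.1 hi)]]
  simp only [one_pow, mul_one, zero_add, pow_one, pow_zero, Nat.choose_one_right,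
    Nat.choose_zero_right, Nat.cast_one, mul_comm, add_assoc]
  push_cast; ring

theorem sum_choose_mul_pow (m : ℕ) (t : ℝ) :
    ∑ j : Fin m, ((m + 1).choose (j + 2) : ℝ) * ((j : ℕ) + 1) * t ^ ((j : ℕ) + 2) =
      (m + 1) * t * (1 + t) ^ m - (1 + t) ^ (m + 1) + 1 := by
  have h : ∑ j : Fin m, ((m + 1).choose (j + 2) : ℝ) * ((j : ℕ) + 2) * t ^ ((j : ℕ) + 2) =
      (m + 1) * t * ((1 + t) ^ m - 1) := by
    have h2 := add_pow t 1 m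
    rw [Finset.sum_range_succ', Finset.sum_range] at h2
    simp only [one_pow, mul_one, pow_zero, Nat.choose_zero_right, Nat.cast_one] at h2
    rw [add_comm 1 t, h2, add_sub_cancel_right, Finset.mul_sum]
    refine Finset.sum_congr rfl fun j _ => ?_
    have h3 : ((m : ℝ) + 1) * m.choose (j + 1) = (m + 1).choose (j + 2) * ((j : ℕ) + 2) := by
      exact_mod_cast Nat.add_one_mul_choose_eq m (j + 1)
    rw [pow_succ]
    linear_combination -t ^ ((j : ℕ) + 1) * t * h3
  have h0 := sum_choose_pow m t
  have : ∑ j : Fin m, ((m + 1).choose (j + 2) : ℝ) * ((j : ℕ) + 1) * t ^ ((j : ℕ) + 2) =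
      ∑ j : Fin m, ((m + 1).choose (j + 2) : ℝ) * ((j : ℕ) + 2) * t ^ ((j : ℕ) + 2) -
      ∑ j : Fin m, ((m + 1).choose (j + 2) : ℝ) * t ^ ((j : ℕ) + 2) := by
    rw [← Finset.sum_sub_distrib]
    exact Finset.sum_congr rfl fun j _ => by ring
  rw [this, h, h0]; ring

theorem sum_choose_mul_sq_pow (k : ℕ) (t : ℝ) :
    ∑ j : Fin (k + 1), ((k + 2).choose (j + 2) : ℝ) * ((j : ℕ) + 1) ^ 2 * t ^ ((j : ℕ) + 2) =
      (k + 2) * (k + 1) * t ^ 2 * (1 + t) ^ k -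
        ((k + 2) * t * (1 + t) ^ (k + 1) - (1 + t) ^ (k + 2) + 1) := by
  have h : ∑ j : Fin (k + 1), ((k + 2).choose (j + 2) : ℝ) * (((j : ℕ) + 2) * ((j : ℕ) + 1)) *
      t ^ ((j : ℕ) + 2) = (k + 2) * (k + 1) * t ^ 2 * (1 + t) ^ k := by
    rw [add_comm 1 t, add_pow t 1 k, Finset.sum_range, Finset.mul_sum]
    refine Finset.sum_congr rfl fun j _ => ?_
    have h3 : ((k + 1 : ℕ) + 1 : ℝ) * (k + 1).choose (j + 1) =
        (k + 2).choose (j + 2) * ((j : ℕ) + 2) := by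
      exact_mod_cast Nat.add_one_mul_choose_eq (k + 1) (j + 1)
    have h4 : ((k : ℝ) + 1) * k.choose j = (k + 1).choose (j + 1) * ((j : ℕ) + 1) := by
      exact_mod_cast Nat.add_one_mul_choose_eq k j
    push_cast at h3
    rw [pow_add, one_pow, mul_one]
    linear_combination -t ^ (j : ℕ) * t ^ 2 * ((j : ℕ) + 1) * h3 -
      t ^ (j : ℕ) * t ^ 2 * (k + 2) * h4
  have h1 := sum_choose_mul_pow (k + 1) t
  push_cast at h1
  have : ∑ j : Fin (k + 1), ((k + 2).choose (j + 2) : ℝ) * ((j : ℕ) + 1) ^ 2 * t ^ ((j : ℕ) + 2) =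
      ∑ j : Fin (k + 1), ((k + 2).choose (j + 2) : ℝ) * (((j : ℕ) + 2) * ((j : ℕ) + 1)) *
        t ^ ((j : ℕ) + 2) -
      ∑ j : Fin (k + 1), ((k + 2).choose (j + 2) : ℝ) * ((j : ℕ) + 1) * t ^ ((j : ℕ) + 2) := by
    rw [← Finset.sum_sub_distrib]
    exact Finset.sum_congr rfl fun j _ => by ring
  rw [this, h, h1]; ring

/-- The coefficients of the linear functional `tailSum m φ`, in terms of `x = tan φ`. -/
noncomputable def tailCoeff (m : ℕ) (x : ℝ) : Fin m → ℝ := fun j =>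
  Real.sqrt ((m + 1).choose (j + 2)) * x ^ ((j : ℕ) + 1)

/-- The coefficients of the linear functional `tailSumDeriv m φ`, in terms of `x = tan φ`. -/
noncomputable def tailCoeffDeriv (m : ℕ) (x : ℝ) : Fin m → ℝ := fun j =>
  Real.sqrt ((m + 1).choose (j + 2)) * (((j : ℕ) + 1) * x ^ (j : ℕ) * (1 + x ^ 2))

theorem tailSum_eq (m : ℕ) (φ : ℝ) (y : Fin m → ℝ) :
    tailSum m φ y = tailCoeff m (Real.tan φ) ⬝ᵥ y := by
  rw [dotProduct_comm]; rfl

theorem tailSumDeriv_eq (m : ℕ) (φ : ℝ) (y : Fin m → ℝ) :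
    tailSumDeriv m φ y = tailCoeffDeriv m (Real.tan φ) ⬝ᵥ y := by
  rw [dotProduct_comm]; rfl

theorem tailCoeff_self (m : ℕ) (x : ℝ) :
    x ^ 2 * (tailCoeff m x ⬝ᵥ tailCoeff m x) =
      (1 + x ^ 2) ^ (m + 1) - 1 - (m + 1) * x ^ 2 := by
  rw [← sum_choose_pow, dotProduct, Finset.mul_sum]
  refine Finset.sum_congr rfl fun j _ => ?_
  have := Real.mul_self_sqrt (Nat.cast_nonneg (α := ℝ) ((m + 1).choose (j + 2)))
  rw [tailCoeff]
  linear_combination x ^ (2 * ((j : ℕ) + 2)) * this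

theorem tailCoeff_deriv (m : ℕ) (x : ℝ) :
    x ^ 3 * (tailCoeff m x ⬝ᵥ tailCoeffDeriv m x) = (1 + x ^ 2) *
      ((m + 1) * x ^ 2 * (1 + x ^ 2) ^ m - (1 + x ^ 2) ^ (m + 1) + 1) := by
  rw [← sum_choose_mul_pow, dotProduct, Finset.mul_sum, Finset.mul_sum]
  refine Finset.sum_congr rfl fun j _ => ?_
  have := Real.mul_self_sqrt (Nat.cast_nonneg (α := ℝ) ((m + 1).choose (j + 2)))
  rw [tailCoeff, tailCoeffDeriv]
  linear_combination x ^ (2 * ((j : ℕ) + 2)) * (1 + x ^ 2) * ((j : ℕ) + 1) * this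

theorem tailCoeffDeriv_self (k : ℕ) (x : ℝ) :
    x ^ 4 * (tailCoeffDeriv (k + 1) x ⬝ᵥ tailCoeffDeriv (k + 1) x) = (1 + x ^ 2) ^ 2 *
      ((k + 2) * (k + 1) * (x ^ 2) ^ 2 * (1 + x ^ 2) ^ k -
        ((k + 2) * x ^ 2 * (1 + x ^ 2) ^ (k + 1) - (1 + x ^ 2) ^ (k + 2) + 1)) := by
  rw [← sum_choose_mul_sq_pow, dotProduct, Finset.mul_sum, Finset.mul_sum]
  refine Finset.sum_congr rfl fun j _ => ?_
  have := Real.mul_self_sqrt (Nat.cast_nonneg (α := ℝ) ((k + 2).choose (j + 2)))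
  rw [tailCoeffDeriv]
  linear_combination x ^ (2 * ((j : ℕ) + 2)) * (1 + x ^ 2) ^ 2 * ((j : ℕ) + 1) ^ 2 * this

theorem Delta_sq (k : ℕ) {x : ℝ} :
    Delta (k + 2) x ^ 2 = (1 + x ^ 2) ^ 2 *
      ((k + 2) * x ^ 2 * (1 + x ^ 2) ^ (k + 1) - (1 + x ^ 2) ^ (k + 2) + 1) ^ 2 /
      ((1 + x ^ 2) ^ (k + 2) * ((1 + x ^ 2) ^ (k + 2) - 1 - (k + 2) * x ^ 2) ^ 2) := by
  have hq : 0 < 1 + x ^ 2 := by positivity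
  set q := 1 + x ^ 2
  have h1 : (q ^ (-((k + 2 : ℕ) : ℝ) / 2)) ^ 2 = (q ^ (k + 2))⁻¹ := by
    rw [← Real.rpow_natCast, ← Real.rpow_mul hq.le, ← Real.rpow_natCast q (k + 2),
      ← Real.rpow_neg hq.le]
    congr 1; push_cast; ring
  have hpos : 0 < q ^ (k + 2) := by positivity
  have h2 : q * (1 - q ^ (-((k + 2 : ℕ) : ℤ))) - ((k + 2 : ℕ) : ℝ) * x ^ 2 =
      -(q ^ (k + 2))⁻¹ * (q * ((k + 2) * x ^ 2 * q ^ (k + 1) - q ^ (k + 2) + 1)) := by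
    rw [zpow_neg, zpow_natCast]
    field_simp
    push_cast; ring
  have h3 : 1 - q ^ (-((k + 2 : ℕ) : ℤ)) - ((k + 2 : ℕ) : ℝ) * x ^ 2 * q ^ (-((k + 2 : ℕ) : ℤ)) =
      (q ^ (k + 2))⁻¹ * (q ^ (k + 2) - 1 - (k + 2) * x ^ 2) := by
    rw [zpow_neg, zpow_natCast]
    field_simp
    push_cast; ring
  rw [Delta, mul_pow, h1, div_pow, h2, h3, mul_pow, mul_pow, mul_pow _ (_ - _ - _), neg_sq,
    mul_div_mul_left _ _ (by positivity)]
  rw [inv_mul_eq_div, div_div, mul_comm (q ^ (k + 2))]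

/-- Strict Bernoulli inequality. -/
theorem one_add_mul_lt_pow {k : ℕ} {t : ℝ} (ht : 0 < t) :
    0 < (1 + t) ^ (k + 2) - 1 - (k + 2) * t := by
  have := one_add_mul_self_lt_rpow_one_add (s := t) (p := (k + 2 : ℕ)) (by linarith) ht.ne'
    (by push_cast; have : (0 : ℝ) ≤ k := k.cast_nonneg; linarith)
  rw [Real.rpow_natCast] at this
  push_cast at this
  linarith

theorem Gam_nonneg_and_sq (k : ℕ) {x : ℝ} (hx : x ≠ 0) :
    0 ≤ Gam (k + 2) x ∧
    Gam (k + 2) x ^ 2 = ((1 + x ^ 2) ^ (k + 2) - 1 - (k + 2) * x ^ 2) ^ 2 * (1 + x ^ 2) ^ (k + 2) /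
      ((1 + x ^ 2) ^ (k + 2) - 1) ^ 3 := by
  have hx2 : 0 < x ^ 2 := by positivity
  have hD := one_add_mul_lt_pow (k := k) hx2
  have hq : 0 < 1 + x ^ 2 := by positivity
  set q := 1 + x ^ 2
  have hpos : 0 < q ^ (k + 2) := by positivity
  have hu : 0 < q ^ (k + 2) - 1 := by
    have : 0 < ((k : ℝ) + 2) * x ^ 2 := by positivity
    linarith
  have h3 : 1 - q ^ (-((k + 2 : ℕ) : ℤ)) - ((k + 2 : ℕ) : ℝ) * x ^ 2 * q ^ (-((k + 2 : ℕ) : ℤ)) =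
      (q ^ (k + 2))⁻¹ * (q ^ (k + 2) - 1 - (k + 2) * x ^ 2) := by
    rw [zpow_neg, zpow_natCast]
    field_simp
    push_cast; ring
  have h4 : 1 - q ^ (-((k + 2 : ℕ) : ℤ)) = (q ^ (k + 2))⁻¹ * (q ^ (k + 2) - 1) := by
    rw [zpow_neg, zpow_natCast]
    field_simp
  have h5 : 0 < 1 - q ^ (-((k + 2 : ℕ) : ℤ)) := by rw [h4]; positivity
  have h6 : ((1 - q ^ (-((k + 2 : ℕ) : ℤ))) ^ (3 / 2 : ℝ)) ^ 2 =
      ((q ^ (k + 2))⁻¹ * (q ^ (k + 2) - 1)) ^ 3 := by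
    rw [← h4, ← Real.rpow_natCast, ← Real.rpow_mul h5.le, ← Real.rpow_natCast _ 3]
    norm_num
  constructor
  · rw [Gam, h3]
    exact div_nonneg (mul_nonneg (by positivity) hD.le) (Real.rpow_nonneg h5.le _)
  · rw [Gam, div_pow, h6, h3]
    field_simp

/-! ### The two-point density of the zeros -/

theorem F_one (s : ℝ) : F 1 s + 1 = 0 := by
  have h : (1 : ℝ) + s ^ 2 ≠ 0 := by positivity
  have : Gam 1 s = 0 := by
    rw [Gam]
    have : 1 - (1 + s ^ 2) ^ (-((1 : ℕ) : ℤ)) -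
        ((1 : ℕ) : ℝ) * s ^ 2 * (1 + s ^ 2) ^ (-((1 : ℕ) : ℤ)) = 0 := by
      simp; field_simp; ring
    rw [this, zero_div]
  simp [F, this]

theorem sqrt_add_arcsin_eq_of_sq_eq {r s : ℝ} (h : r ^ 2 = s ^ 2) :
    Real.sqrt (1 - r ^ 2) + r * Real.arcsin r = Real.sqrt (1 - s ^ 2) + s * Real.arcsin s := by
  rcases sq_eq_sq_iff_eq_or_eq_neg.1 h with rfl | rfl
  · rfl
  · simp [Real.arcsin_neg]

/-- The Gram matrix of `tailCoeff` and `tailCoeffDeriv` at `x`, written as that of the Gaussian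
pair `(αX, βX + τY)`, reproduces `Γ_n(x)` and, up to sign, `Δ_n(x)`. All quantities are rational
functions of `n`, `t = x ^ 2` and
`Q = (1 + t) ^ k` up to square roots, and the only identity that is
not a matter of clearing denominators is `hkey`. -/
theorem Gam_and_Delta_sq_of_gram (k : ℕ) {x α β τ n l : ℝ} (hx : x ≠ 0) (hα : 0 < α)
    (hn : n = (k : ℝ) + 2) (hl : l = n⁻¹)
    (h1 : α ^ 2 = tailCoeff (k + 1) x ⬝ᵥ tailCoeff (k + 1) x)
    (h2 : α * β = tailCoeff (k + 1) x ⬝ᵥ tailCoeffDeriv (k + 1) x)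
    (h3 : β ^ 2 + τ ^ 2 = tailCoeffDeriv (k + 1) x ⬝ᵥ tailCoeffDeriv (k + 1) x) :
    α / (1 + l * α ^ 2) * Real.sqrt (β ^ 2 / (1 + l * α ^ 2) + τ ^ 2) =
      n * Real.sqrt n * Gam (k + 2) x ∧
    (β / Real.sqrt (1 + l * α ^ 2) / Real.sqrt (β ^ 2 / (1 + l * α ^ 2) + τ ^ 2)) ^ 2 =
      Delta (k + 2) x ^ 2 := by
  have e1 := tailCoeff_self (k + 1) x
  have e2 := tailCoeff_deriv (k + 1) x
  have e3 := tailCoeffDeriv_self k x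
  rw [← h1] at e1
  rw [← h2] at e2
  rw [← h3] at e3
  obtain ⟨hG0, hG⟩ := Gam_nonneg_and_sq k hx
  have hΔ := Delta_sq k (x := x)
  have hx2 : 0 < x ^ 2 := by positivity
  have hD := one_add_mul_lt_pow (k := k) hx2
  have hn0 : 0 < n := by rw [hn]; positivity
  push_cast at e1 e2 e3
  rw [show (k : ℝ) + 1 + 1 = n by rw [hn]; ring] at e1 e2
  rw [show (k : ℝ) + 1 = n - 1 by rw [hn]; ring] at e3
  rw [← hn] at hD hG hΔ e3
  set t := x ^ 2 with ht
  set q := 1 + t with hq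
  have hq0 : 0 < q := by positivity
  set Q := q ^ k with hQ
  have hQ0 : 0 < Q := by positivity
  have p1 : q ^ (k + 1) = Q * q := pow_succ _ _
  have p2 : q ^ (k + 2) = Q * q ^ 2 := pow_add _ _ _
  have p2' : q ^ (k + 1 + 1) = Q * q ^ 2 := p2
  rw [p2'] at e1 e2
  rw [p1] at e2 e3 hΔ
  rw [p2] at hD hG hΔ e3
  set u := Q * q ^ 2 - 1 with hu
  set D := u - n * t with hDdef
  set S := n * t * (Q * q) - Q * q ^ 2 + 1 with hS
  have hu0 : 0 < u := by
    have : 0 < n * t := by positivity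
    linarith
  have hκ : 1 + l * α ^ 2 = u / (n * t) := by
    rw [hl]; field_simp; linear_combination e1
  have hα2 : α ^ 2 = D / t := by
    rw [eq_div_iff hx2.ne']; linear_combination e1
  have hαβ : (α * β) ^ 2 = q ^ 2 * S ^ 2 / t ^ 3 := by
    rw [eq_div_iff (by positivity), ← mul_pow, ← e2, ht]; ring
  have hββ : β ^ 2 = q ^ 2 * S ^ 2 / (t ^ 2 * D) := by
    have : α ^ 2 * β ^ 2 = q ^ 2 * S ^ 2 / t ^ 3 := by rw [← mul_pow, hαβ]
    rw [hα2] at this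
    field_simp at this ⊢
    linear_combination this
  have hbb : β ^ 2 + τ ^ 2 = q ^ 2 * (n * (n - 1) * t ^ 2 * Q - S) / t ^ 2 := by
    rw [eq_div_iff (by positivity)]
    have : x ^ 4 = t ^ 2 := by rw [ht]; ring
    rw [this] at e3
    linear_combination e3
  have hR : β ^ 2 / (1 + l * α ^ 2) + τ ^ 2 = n * D * Q * q ^ 2 / (t * u) := by
    have hkey : (n * (n - 1) * t ^ 2 * Q - S) * u - S ^ 2 = n * D * Q * t := by
      rw [hDdef, hu, hS, hq]; ring
    have : τ ^ 2 = q ^ 2 * (n * (n - 1) * t ^ 2 * Q - S) / t ^ 2 - β ^ 2 := by linarith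
    have hβD : β ^ 2 * D * t ^ 2 = q ^ 2 * S ^ 2 := by rw [hββ]; field_simp
    rw [hκ, this, div_div_eq_mul_div, eq_div_iff (by positivity)]
    field_simp
    linear_combination q ^ 2 * hkey - hβD
  have hR0 : 0 ≤ n * D * Q * q ^ 2 / (t * u) := by positivity
  constructor
  · refine (sq_eq_sq₀ (by rw [hκ]; positivity) (by positivity)).1 ?_
    rw [mul_pow, mul_pow, mul_pow, Real.sq_sqrt hn0.le, hR, Real.sq_sqrt hR0, div_pow, hκ, hα2, hG]
    field_simp
  · rw [div_pow, div_pow, hR, Real.sq_sqrt hR0, hκ, Real.sq_sqrt (by positivity), hββ, hΔ]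
    field_simp

theorem lintegral_stdDensity_mul_exp {m : ℕ} {a b : Fin m → ℝ} {α β τ l : ℝ}
    (h1 : α ^ 2 = a ⬝ᵥ a) (h2 : α * β = a ⬝ᵥ b) (h3 : β ^ 2 + τ ^ 2 = b ⬝ᵥ b) :
    ∫⁻ y : Fin m → ℝ, stdDensity y *
      ENNReal.ofReal (Real.exp (-(l * (a ⬝ᵥ y) ^ 2) / 2) * (|a ⬝ᵥ y| * |b ⬝ᵥ y|)) =
      ∫⁻ p : ℝ × ℝ, ENNReal.ofReal (Real.exp (-(l * (α * p.1) ^ 2) / 2) *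
        (|α * p.1| * |β * p.1 + τ * p.2|)) ∂((gaussianReal 0 1).prod (gaussianReal 0 1)) := by
  have hm : Measurable fun p : ℝ × ℝ =>
      ENNReal.ofReal (Real.exp (-(l * p.1 ^ 2) / 2) * (|p.1| * |p.2|)) := by fun_prop
  have hab : Measurable fun y : Fin m → ℝ => (a ⬝ᵥ y, b ⬝ᵥ y) := by
    simp only [dotProduct]; fun_prop
  have e1 := lintegral_stdDensity_mul (hm.comp hab)
  have e2 := lintegral_map hm hab (μ := Measure.pi fun _ : Fin m => gaussianReal 0 1)
  rw [map_pi_gaussianReal_dotProduct a b h1 h2 h3, lintegral_map hm (by fun_prop)] at e2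
  exact e1.trans e2.symm

/-- The intensity of pairs of zeros at the angles `θ` and `θ + φ`: the Jacobian of `pairMap` is
integrated over the coefficients of index at least two, against the Gaussian density. -/
theorem lintegral_pair_density (m : ℕ) {φ : ℝ} (hφ : Real.tan φ ≠ 0) :
    ∫⁻ y : Fin m → ℝ, ENNReal.ofReal (|tailSum m φ y| * |tailSumDeriv m φ y| /
        Real.sqrt (m + 1 : ℕ)) * (gaussianPDF 0 1 0 *
          (gaussianPDF 0 1 (-(tailSum m φ y) / Real.sqrt (m + 1 : ℕ)) * stdDensity y)) =
      ENNReal.ofReal ((m + 1 : ℕ) / Real.pi ^ 2 * (F (m + 1) (Real.tan φ) + 1)) := by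
  -- in degree one there are no pairs of zeros, and both sides vanish
  rcases m with _ | k
  · simp [F_one, tailSum]
  set x := Real.tan φ with hx
  set a := tailCoeff (k + 1) x
  set b := tailCoeffDeriv (k + 1) x
  set n : ℝ := ((k + 1 + 1 : ℕ) : ℝ) with hn
  have hn0 : 0 < n := by positivity
  have haa : 0 < a ⬝ᵥ a := by
    have h := tailCoeff_self (k + 1) x
    have hD := one_add_mul_lt_pow (k := k) (t := x ^ 2) (by positivity)
    push_cast at h
    have : 0 < x ^ 2 * (a ⬝ᵥ a) := by
      rw [h]; convert hD using 2; ring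
    exact pos_of_mul_pos_right this (by positivity)
  set α := Real.sqrt (a ⬝ᵥ a) with hα
  have hα0 : 0 < α := Real.sqrt_pos.2 haa
  have h1 : α ^ 2 = a ⬝ᵥ a := Real.sq_sqrt haa.le
  set β := (a ⬝ᵥ b) / α with hβ
  have h2 : α * β = a ⬝ᵥ b := by rw [hβ]; field_simp
  have hcs : β ^ 2 ≤ b ⬝ᵥ b := by
    rw [hβ, div_pow, h1, div_le_iff₀ haa]
    have := Finset.sum_mul_sq_le_sq_mul_sq Finset.univ a b
    simp only [dotProduct, ← sq]
    linarith
  set τ := Real.sqrt (b ⬝ᵥ b - β ^ 2) with hτ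
  have h3 : β ^ 2 + τ ^ 2 = b ⬝ᵥ b := by rw [hτ, Real.sq_sqrt (by linarith)]; ring
  have hτ0 : 0 ≤ τ := Real.sqrt_nonneg _
  obtain ⟨g1, g2⟩ := Gam_and_Delta_sq_of_gram k hφ hα0 (n := n) (l := n⁻¹)
    (by rw [hn]; push_cast; ring) rfl h1 h2 h3
  have hint : ∀ y : Fin (k + 1) → ℝ, ENNReal.ofReal (|tailSum (k + 1) φ y| *
      |tailSumDeriv (k + 1) φ y| / Real.sqrt n) * (gaussianPDF 0 1 0 *
        (gaussianPDF 0 1 (-(tailSum (k + 1) φ y) / Real.sqrt n) * stdDensity y)) =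
      ENNReal.ofReal ((2 * Real.pi)⁻¹ / Real.sqrt n) * (stdDensity y *
        ENNReal.ofReal (Real.exp (-(n⁻¹ * (a ⬝ᵥ y) ^ 2) / 2) * (|a ⬝ᵥ y| * |b ⬝ᵥ y|))) := by
    intro y
    rw [tailSum_eq, tailSumDeriv_eq]
    have a3 : (Real.sqrt (2 * Real.pi))⁻¹ * (Real.sqrt (2 * Real.pi))⁻¹ = (2 * Real.pi)⁻¹ := by
      rw [← mul_inv, Real.mul_self_sqrt (by positivity)]
    have a4 : -(-(a ⬝ᵥ y) / Real.sqrt n) ^ 2 / 2 = -(n⁻¹ * (a ⬝ᵥ y) ^ 2) / 2 := by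
      rw [div_pow, Real.sq_sqrt hn0.le]; ring
    simp only [gaussianPDF, gaussianPDFReal, NNReal.coe_one, mul_one, sub_zero]
    rw [mul_comm (stdDensity y), ← mul_assoc, ← mul_assoc, ← mul_assoc,
      ← ENNReal.ofReal_mul (by positivity), ← ENNReal.ofReal_mul (by positivity),
      ← ENNReal.ofReal_mul (by positivity)]
    congr 2
    rw [a4, ← a3]
    simp
    ring
  simp only [hint]
  have hab : Measurable fun y : Fin (k + 1) → ℝ => stdDensity y *
        ENNReal.ofReal (Real.exp (-(n⁻¹ * (a ⬝ᵥ y) ^ 2) / 2) * (|a ⬝ᵥ y| * |b ⬝ᵥ y|)) := by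
    refine measurable_stdDensity.mul ?_
    simp only [dotProduct]; fun_prop
  rw [lintegral_const_mul _ hab, lintegral_stdDensity_mul_exp h1 h2 h3,
    lintegral_exp_neg_sq_mul_abs_mul_abs hα0.le hτ0 (by positivity),
    sqrt_add_arcsin_eq_of_sq_eq g2, ← ENNReal.ofReal_mul (by positivity)]
  congr 1
  have hsn : Real.sqrt n ≠ 0 := (Real.sqrt_pos.2 hn0).ne'
  rw [F]
  rw [show ∀ A B C : ℝ, 2 / Real.pi * A * (B * C) = 2 / Real.pi * (A * B) * C by intros; ring, g1]
  field_simp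
  ring

/-! ### Intensities of zeros and of pairs of zeros in the angle -/

theorem measurable_F (n : ℕ) : Measurable (F n) := by
  unfold F Delta Gam
  simp only [zpow_neg, zpow_natCast]
  fun_prop

theorem lintegral_stdDensity (d : ℕ) : ∫⁻ y : Fin d → ℝ, stdDensity y = 1 := by
  have := lintegral_stdDensity_mul (d := d) (f := fun _ => 1) measurable_const
  simpa using this

theorem stdDensity_cons {d : ℕ} (x : ℝ) (y : Fin d → ℝ) :
    stdDensity (Fin.cons x y : Fin (d + 1) → ℝ) = gaussianPDF 0 1 x * stdDensity y := by
  simp [stdDensity, Fin.prod_univ_succ]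

/-- The zeros are equidistributed in the angle, with density `√n / π`. -/
theorem lintegral_encard_trigZeros (m : ℕ) {I : Set ℝ} (hI : MeasurableSet I) :
    ∫⁻ c : Fin (m + 2) → ℝ, stdDensity c * ((trigZeros (m + 1) I c).encard : ℝ≥0∞) =
      ENNReal.ofReal (Real.sqrt (m + 1 : ℕ) / Real.pi) * volume I := by
  have hS : MeasurableSet {v : Fin (m + 2) → ℝ | v 0 ∈ I} := measurable_pi_apply 0 hI
  rw [(lintegral_stdDensity_mul_encard m hI).2, ← lintegral_indicator hS,
    lintegral_volume_succ]
  · have h : ∀ x, ∫⁻ y : Fin (m + 1) → ℝ, {v : Fin (m + 2) → ℝ | v 0 ∈ I}.indicator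
        (fun v => ENNReal.ofReal (Real.sqrt (m + 1 : ℕ) * |v 1|) *
          stdDensity (dropZero (m + 1) v)) (Fin.cons x y) =
        I.indicator (fun _ => ENNReal.ofReal (Real.sqrt (m + 1 : ℕ) / Real.pi)) x := by
      intro x
      by_cases hx : x ∈ I
      · rw [indicator_of_mem hx]
        have e : ∀ y : Fin (m + 1) → ℝ, {v : Fin (m + 2) → ℝ | v 0 ∈ I}.indicator
            (fun v => ENNReal.ofReal (Real.sqrt (m + 1 : ℕ) * |v 1|) *
              stdDensity (dropZero (m + 1) v)) (Fin.cons x y) =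
            ENNReal.ofReal (Real.sqrt (m + 1 : ℕ)) * gaussianPDF 0 1 0 *
              (ENNReal.ofReal |y 0| * stdDensity y) := by
          intro y
          rw [indicator_of_mem (by simpa using hx), dropZero_apply, Fin.update_cons_zero,
            stdDensity_cons, ENNReal.ofReal_mul (Real.sqrt_nonneg _),
            show (Fin.cons x y : Fin (m + 2) → ℝ) 1 = y 0 from rfl]
          ring
        simp only [e]
        have hm : Measurable fun y : Fin (m + 1) → ℝ => ENNReal.ofReal |y 0| * stdDensity y :=
          Measurable.mul (by fun_prop) measurable_stdDensity
        rw [lintegral_const_mul _ hm, lintegral_volume_succ hm]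
        have e2 : ∀ s : ℝ, ∫⁻ z : Fin m → ℝ,
            ENNReal.ofReal |(Fin.cons s z : Fin (m + 1) → ℝ) 0| *
              stdDensity (Fin.cons s z : Fin (m + 1) → ℝ) =
            gaussianPDF 0 1 s * ENNReal.ofReal |s| := by
          intro s
          simp only [Fin.cons_zero, stdDensity_cons, ← mul_assoc]
          rw [lintegral_const_mul _ measurable_stdDensity, lintegral_stdDensity, mul_one, mul_comm]
        simp only [e2]
        rw [lintegral_gaussianPDF_mul_abs, gaussianPDF, gaussianPDFReal,
          ← ENNReal.ofReal_mul (by positivity), ← ENNReal.ofReal_mul (by positivity)]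
        congr 1
        have : Real.sqrt (2 * Real.pi) ^ 2 = 2 * Real.pi := Real.sq_sqrt (by positivity)
        simp only [NNReal.coe_one, mul_one, sub_zero]
        field_simp
        rw [this]; norm_num
      · rw [indicator_of_notMem hx]
        have e : ∀ y : Fin (m + 1) → ℝ, {v : Fin (m + 2) → ℝ | v 0 ∈ I}.indicator
            (fun v => ENNReal.ofReal (Real.sqrt (m + 1 : ℕ) * |v 1|) *
              stdDensity (dropZero (m + 1) v)) (Fin.cons x y) = 0 :=
          fun y => indicator_of_notMem (by simpa using hx) _
        simp only [e, lintegral_zero]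
    simp only [h]
    rw [lintegral_indicator hI, setLIntegral_const]
  · refine Measurable.indicator ?_ hS
    exact Measurable.mul (by fun_prop)
      (measurable_stdDensity.comp (dropZero (m + 1)).continuous.measurable)

theorem volume_Ioo_inter_shift {p q : ℝ} (φ : ℝ) :
    volume {θ | θ ∈ Ioo p q ∧ θ + φ ∈ Ioo p q} = ENNReal.ofReal (q - p - |φ|) := by
  have : {θ | θ ∈ Ioo p q ∧ θ + φ ∈ Ioo p q} = Ioo (max p (p - φ)) (min q (q - φ)) := by
    ext θ
    simp only [mem_ofPred_eq, mem_Ioo, max_lt_iff, lt_min_iff]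
    constructor
    · rintro ⟨⟨h1, h2⟩, h3, h4⟩; exact ⟨⟨h1, by linarith⟩, h2, by linarith⟩
    · rintro ⟨⟨h1, h2⟩, h3, h4⟩; exact ⟨⟨h1, h3⟩, by linarith, by linarith⟩
  rw [this, Real.volume_Ioo]
  congr 1
  rcases le_total 0 φ with h | h
  · rw [max_eq_left (by linarith), min_eq_right (by linarith), abs_of_nonneg h]; ring
  · rw [max_eq_right (by linarith), min_eq_left (by linarith), abs_of_nonpos h]; ring

theorem ae_sin_ne_zero : ∀ᵐ φ : ℝ, Real.sin φ ≠ 0 := by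
  have : {φ : ℝ | Real.sin φ = 0} = range fun k : ℤ => (k : ℝ) * Real.pi := by
    ext φ; exact Real.sin_eq_zero_iff
  rw [ae_iff]
  simp only [not_not, this]
  exact (countable_range _).measure_zero _

theorem ae_cos_ne_zero : ∀ᵐ φ : ℝ, Real.cos φ ≠ 0 := by
  have : {φ : ℝ | Real.cos φ = 0} = range fun k : ℤ => (2 * (k : ℝ) + 1) * Real.pi / 2 := by
    ext φ; rw [mem_ofPred_eq, Real.cos_eq_zero_iff]; simp [eq_comm]
  rw [ae_iff]
  simp only [not_not, this]
  exact (countable_range _).measure_zero _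

/-- The two-point density depends only on the difference `φ` of the two angles. -/
theorem lintegral_encard_pairs (m : ℕ) (p q : ℝ) :
    ∫⁻ c : Fin (m + 2) → ℝ, stdDensity c *
        ({z : ℝ × ℝ | z.1 ∈ trigZeros (m + 1) (Ioo p q) c ∧ z.2 ∈ trigZeros (m + 1) (Ioo p q) c ∧
        Real.sin (z.2 - z.1) ≠ 0 ∧ Real.cos (z.2 - z.1) ≠ 0}.encard : ℝ≥0∞) =
      ∫⁻ φ : ℝ, ENNReal.ofReal (q - p - |φ|) *
        ENNReal.ofReal ((m + 1 : ℕ) / Real.pi ^ 2 * (F (m + 1) (Real.tan φ) + 1)) := by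
  have hs : MeasurableSet (pairDomain m (Ioo p q)) :=
    (measurable_pi_apply 0 measurableSet_Ioo).inter
      ((((measurable_pi_apply 0).add (measurable_pi_apply 1)) measurableSet_Ioo).inter
        ((measurableSet_eq_fun (by fun_prop) measurable_const).compl.inter
          (measurableSet_eq_fun (by fun_prop) measurable_const).compl))
  have hm1 : Measurable fun v : Fin (m + 2) → ℝ =>
      ENNReal.ofReal (|tailSum m (v 1) (tail2 v)| * |tailSumDeriv m (v 1) (tail2 v)| /
        Real.sqrt (m + 1 : ℕ)) * stdDensity (dropZero (m + 1) (solveOne m v)) :=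
    Measurable.mul ((((measurable_tailSum m).abs).mul
      ((measurable_tailSumDeriv m).abs)).div_const _).ennreal_ofReal
      (measurable_stdDensity.comp
        ((dropZero (m + 1)).continuous.measurable.comp (measurable_solveOne m)))
  have hm := hm1.indicator hs
  rw [lintegral_stdDensity_mul_encard_pairs m measurableSet_Ioo, ← lintegral_indicator hs,
    lintegral_volume_succ hm]
  have e1 : ∀ θ : ℝ, ∫⁻ y : Fin (m + 1) → ℝ, (pairDomain m (Ioo p q)).indicator (fun v =>
      ENNReal.ofReal (|tailSum m (v 1) (tail2 v)| * |tailSumDeriv m (v 1) (tail2 v)| /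
        Real.sqrt (m + 1 : ℕ)) * stdDensity (dropZero (m + 1) (solveOne m v))) (Fin.cons θ y) =
      ∫⁻ φ : ℝ, {z : ℝ × ℝ | z.1 ∈ Ioo p q ∧ z.1 + z.2 ∈ Ioo p q}.indicator (fun z =>
        ENNReal.ofReal ((m + 1 : ℕ) / Real.pi ^ 2 * (F (m + 1) (Real.tan z.2) + 1))) (θ, φ) := by
    intro θ
    have hcons : Measurable fun y : Fin (m + 1) → ℝ => (Fin.cons θ y : Fin (m + 2) → ℝ) :=
      measurable_pi_iff.2 fun i => by
        refine Fin.cases ?_ (fun j => ?_) i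
        · simp
        · simp only [Fin.cons_succ]; fun_prop
    refine (lintegral_volume_succ (hm.comp hcons)).trans (lintegral_congr_ae ?_)
    filter_upwards [ae_sin_ne_zero, ae_cos_ne_zero] with φ h1 h2
    by_cases hz : θ ∈ Ioo p q ∧ θ + φ ∈ Ioo p q
    · have htan : Real.tan φ ≠ 0 := by rw [Real.tan_eq_sin_div_cos]; exact div_ne_zero h1 h2
      have hz' : (θ, φ) ∈ {z : ℝ × ℝ | z.1 ∈ Ioo p q ∧ z.1 + z.2 ∈ Ioo p q} := hz
      rw [indicator_of_mem hz', ← lintegral_pair_density m htan]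
      refine lintegral_congr fun y => ?_
      have hv : (Fin.cons θ (Fin.cons φ y : Fin (m + 1) → ℝ) : Fin (m + 2) → ℝ) ∈
          pairDomain m (Ioo p q) := ⟨hz.1, hz.2, h1, h2⟩
      rw [Function.comp, indicator_of_mem hv]
      have t2 : tail2 (Fin.cons θ (Fin.cons φ y : Fin (m + 1) → ℝ) : Fin (m + 2) → ℝ) = y := rfl
      have v1 : (Fin.cons θ (Fin.cons φ y : Fin (m + 1) → ℝ) : Fin (m + 2) → ℝ) 1 = φ := rfl
      have hd : dropZero (m + 1) (solveOne m
          (Fin.cons θ (Fin.cons φ y : Fin (m + 1) → ℝ) : Fin (m + 2) → ℝ)) =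
          Fin.cons 0 (Fin.cons (-(tailSum m φ y) / Real.sqrt (m + 1 : ℕ)) y :
            Fin (m + 1) → ℝ) := by
        rw [dropZero_apply, solveOne, t2, v1]
        ext i
        refine Fin.cases ?_ (fun i => Fin.cases ?_ (fun j => ?_) i) i
        · simp
        · simp
        · have h1 : j.succ.succ ≠ (1 : Fin (m + 2)) := by
            intro h; simpa using congrArg Fin.val h
          simp [h1]
      rw [t2, v1, hd, stdDensity_cons, stdDensity_cons]
    · have hz' : (θ, φ) ∉ {z : ℝ × ℝ | z.1 ∈ Ioo p q ∧ z.1 + z.2 ∈ Ioo p q} := hz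
      rw [indicator_of_notMem hz']
      have : ∀ y : Fin m → ℝ, (Fin.cons θ (Fin.cons φ y : Fin (m + 1) → ℝ) : Fin (m + 2) → ℝ) ∉
          pairDomain m (Ioo p q) := fun y hv => hz ⟨hv.1, hv.2.1⟩
      simp only [Function.comp, indicator_of_notMem (this _), lintegral_zero]
  simp only [e1]
  have hset : MeasurableSet {z : ℝ × ℝ | z.1 ∈ Ioo p q ∧ z.1 + z.2 ∈ Ioo p q} :=
    (measurable_fst measurableSet_Ioo).inter
      ((measurable_fst.add measurable_snd) measurableSet_Ioo)
  have hFm : Measurable fun φ : ℝ =>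
      ENNReal.ofReal ((m + 1 : ℕ) / Real.pi ^ 2 * (F (m + 1) (Real.tan φ) + 1)) := by
    refine (((measurable_F (m + 1)).comp ?_).add_const 1 |>.const_mul _).ennreal_ofReal
    rw [show Real.tan = fun x => Real.sin x / Real.cos x from funext Real.tan_eq_sin_div_cos]
    exact Real.measurable_sin.div Real.measurable_cos
  refine (lintegral_lintegral_swap (f := fun θ φ =>
    {z : ℝ × ℝ | z.1 ∈ Ioo p q ∧ z.1 + z.2 ∈ Ioo p q}.indicator (fun z =>
      ENNReal.ofReal ((m + 1 : ℕ) / Real.pi ^ 2 * (F (m + 1) (Real.tan z.2) + 1))) (θ, φ))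
    ((hFm.comp measurable_snd).indicator hset).aemeasurable).trans (lintegral_congr fun φ => ?_)
  have hset' : MeasurableSet {θ | θ ∈ Ioo p q ∧ θ + φ ∈ Ioo p q} :=
    measurableSet_Ioo.inter ((measurable_id.add_const φ) measurableSet_Ioo)
  rw [← volume_Ioo_inter_shift, mul_comm, ← setLIntegral_const, ← lintegral_indicator hset']
  rfl

/-! ### From angles to real zeros -/

/-- The extension of `arctan` to the extended real line. -/
noncomputable def angle : EReal → ℝ
  | (x : ℝ) => Real.arctan x
  | ⊤ => Real.pi / 2
  | ⊥ => -(Real.pi / 2)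

@[simp] theorem angle_coe (x : ℝ) : angle (x : EReal) = Real.arctan x := rfl
@[simp] theorem angle_top : angle ⊤ = Real.pi / 2 := rfl
@[simp] theorem angle_bot : angle ⊥ = -(Real.pi / 2) := rfl

theorem angle_mem_Icc (x : EReal) : angle x ∈ Icc (-(Real.pi / 2)) (Real.pi / 2) := by
  induction x with
  | bot => exact ⟨le_rfl, by rw [angle_bot]; linarith [Real.pi_pos]⟩
  | top => exact ⟨by rw [angle_top]; linarith [Real.pi_pos], le_rfl⟩
  | coe x => exact ⟨(Real.neg_pi_div_two_lt_arctan x).le, (Real.arctan_lt_pi_div_two x).le⟩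

theorem strictMono_angle : StrictMono angle := by
  intro x y hxy
  induction x with
  | bot =>
    induction y with
    | bot => exact absurd hxy (lt_irrefl _)
    | top => rw [angle_bot, angle_top]; linarith [Real.pi_pos]
    | coe y => exact Real.neg_pi_div_two_lt_arctan y
  | top => exact absurd hxy not_top_lt
  | coe x =>
    induction y with
    | bot => exact absurd hxy not_lt_bot
    | top => exact Real.arctan_lt_pi_div_two x
    | coe y => exact Real.arctan_strictMono (EReal.coe_lt_coe_iff.1 hxy)

theorem zeros_eq_image (n : ℕ) (a b : EReal) (c : Fin (n + 1) → ℝ) :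
    zeros n a b c = Real.tan '' trigZeros n (Ioo (angle a) (angle b)) c := by
  ext x
  constructor
  · rintro ⟨hax, hxb, hx⟩
    have hcos := (Real.cos_arctan_pos x).ne'
    refine ⟨Real.arctan x, ⟨⟨?_, ?_⟩, ?_⟩, Real.tan_arctan x⟩
    · simpa using strictMono_angle hax
    · simpa using strictMono_angle hxb
    · rw [trigPoly_eq_cos_pow_mul_poly n c hcos, Real.tan_arctan, hx, mul_zero]
  · rintro ⟨θ, ⟨⟨h1, h2⟩, hθ⟩, rfl⟩
    have h1' := (angle_mem_Icc a).1.trans_lt h1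
    have h2' := h2.trans_le (angle_mem_Icc b).2
    have harc : Real.arctan (Real.tan θ) = θ := Real.arctan_tan h1' h2'
    have hcos := (Real.cos_pos_of_mem_Ioo ⟨h1', h2'⟩).ne'
    rw [trigPoly_eq_cos_pow_mul_poly n c hcos] at hθ
    refine ⟨strictMono_angle.lt_iff_lt.1 ?_, strictMono_angle.lt_iff_lt.1 ?_,
      (mul_eq_zero.1 hθ).resolve_left (pow_ne_zero _ hcos)⟩
    · rwa [angle_coe, harc]
    · rwa [angle_coe, harc]

theorem injOn_tan_trigZeros (n : ℕ) (a b : EReal) (c : Fin (n + 1) → ℝ) :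
    InjOn Real.tan (trigZeros n (Ioo (angle a) (angle b)) c) :=
  Real.injOn_tan.mono fun θ (hθ : θ ∈ Ioo (angle a) (angle b) ∧ _) =>
    (⟨(angle_mem_Icc a).1.trans_lt hθ.1.1, hθ.1.2.trans_le (angle_mem_Icc b).2⟩ :
      θ ∈ Ioo (-(Real.pi / 2)) (Real.pi / 2))

theorem zeros_finite (n : ℕ) (a b : EReal) {c : Fin (n + 1) → ℝ} (hc : c ≠ 0) :
    (zeros n a b c).Finite ∧ (zeros n a b c).ncard ≤ n := by
  let p : Polynomial ℝ := ∑ j : Fin (n + 1),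
    Polynomial.monomial (j : ℕ) (c j * Real.sqrt (n.choose (j : ℕ) : ℝ))
  have heval : ∀ x, p.eval x = poly n c x := by
    intro x
    simp [p, poly, Polynomial.eval_finsetSum]
  have hdeg : p.natDegree ≤ n :=
    Polynomial.natDegree_sum_le_of_forall_le _ _ fun j _ =>
      (Polynomial.natDegree_monomial_le _).trans (Nat.lt_succ_iff.1 j.2)
  have hp : p ≠ 0 := by
    obtain ⟨j, hj⟩ := Function.ne_iff.1 hc
    intro h0
    have hcoef : p.coeff j = c j * Real.sqrt (n.choose (j : ℕ) : ℝ) := by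
      simp only [p, Polynomial.finsetSum_coeff, Polynomial.coeff_monomial]
      rw [Finset.sum_eq_single j] <;> simp [Fin.ext_iff]
      intro i hi hij; exact absurd hij hi
    rw [h0, Polynomial.coeff_zero] at hcoef
    have hpos : 0 < Real.sqrt (n.choose (j : ℕ) : ℝ) :=
      Real.sqrt_pos.2 (by exact_mod_cast Nat.choose_pos (Nat.lt_succ_iff.1 j.2))
    exact (mul_ne_zero hj hpos.ne') hcoef.symm
  have hsub : zeros n a b c ⊆ (p.roots.toFinset : Set ℝ) := by
    rintro x ⟨-, -, hx⟩
    simp [hp, heval, hx]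
  refine ⟨(Finset.finite_toSet _).subset hsub, ?_⟩
  calc (zeros n a b c).ncard ≤ (p.roots.toFinset : Set ℝ).ncard :=
        ncard_le_ncard hsub (Finset.finite_toSet _)
    _ = p.roots.toFinset.card := ncard_coe_finset _
    _ ≤ p.roots.card := Multiset.toFinset_card_le _
    _ ≤ p.natDegree := Polynomial.card_roots' p
    _ ≤ n := hdeg

theorem encard_trigZeros (n : ℕ) (a b : EReal) {c : Fin (n + 1) → ℝ} (hc : c ≠ 0) :
    ((trigZeros n (Ioo (angle a) (angle b)) c).encard : ℝ≥0∞) =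
      ENNReal.ofReal (numZeros n a b c) := by
  rw [← (injOn_tan_trigZeros n a b c).encard_image, ← zeros_eq_image, numZeros,
    ENNReal.ofReal_natCast, ← (zeros_finite n a b hc).1.cast_ncard_eq]
  simp

/-- For zeros in `(-π/2, π/2)` the sine of the difference vanishes only on the diagonal. -/
theorem encard_pairs (n : ℕ) (a b : EReal) {c : Fin (n + 1) → ℝ} (hc : c ≠ 0)
    (hcos : ∀ θ θ' : ℝ, trigPoly n c θ = 0 → trigPoly n c θ' = 0 → Real.cos (θ' - θ) ≠ 0) :
    ({z : ℝ × ℝ | z.1 ∈ trigZeros n (Ioo (angle a) (angle b)) c ∧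
        z.2 ∈ trigZeros n (Ioo (angle a) (angle b)) c ∧
        Real.sin (z.2 - z.1) ≠ 0 ∧ Real.cos (z.2 - z.1) ≠ 0}.encard : ℝ≥0∞) =
      ENNReal.ofReal (numZeros n a b c ^ 2 - numZeros n a b c) := by
  set Z := trigZeros n (Ioo (angle a) (angle b)) c with hZ
  have hfin : Z.Finite := by
    refine Finite.of_finite_image ?_ (injOn_tan_trigZeros n a b c)
    rw [← zeros_eq_image]; exact (zeros_finite n a b hc).1
  have hset : {z : ℝ × ℝ | z.1 ∈ Z ∧ z.2 ∈ Z ∧ Real.sin (z.2 - z.1) ≠ 0 ∧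
      Real.cos (z.2 - z.1) ≠ 0} = (hfin.toFinset.offDiag : Set (ℝ × ℝ)) := by
    ext ⟨x, y⟩
    simp only [mem_ofPred_eq, Finset.coe_offDiag, Finite.coe_toFinset, mem_offDiag]
    refine and_congr_right fun hx => and_congr_right fun hy => ?_
    have hx1 := (angle_mem_Icc a).1.trans_lt hx.1.1
    have hx2 := hx.1.2.trans_le (angle_mem_Icc b).2
    have hy1 := (angle_mem_Icc a).1.trans_lt hy.1.1
    have hy2 := hy.1.2.trans_le (angle_mem_Icc b).2
    constructor
    · rintro ⟨hs, -⟩ rfl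
      simp at hs
    · intro hxy
      refine ⟨fun hs => hxy ?_, hcos x y hx.2 hy.2⟩
      have := (Real.sin_eq_zero_iff_of_lt_of_lt (x := y - x) (by linarith) (by linarith)).1 hs
      linarith
  have hN : numZeros n a b c = (hfin.toFinset.card : ℝ) := by
    rw [numZeros, zeros_eq_image, (injOn_tan_trigZeros n a b c).ncard_image,
      ncard_eq_toFinset_card _ hfin]
  rw [hset, encard_coe_eq_coe_finsetCard, hN, Finset.offDiag_card]
  have hle : hfin.toFinset.card ≤ hfin.toFinset.card * hfin.toFinset.card := Nat.le_mul_self _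
  rw [show ((hfin.toFinset.card : ℝ) ^ 2 - hfin.toFinset.card) =
    ((hfin.toFinset.card * hfin.toFinset.card - hfin.toFinset.card : ℕ) : ℝ) by
      rw [Nat.cast_sub hle]; push_cast; ring, ENNReal.ofReal_natCast]
  simp

/-- The standard Gaussian measure on coefficient vectors. -/
noncomputable abbrev coeffMeasure (n : ℕ) : Measure (Fin (n + 1) → ℝ) :=
  Measure.pi fun _ => gaussianReal 0 1

theorem coeffMeasure_absolutelyContinuous (n : ℕ) : coeffMeasure n ≪ volume := by
  rw [coeffMeasure, pi_gaussianReal_eq_withDensity]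
  exact withDensity_absolutelyContinuous _ _

theorem ae_ne_zero (n : ℕ) : ∀ᵐ c ∂coeffMeasure n, c ≠ 0 := by
  have : ∀ᵐ c : Fin (n + 1) → ℝ, c ≠ 0 := by
    rw [ae_iff]; simp
  exact (coeffMeasure_absolutelyContinuous n).ae_le this

theorem lintegral_coeffMeasure (n : ℕ) {f : (Fin (n + 1) → ℝ) → ℝ≥0∞}
    (hf : AEMeasurable f (coeffMeasure n)) :
    ∫⁻ c, f c ∂coeffMeasure n = ∫⁻ c, stdDensity c * f c := by
  rw [coeffMeasure, pi_gaussianReal_eq_withDensity] at hf ⊢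
  rw [lintegral_withDensity_eq_lintegral_mul₀' measurable_stdDensity.aemeasurable hf]
  rfl

theorem numZeros_nonneg (n : ℕ) (a b : EReal) (c : Fin (n + 1) → ℝ) : 0 ≤ numZeros n a b c :=
  Nat.cast_nonneg _

/-- The area formula yields measurability of the Gaussian density times the number of zeros; the
density is then divided out. -/
theorem aemeasurable_numZeros (m : ℕ) (a b : EReal) :
    AEMeasurable (numZeros (m + 1) a b) (coeffMeasure (m + 1)) := by
  have h := (lintegral_stdDensity_mul_encard m
    (measurableSet_Ioo (a := angle a) (b := angle b))).1
  have h2 : AEMeasurable (fun c : Fin (m + 2) → ℝ => (stdDensity c * ((trigZeros (m + 1)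
      (Ioo (angle a) (angle b)) c).encard : ℝ≥0∞) / stdDensity c).toReal)
      (coeffMeasure (m + 1)) :=
    ((h.mono_ac (coeffMeasure_absolutelyContinuous _)).div
      measurable_stdDensity.aemeasurable).ennreal_toReal
  refine h2.congr ?_
  filter_upwards [ae_ne_zero (m + 1)] with c hc
  have h0 : stdDensity c ≠ 0 := by
    rw [stdDensity, Finset.prod_ne_zero_iff]
    exact fun i _ => (gaussianPDF_pos 0 one_ne_zero _).ne'
  have h1 : stdDensity c ≠ ∞ := ENNReal.prod_ne_top fun i _ => gaussianPDF_ne_top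
  rw [mul_comm, ENNReal.mul_div_cancel_right h0 h1, encard_trigZeros (m + 1) a b hc,
    ENNReal.toReal_ofReal (numZeros_nonneg _ _ _ _)]

theorem memLp_numZeros (m : ℕ) (a b : EReal) (p : ℝ≥0∞) :
    MemLp (numZeros (m + 1) a b) p (coeffMeasure (m + 1)) := by
  refine MemLp.of_bound (aemeasurable_numZeros m a b).aestronglyMeasurable (m + 1 : ℕ) ?_
  filter_upwards [ae_ne_zero (m + 1)] with c hc
  rw [Real.norm_of_nonneg (numZeros_nonneg _ _ _ _), numZeros]
  exact_mod_cast (zeros_finite (m + 1) a b hc).2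

theorem integral_numZeros (m : ℕ) {a b : EReal} (hab : a < b) :
    ∫ c, numZeros (m + 1) a b c ∂coeffMeasure (m + 1) =
      Real.sqrt (m + 1 : ℕ) / Real.pi * (angle b - angle a) := by
  have hlt := strictMono_angle hab
  rw [integral_eq_lintegral_of_nonneg_ae
    (Filter.Eventually.of_forall fun c => numZeros_nonneg _ _ _ c)
    (aemeasurable_numZeros m a b).aestronglyMeasurable]
  have h := lintegral_encard_trigZeros m (measurableSet_Ioo (a := angle a) (b := angle b))
  rw [Real.volume_Ioo, ← ENNReal.ofReal_mul (by positivity)] at h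
  have h2 : ∫⁻ c, ENNReal.ofReal (numZeros (m + 1) a b c) ∂coeffMeasure (m + 1) =
      ENNReal.ofReal (Real.sqrt (m + 1 : ℕ) / Real.pi * (angle b - angle a)) := by
    rw [lintegral_coeffMeasure _ (aemeasurable_numZeros m a b).ennreal_ofReal, ← h]
    refine lintegral_congr_ae ?_
    have : ∀ᵐ c : Fin (m + 2) → ℝ, c ≠ 0 := by rw [ae_iff]; simp
    filter_upwards [this] with c hc
    rw [encard_trigZeros (m + 1) a b hc]
  rw [h2, ENNReal.toReal_ofReal (mul_nonneg (by positivity) (by linarith))]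

theorem numZeros_sq_sub_nonneg (n : ℕ) (a b : EReal) (c : Fin (n + 1) → ℝ) :
    0 ≤ numZeros n a b c ^ 2 - numZeros n a b c := by
  rw [numZeros, sub_nonneg, sq]
  exact_mod_cast Nat.le_mul_self _

theorem lintegral_factorial_moment (m : ℕ) (a b : EReal) :
    ENNReal.ofReal (∫ c, (numZeros (m + 1) a b c ^ 2 - numZeros (m + 1) a b c)
        ∂coeffMeasure (m + 1)) =
      ∫⁻ φ : ℝ, ENNReal.ofReal (angle b - angle a - |φ|) *
        ENNReal.ofReal ((m + 1 : ℕ) / Real.pi ^ 2 * (F (m + 1) (Real.tan φ) + 1)) := by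
  rw [ofReal_integral_eq_lintegral_ofReal
    (f := fun c => numZeros (m + 1) a b c ^ 2 - numZeros (m + 1) a b c)
    ((memLp_numZeros m a b 2).integrable_sq.sub ((memLp_numZeros m a b 1).integrable le_rfl))
    (Filter.Eventually.of_forall fun c => numZeros_sq_sub_nonneg _ _ _ c),
    ← lintegral_encard_pairs, lintegral_coeffMeasure]
  · refine lintegral_congr_ae ?_
    have : ∀ᵐ c : Fin (m + 2) → ℝ, c ≠ 0 := by rw [ae_iff]; simp
    filter_upwards [this, ae_cos_sub_ne_zero (m + 1) (Nat.succ_ne_zero m)] with c hc hcos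
    rw [encard_pairs (m + 1) a b hc hcos]
  · exact (((aemeasurable_numZeros m a b).pow_const 2).sub
      (aemeasurable_numZeros m a b)).ennreal_ofReal

/-! ### The variance as an integral over the angle -/

theorem F_neg (n : ℕ) (s : ℝ) : F n (-s) = F n s := by
  simp [F, Delta, Gam]

theorem F_add_one_nonneg (m : ℕ) (s : ℝ) : 0 ≤ F (m + 1) s + 1 := by
  rcases m with _ | k
  · exact (F_one s).ge
  have hG : 0 ≤ Gam (k + 2) s := by
    rcases eq_or_ne s 0 with rfl | hs
    · simp [Gam]
    · exact (Gam_nonneg_and_sq k hs).1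
  have hA : ∀ r : ℝ, 0 ≤ r * Real.arcsin r := by
    intro r
    rcases le_total 0 r with h | h
    · exact mul_nonneg h (Real.arcsin_nonneg.2 h)
    · exact mul_nonneg_of_nonpos_of_nonpos h (Real.arcsin_nonpos.2 h)
  rw [F, sub_add_cancel]
  exact mul_nonneg (add_nonneg (Real.sqrt_nonneg _) (hA _)) hG

theorem measurable_F_tan (n : ℕ) : Measurable fun t => F n (Real.tan t) := by
  refine (measurable_F n).comp ?_
  rw [show Real.tan = fun x => Real.sin x / Real.cos x from funext Real.tan_eq_sin_div_cos]
  exact Real.measurable_sin.div Real.measurable_cos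

theorem F_tan_pi_sub (n : ℕ) (t : ℝ) : F n (Real.tan (Real.pi - t)) = F n (Real.tan t) := by
  rw [Real.tan_pi_sub, F_neg]

theorem F_tan_abs (n : ℕ) (t : ℝ) : F n (Real.tan |t|) = F n (Real.tan t) := by
  rcases abs_choice t with h | h
  · rw [h]
  · rw [h, Real.tan_neg, F_neg]

theorem integrable_factorial_moment (m : ℕ) (a b : EReal) :
    Integrable (fun φ : ℝ => max 0 (angle b - angle a - |φ|) *
      ((m + 1 : ℕ) / Real.pi ^ 2 * (F (m + 1) (Real.tan φ) + 1))) ∧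
    ∫ c, (numZeros (m + 1) a b c ^ 2 - numZeros (m + 1) a b c) ∂coeffMeasure (m + 1) =
      ∫ φ : ℝ, max 0 (angle b - angle a - |φ|) *
        ((m + 1 : ℕ) / Real.pi ^ 2 * (F (m + 1) (Real.tan φ) + 1)) := by
  have hg : ∀ φ : ℝ, 0 ≤ ((m + 1 : ℕ) : ℝ) / Real.pi ^ 2 * (F (m + 1) (Real.tan φ) + 1) :=
    fun φ => mul_nonneg (by positivity) (F_add_one_nonneg m _)
  have h0 : ∀ φ : ℝ, 0 ≤ max 0 (angle b - angle a - |φ|) *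
      ((m + 1 : ℕ) / Real.pi ^ 2 * (F (m + 1) (Real.tan φ) + 1)) :=
    fun φ => mul_nonneg (le_max_left _ _) (hg φ)
  have hm : Measurable fun φ : ℝ => max 0 (angle b - angle a - |φ|) *
      ((m + 1 : ℕ) / Real.pi ^ 2 * (F (m + 1) (Real.tan φ) + 1)) :=
    Measurable.mul (by fun_prop) (((measurable_F_tan (m + 1)).add_const 1).const_mul _)
  have h := lintegral_factorial_moment m a b
  have e : ∀ φ : ℝ, ENNReal.ofReal (angle b - angle a - |φ|) *
      ENNReal.ofReal ((m + 1 : ℕ) / Real.pi ^ 2 * (F (m + 1) (Real.tan φ) + 1)) =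
      ENNReal.ofReal (max 0 (angle b - angle a - |φ|) *
        ((m + 1 : ℕ) / Real.pi ^ 2 * (F (m + 1) (Real.tan φ) + 1))) := by
    intro φ
    rw [ENNReal.ofReal_mul (le_max_left _ _)]
    congr 1
    rw [ENNReal.ofReal_max, ENNReal.ofReal_zero, max_eq_right zero_le]
  simp only [e] at h
  have hint : Integrable (fun φ : ℝ => max 0 (angle b - angle a - |φ|) *
      ((m + 1 : ℕ) / Real.pi ^ 2 * (F (m + 1) (Real.tan φ) + 1))) := by
    refine ⟨hm.aestronglyMeasurable, ?_⟩
    rw [hasFiniteIntegral_iff_ofReal (Filter.Eventually.of_forall h0), ← h]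
    exact ENNReal.ofReal_lt_top
  refine ⟨hint, ?_⟩
  rw [← ofReal_integral_eq_lintegral_ofReal hint (Filter.Eventually.of_forall h0)] at h
  exact (ENNReal.ofReal_eq_ofReal_iff
    (integral_nonneg fun c => numZeros_sq_sub_nonneg _ _ _ c) (integral_nonneg h0)).1 h

/-- The number of zeros is at most `n`, so its second factorial moment is finite; on the whole line
this moment is an integral of `F_n(tan t) + 1 ≥ 0` against a weight that is bounded below on
`(0, π/2]`. -/
theorem intervalIntegrable_F_tan (m : ℕ) :
    IntervalIntegrable (fun t => F (m + 1) (Real.tan t)) volume 0 Real.pi := by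
  have hpi := Real.pi_pos
  have h1 := (integrable_factorial_moment m ⊥ ⊤).1
  have hhalf : IntervalIntegrable (fun t => F (m + 1) (Real.tan t)) volume 0 (Real.pi / 2) := by
    rw [intervalIntegrable_iff_integrableOn_Ioc_of_le (by positivity)]
    have h2 : IntegrableOn (fun t => F (m + 1) (Real.tan t) + 1) (Ioc 0 (Real.pi / 2)) := by
      refine Integrable.mono' ((h1.integrableOn (s := Ioc 0 (Real.pi / 2))).const_mul
        (2 * Real.pi / (m + 1 : ℕ)))
        ((measurable_F_tan (m + 1)).add_const 1).aestronglyMeasurable ?_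
      refine (ae_restrict_mem measurableSet_Ioc).mono fun t ht => ?_
      have hF := F_add_one_nonneg m (Real.tan t)
      have hm : (0 : ℝ) < (m + 1 : ℕ) := by positivity
      rw [Real.norm_of_nonneg hF, angle_top, angle_bot, abs_of_pos ht.1]
      have : Real.pi / 2 ≤ max 0 (Real.pi / 2 - -(Real.pi / 2) - t) :=
        le_max_of_le_right (by linarith [ht.2])
      calc F (m + 1) (Real.tan t) + 1 = 2 * Real.pi / (m + 1 : ℕ) * (Real.pi / 2 *
            ((m + 1 : ℕ) / Real.pi ^ 2 * (F (m + 1) (Real.tan t) + 1))) := by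
            field_simp
        _ ≤ _ := by gcongr
    refine (h2.sub (integrableOn_const (C := (1 : ℝ)) (by simp))).congr
      (Filter.Eventually.of_forall fun t => ?_)
    simp
  refine hhalf.trans ?_
  have := (hhalf.comp_sub_left Real.pi).symm
  simp only [F_tan_pi_sub, sub_zero] at this
  rwa [show Real.pi - Real.pi / 2 = Real.pi / 2 by ring] at this

theorem intervalIntegrable_F_tan' (m : ℕ) {s t : ℝ} (hs : s ∈ Icc 0 Real.pi)
    (ht : t ∈ Icc 0 Real.pi) :
    IntervalIntegrable (fun t => F (m + 1) (Real.tan t)) volume s t :=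
  (intervalIntegrable_F_tan m).mono_set (by
    rw [uIcc_of_le Real.pi_pos.le]
    exact uIcc_subset_Icc hs ht)

/-- The integral of `F_n(tan t)` over `(0, θ)`. -/
noncomputable def intF (n : ℕ) (θ : ℝ) : ℝ := ∫ t in (0 : ℝ)..θ, F n (Real.tan t)

/-- The integral of `t * F_n(tan t)` over `(0, θ)`. -/
noncomputable def intMulF (n : ℕ) (θ : ℝ) : ℝ := ∫ t in (0 : ℝ)..θ, t * F n (Real.tan t)

theorem intervalIntegrable_mul_F_tan (m : ℕ) {s t : ℝ} (hs : s ∈ Icc 0 Real.pi)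
    (ht : t ∈ Icc 0 Real.pi) :
    IntervalIntegrable (fun t => t * F (m + 1) (Real.tan t)) volume s t :=
  (intervalIntegrable_F_tan' m hs ht).continuousOn_mul continuousOn_id

theorem factorial_moment_eq (m : ℕ) {a b : EReal} (hab : a < b) :
    ∫ c, (numZeros (m + 1) a b c ^ 2 - numZeros (m + 1) a b c) ∂coeffMeasure (m + 1) =
      2 * (m + 1 : ℕ) / Real.pi ^ 2 * ((angle b - angle a) * intF (m + 1) (angle b - angle a) -
        intMulF (m + 1) (angle b - angle a)) +
        (m + 1 : ℕ) / Real.pi ^ 2 * (angle b - angle a) ^ 2 := by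
  have hlt := strictMono_angle hab
  have hle : angle b - angle a ≤ Real.pi := by
    linarith [(angle_mem_Icc a).1, (angle_mem_Icc b).2]
  rw [(integrable_factorial_moment m a b).2]
  set ℓ := angle b - angle a with hℓ
  have hℓ0 : 0 < ℓ := by linarith
  have e1 : ∀ φ : ℝ, max 0 (ℓ - |φ|) *
      ((m + 1 : ℕ) / Real.pi ^ 2 * (F (m + 1) (Real.tan φ) + 1)) =
      (fun t => max 0 (ℓ - t) *
        ((m + 1 : ℕ) / Real.pi ^ 2 * (F (m + 1) (Real.tan t) + 1))) |φ| := by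
    intro φ; simp only [F_tan_abs]
  simp only [e1]
  rw [integral_comp_abs (f := fun t => max 0 (ℓ - t) *
        ((m + 1 : ℕ) / Real.pi ^ 2 * (F (m + 1) (Real.tan t) + 1))),
    setIntegral_eq_of_subset_of_forall_sdiff_eq_zero measurableSet_Ioi
      (Ioc_subset_Ioi_self : Ioc 0 ℓ ⊆ Ioi 0) (fun t ht => by
        have ht0 : 0 < t := ht.1
        have : ℓ < t := by
          by_contra h; exact ht.2 ⟨ht0, not_lt.1 h⟩
        rw [max_eq_left (by linarith), zero_mul]),
    ← intervalIntegral.integral_of_le hℓ0.le]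
  have h0 : (0 : ℝ) ∈ Icc 0 Real.pi := ⟨le_rfl, Real.pi_pos.le⟩
  have hℓm : ℓ ∈ Icc 0 Real.pi := ⟨hℓ0.le, hle⟩
  have i1 := intervalIntegrable_F_tan' m h0 hℓm
  have i2 := intervalIntegrable_mul_F_tan m h0 hℓm
  have e2 : ∫ t in (0 : ℝ)..ℓ, max 0 (ℓ - t) *
        ((m + 1 : ℕ) / Real.pi ^ 2 * (F (m + 1) (Real.tan t) + 1)) =
      ∫ t in (0 : ℝ)..ℓ, ((m + 1 : ℕ) / Real.pi ^ 2) * ((ℓ * F (m + 1) (Real.tan t) -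
        t * F (m + 1) (Real.tan t)) + (ℓ - t)) := by
    refine intervalIntegral.integral_congr fun t ht => ?_
    rw [uIcc_of_le hℓ0.le] at ht
    simp only [max_eq_right (sub_nonneg.2 ht.2)]
    ring
  have i3 : IntervalIntegrable (fun t : ℝ => ℓ - t) volume 0 ℓ :=
    (continuous_const.sub continuous_id).intervalIntegrable _ _
  have e3 : ∫ t in (0 : ℝ)..ℓ, (ℓ - t) = ℓ ^ 2 / 2 := by
    rw [intervalIntegral.integral_sub (by simp) (by simp)]
    simp; ring
  rw [e2, intervalIntegral.integral_const_mul,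
    intervalIntegral.integral_add ((i1.const_mul ℓ).sub i2) i3,
    intervalIntegral.integral_sub (i1.const_mul ℓ) i2, intervalIntegral.integral_const_mul, e3,
    intF, intMulF]
  ring

theorem variance_numZeros (m : ℕ) {a b : EReal} (hab : a < b) :
    variance (numZeros (m + 1) a b) (coeffMeasure (m + 1)) =
      Real.sqrt (m + 1 : ℕ) / Real.pi * (angle b - angle a) +
      2 * (m + 1 : ℕ) / Real.pi ^ 2 * ((angle b - angle a) * intF (m + 1) (angle b - angle a) -
        intMulF (m + 1) (angle b - angle a)) := by
  have h := factorial_moment_eq m hab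
  have hE := integral_numZeros m hab
  rw [integral_sub (memLp_numZeros m a b 2).integrable_sq
    ((memLp_numZeros m a b 1).integrable le_rfl), hE] at h
  rw [variance_eq_sub (memLp_numZeros m a b 2), hE]
  simp only [Pi.pow_apply]
  have hs : Real.sqrt (m + 1 : ℕ) ^ 2 = (m + 1 : ℕ) := Real.sq_sqrt (by positivity)
  rw [mul_pow, div_pow, hs]
  linarith

theorem intF_pi_sub (m : ℕ) {θ : ℝ} (hθ : θ ∈ Icc 0 (Real.pi / 2)) :
    intF (m + 1) (Real.pi - θ) = 2 * intF (m + 1) (Real.pi / 2) - intF (m + 1) θ := by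
  have hpi := Real.pi_pos
  have h0 : (0 : ℝ) ∈ Icc 0 Real.pi := ⟨le_rfl, by linarith⟩
  have h1 : Real.pi / 2 ∈ Icc 0 Real.pi := ⟨by linarith, by linarith⟩
  have h2 : θ ∈ Icc 0 Real.pi := ⟨hθ.1, by linarith [hθ.2]⟩
  have h3 : Real.pi - θ ∈ Icc 0 Real.pi := ⟨by linarith [hθ.2], by linarith [hθ.1]⟩
  have e1 := intervalIntegral.integral_add_adjacent_intervals
    (intervalIntegrable_F_tan' m h0 h1) (intervalIntegrable_F_tan' m h1 h3)
  have e2 := intervalIntegral.integral_add_adjacent_intervals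
    (intervalIntegrable_F_tan' m h0 h2) (intervalIntegrable_F_tan' m h2 h1)
  have e3 := intervalIntegral.integral_comp_sub_left (a := θ) (b := Real.pi / 2)
    (fun t => F (m + 1) (Real.tan t)) Real.pi
  simp only [F_tan_pi_sub] at e3
  rw [show Real.pi - Real.pi / 2 = Real.pi / 2 by ring] at e3
  rw [intF, intF, intF]
  linarith

theorem intMulF_pi_sub (m : ℕ) {θ : ℝ} (hθ : θ ∈ Icc 0 (Real.pi / 2)) :
    intMulF (m + 1) (Real.pi - θ) =
      Real.pi * (intF (m + 1) (Real.pi / 2) - intF (m + 1) θ) + intMulF (m + 1) θ := by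
  have hpi := Real.pi_pos
  have h0 : (0 : ℝ) ∈ Icc 0 Real.pi := ⟨le_rfl, by linarith⟩
  have h1 : Real.pi / 2 ∈ Icc 0 Real.pi := ⟨by linarith, by linarith⟩
  have h2 : θ ∈ Icc 0 Real.pi := ⟨hθ.1, by linarith [hθ.2]⟩
  have h3 : Real.pi - θ ∈ Icc 0 Real.pi := ⟨by linarith [hθ.2], by linarith [hθ.1]⟩
  have e1 := intervalIntegral.integral_add_adjacent_intervals
    (intervalIntegrable_mul_F_tan m h0 h1) (intervalIntegrable_mul_F_tan m h1 h3)
  have e2 := intervalIntegral.integral_add_adjacent_intervals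
    (intervalIntegrable_mul_F_tan m h0 h2) (intervalIntegrable_mul_F_tan m h2 h1)
  have e4 := intervalIntegral.integral_add_adjacent_intervals
    (intervalIntegrable_F_tan' m h0 h2) (intervalIntegrable_F_tan' m h2 h1)
  have e3 := intervalIntegral.integral_comp_sub_left (a := θ) (b := Real.pi / 2)
    (fun t => t * F (m + 1) (Real.tan t)) Real.pi
  simp only [F_tan_pi_sub, sub_mul] at e3
  rw [show Real.pi - Real.pi / 2 = Real.pi / 2 by ring,
    intervalIntegral.integral_sub ((intervalIntegrable_F_tan' m h2 h1).const_mul _)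
      (intervalIntegrable_mul_F_tan m h2 h1), intervalIntegral.integral_const_mul] at e3
  rw [intF, intF, intMulF, intMulF]
  rw [show (∫ t in (0 : ℝ)..(Real.pi / 2), F (m + 1) (Real.tan t)) -
    ∫ t in (0 : ℝ)..θ, F (m + 1) (Real.tan t) =
    ∫ t in θ..(Real.pi / 2), F (m + 1) (Real.tan t) by linarith]
  linarith

/-! ### The substitution `s = √n tan t` and the exact formulas -/

/-- The number `√n tan θ`, read as `∞` at `θ = π / 2`; it is the upper limit of integration in `s`
that corresponds to the upper limit `θ` in the variable `t = arctan (s / √n)`. -/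
noncomputable def tanLimit (n : ℕ) (θ : ℝ) : EReal :=
  if θ = Real.pi / 2 then ⊤ else ((Real.sqrt n * Real.tan θ : ℝ) : EReal)

theorem image_tan_Ioo (m : ℕ) {θ : ℝ} (hθ : θ ∈ Ioc 0 (Real.pi / 2)) :
    (fun t => Real.sqrt (m + 1 : ℕ) * Real.tan t) '' Ioo 0 θ =
      {s : ℝ | 0 < s ∧ (s : EReal) < tanLimit (m + 1) θ} := by
  have hr : 0 < Real.sqrt (m + 1 : ℕ) := Real.sqrt_pos.2 (by positivity)
  have hpi := Real.pi_pos
  ext s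
  constructor
  · rintro ⟨t, ⟨h0, ht⟩, rfl⟩
    refine ⟨mul_pos hr (Real.tan_pos_of_pos_of_lt_pi_div_two h0 (ht.trans_le hθ.2)), ?_⟩
    rw [tanLimit]
    split_ifs with h
    · exact EReal.coe_lt_top _
    · exact EReal.coe_lt_coe_iff.2 (mul_lt_mul_of_pos_left
        (Real.tan_lt_tan_of_nonneg_of_lt_pi_div_two h0.le (lt_of_le_of_ne hθ.2 h) ht) hr)
  · rintro ⟨h0, hs⟩
    refine ⟨Real.arctan (s / Real.sqrt (m + 1 : ℕ)), ⟨Real.arctan_pos.2 (by positivity), ?_⟩, ?_⟩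
    · rw [tanLimit] at hs
      split_ifs at hs with h
      · rw [h]; exact Real.arctan_lt_pi_div_two _
      · rw [← Real.arctan_tan (by linarith [hθ.1]) (lt_of_le_of_ne hθ.2 h)]
        refine Real.arctan_strictMono ((div_lt_iff₀ hr).2 ?_)
        rw [mul_comm]
        exact EReal.coe_lt_coe_iff.1 hs
    · simp only [Real.tan_arctan]
      field_simp

theorem injOn_mul_tan (m : ℕ) {θ : ℝ} (hθ : θ ≤ Real.pi / 2) :
    InjOn (fun t => Real.sqrt (m + 1 : ℕ) * Real.tan t) (Ioo 0 θ) := by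
  have hr : 0 < Real.sqrt (m + 1 : ℕ) := Real.sqrt_pos.2 (by positivity)
  have hpi := Real.pi_pos
  intro s hs t ht h
  exact Real.injOn_tan ⟨by linarith [hs.1], hs.2.trans_le hθ⟩ ⟨by linarith [ht.1], ht.2.trans_le hθ⟩
    (mul_left_cancel₀ hr.ne' h)

theorem hasDerivAt_mul_tan (m : ℕ) {θ t : ℝ} (hθ : θ ≤ Real.pi / 2) (ht : t ∈ Ioo 0 θ) :
    HasDerivWithinAt (fun t => Real.sqrt (m + 1 : ℕ) * Real.tan t)
      (Real.sqrt (m + 1 : ℕ) * (1 + Real.tan t ^ 2)) (Ioo 0 θ) t := by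
  have hpi := Real.pi_pos
  have hc : Real.cos t ≠ 0 :=
    (Real.cos_pos_of_mem_Ioo ⟨by linarith [ht.1], ht.2.trans_le hθ⟩).ne'
  have := ((Real.hasDerivAt_tan hc).const_mul (Real.sqrt (m + 1 : ℕ))).hasDerivWithinAt
    (s := Ioo 0 θ)
  rwa [one_div, ← inv_eq_iff_eq_inv.1 (Real.inv_one_add_tan_sq hc)] at this

theorem abs_mul_kIntegrand (m : ℕ) (t : ℝ) :
    |Real.sqrt (m + 1 : ℕ) * (1 + Real.tan t ^ 2)| •
      kIntegrand (m + 1) (Real.sqrt (m + 1 : ℕ) * Real.tan t) =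
      Real.sqrt (m + 1 : ℕ) * F (m + 1) (Real.tan t) := by
  have hr : 0 < Real.sqrt (m + 1 : ℕ) := Real.sqrt_pos.2 (by positivity)
  have hs : Real.sqrt (m + 1 : ℕ) ^ 2 = (m + 1 : ℕ) := Real.sq_sqrt (by positivity)
  rw [abs_of_pos (by positivity), smul_eq_mul, kIntegrand, mul_div_cancel_left₀ _ hr.ne', mul_pow,
    hs, mul_div_cancel_left₀ _ (by positivity)]
  have : 1 + Real.tan t ^ 2 ≠ 0 := by positivity
  field_simp

theorem abs_mul_lIntegrand (m : ℕ) {t : ℝ} (h0 : 0 < t) (h1 : t < Real.pi / 2) :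
    |Real.sqrt (m + 1 : ℕ) * (1 + Real.tan t ^ 2)| •
      lIntegrand (m + 1) (Real.sqrt (m + 1 : ℕ) * Real.tan t) =
      (m + 1 : ℕ) * (t * F (m + 1) (Real.tan t)) := by
  have hr : 0 < Real.sqrt (m + 1 : ℕ) := Real.sqrt_pos.2 (by positivity)
  have hs : Real.sqrt (m + 1 : ℕ) ^ 2 = (m + 1 : ℕ) := Real.sq_sqrt (by positivity)
  have h := abs_mul_kIntegrand m t
  rw [lIntegrand, ← kIntegrand, mul_div_cancel_left₀ _ hr.ne',
    Real.arctan_tan (by linarith) h1, ← smul_mul_assoc, h]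
  linear_combination t * F (m + 1) (Real.tan t) * hs

theorem KUpTo_tanLimit (m : ℕ) {θ : ℝ} (hθ : θ ∈ Ioc 0 (Real.pi / 2)) :
    KUpTo (m + 1) (tanLimit (m + 1) θ) =
      2 / Real.pi * (Real.sqrt (m + 1 : ℕ) * intF (m + 1) θ) := by
  rw [KUpTo, ← image_tan_Ioo m hθ, integral_image_eq_integral_abs_deriv_smul measurableSet_Ioo
    (fun t ht => hasDerivAt_mul_tan m hθ.2 ht) (injOn_mul_tan m hθ.2)]
  simp only [abs_mul_kIntegrand]
  rw [integral_const_mul, intF, intervalIntegral.integral_of_le hθ.1.le,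
    integral_Ioc_eq_integral_Ioo]

theorem LUpTo_tanLimit (m : ℕ) {θ : ℝ} (hθ : θ ∈ Ioc 0 (Real.pi / 2)) :
    LUpTo (m + 1) (tanLimit (m + 1) θ) =
      2 / Real.pi ^ 2 * ((m + 1 : ℕ) * intMulF (m + 1) θ) := by
  rw [LUpTo, ← image_tan_Ioo m hθ, integral_image_eq_integral_abs_deriv_smul measurableSet_Ioo
    (fun t ht => hasDerivAt_mul_tan m hθ.2 ht) (injOn_mul_tan m hθ.2)]
  rw [setIntegral_congr_fun measurableSet_Ioo
    (fun t ht => abs_mul_lIntegrand m ht.1 (ht.2.trans_le hθ.2)), integral_const_mul, intMulF,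
    intervalIntegral.integral_of_le hθ.1.le, integral_Ioc_eq_integral_Ioo]

theorem image_tan_Ioo_pi_div_two (m : ℕ) :
    (fun t => Real.sqrt (m + 1 : ℕ) * Real.tan t) '' Ioo 0 (Real.pi / 2) = Ioi 0 := by
  rw [image_tan_Ioo m ⟨by positivity, le_rfl⟩]
  ext s
  simp [tanLimit, EReal.coe_lt_top]

theorem integrableOn_kIntegrand (m : ℕ) : IntegrableOn (kIntegrand (m + 1)) (Ioi 0) := by
  have hpi := Real.pi_pos
  rw [← image_tan_Ioo_pi_div_two m, integrableOn_image_iff_integrableOn_abs_deriv_smul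
    measurableSet_Ioo (fun t ht => hasDerivAt_mul_tan m le_rfl ht) (injOn_mul_tan m le_rfl)]
  simp only [abs_mul_kIntegrand]
  have h := intervalIntegrable_F_tan' m (s := 0) (t := Real.pi / 2) ⟨le_rfl, by linarith⟩
    ⟨by linarith, by linarith⟩
  rw [intervalIntegrable_iff_integrableOn_Ioo_of_le (by positivity)] at h
  exact h.const_mul _

theorem integrableOn_lIntegrand (m : ℕ) : IntegrableOn (lIntegrand (m + 1)) (Ioi 0) := by
  have hpi := Real.pi_pos
  rw [← image_tan_Ioo_pi_div_two m, integrableOn_image_iff_integrableOn_abs_deriv_smul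
    measurableSet_Ioo (fun t ht => hasDerivAt_mul_tan m le_rfl ht) (injOn_mul_tan m le_rfl),
    integrableOn_congr_fun (fun t ht => abs_mul_lIntegrand m ht.1 ht.2) measurableSet_Ioo]
  have h := intervalIntegrable_mul_F_tan m (s := 0) (t := Real.pi / 2) ⟨le_rfl, by linarith⟩
    ⟨by linarith, by linarith⟩
  rw [intervalIntegrable_iff_integrableOn_Ioo_of_le (by positivity)] at h
  exact h.const_mul _

theorem tanLimit_pi_div_two (n : ℕ) : tanLimit n (Real.pi / 2) = ⊤ := if_pos rfl

theorem alpha_coe_coe (a b : ℝ) :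
    alpha a b = if 1 + a * b = 0 then ⊤ else (((b - a) / (1 + a * b) : ℝ) : EReal) := rfl

theorem alpha_coe_top (a : ℝ) :
    alpha a ⊤ = if a = 0 then ⊤ else ((1 / a : ℝ) : EReal) := rfl

theorem alpha_bot_coe (b : ℝ) :
    alpha ⊥ b = if b = 0 then ⊤ else ((-1 / b : ℝ) : EReal) := rfl

/-- `α(a, b)` is the tangent of the angle under which the interval `(a, b)` is seen from `i`. -/
theorem alpha_eq_tan {a b : EReal} (hab : a < b) :
    alpha a b = if angle b - angle a = Real.pi / 2 then ⊤
      else ((Real.tan (angle b - angle a) : ℝ) : EReal) := by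
  have hpi := Real.pi_pos
  induction a with
  | bot =>
    induction b with
    | bot => exact absurd hab (lt_irrefl _)
    | top =>
      have : ¬ (Real.pi / 2 - -(Real.pi / 2) = Real.pi / 2) := by intro h; linarith
      rw [angle_top, angle_bot, if_neg this, sub_neg_eq_add, add_halves, Real.tan_pi]
      rfl
    | coe b =>
      have htan : Real.tan (Real.arctan b + Real.pi / 2) = -b⁻¹ := by
        rw [← Real.tan_sub_pi, show Real.arctan b + Real.pi / 2 - Real.pi =
          -(Real.pi / 2 - Real.arctan b) by ring, Real.tan_neg, Real.tan_pi_div_two_sub,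
          Real.tan_arctan]
      rw [angle_bot, angle_coe, sub_neg_eq_add, htan, alpha_bot_coe]
      by_cases hb : b = 0
      · subst hb; simp
      · have : ¬ (Real.arctan b + Real.pi / 2 = Real.pi / 2) := by
          simpa [Real.arctan_eq_zero_iff] using hb
        rw [if_neg this, if_neg hb, neg_div, one_div]
  | top => exact absurd hab (not_lt.2 le_top)
  | coe a =>
    induction b with
    | bot => exact absurd hab (not_lt.2 bot_le)
    | top =>
      rw [angle_top, angle_coe, Real.tan_pi_div_two_sub, Real.tan_arctan, alpha_coe_top]
      by_cases ha : a = 0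
      · subst ha; simp
      · have : ¬ (Real.pi / 2 - Real.arctan a = Real.pi / 2) := by
          simpa [Real.arctan_eq_zero_iff] using ha
        rw [if_neg this, if_neg ha, one_div]
    | coe b =>
      have hlt : a < b := EReal.coe_lt_coe_iff.1 hab
      have hA : 0 < Real.sqrt (1 + a ^ 2) := Real.sqrt_pos.2 (by positivity)
      have hB : 0 < Real.sqrt (1 + b ^ 2) := Real.sqrt_pos.2 (by positivity)
      have hc : Real.cos (Real.arctan b - Real.arctan a) =
          (1 + a * b) / (Real.sqrt (1 + a ^ 2) * Real.sqrt (1 + b ^ 2)) := by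
        rw [Real.cos_sub, Real.cos_arctan, Real.cos_arctan, Real.sin_arctan, Real.sin_arctan]
        field_simp
      have hs : Real.sin (Real.arctan b - Real.arctan a) =
          (b - a) / (Real.sqrt (1 + a ^ 2) * Real.sqrt (1 + b ^ 2)) := by
        rw [Real.sin_sub, Real.cos_arctan, Real.cos_arctan, Real.sin_arctan, Real.sin_arctan]
        field_simp
      rw [angle_coe, angle_coe, alpha_coe_coe]
      have hiff : 1 + a * b = 0 ↔ Real.arctan b - Real.arctan a = Real.pi / 2 := by
        constructor
        · intro h
          rw [h, zero_div] at hc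
          have h1 := Real.arctan_strictMono hlt
          have h2 := Real.arctan_lt_pi_div_two b
          have h3 := Real.neg_pi_div_two_lt_arctan a
          exact Real.injOn_cos ⟨by linarith, by linarith⟩ ⟨by linarith, by linarith⟩
            (hc.trans Real.cos_pi_div_two.symm)
        · intro h
          rw [h, Real.cos_pi_div_two, eq_comm, div_eq_zero_iff] at hc
          exact hc.resolve_right (by positivity)
      by_cases h : 1 + a * b = 0
      · rw [if_pos h, if_pos (hiff.1 h)]
      · rw [if_neg h, if_neg (mt hiff.2 h), Real.tan_eq_sin_div_cos, hc, hs]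
        congr 1
        field_simp

theorem upperLimit_eq_tanLimit (m : ℕ) {a b : EReal} (hab : a < b)
    (h : angle b - angle a ≤ Real.pi / 2) :
    upperLimit (m + 1) a b = tanLimit (m + 1) (angle b - angle a) := by
  have hr : 0 < Real.sqrt (m + 1 : ℕ) := Real.sqrt_pos.2 (by positivity)
  have h0 := sub_pos.2 (strictMono_angle hab)
  rw [upperLimit, alpha_eq_tan hab, tanLimit]
  split_ifs with h1
  · rw [max_eq_left le_top, EReal.coe_mul_top_of_pos hr]
  · have := Real.tan_pos_of_pos_of_lt_pi_div_two h0 (lt_of_le_of_ne h h1)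
    rw [← EReal.coe_neg, max_eq_left (EReal.coe_le_coe_iff.2 (by linarith)), EReal.coe_mul]

theorem upperLimit_eq_tanLimit_pi_sub (m : ℕ) {a b : EReal} (hab : a < b)
    (h : Real.pi / 2 < angle b - angle a) :
    upperLimit (m + 1) a b = tanLimit (m + 1) (Real.pi - (angle b - angle a)) := by
  have hpi := Real.pi_pos
  have hle : angle b - angle a ≤ Real.pi := by
    linarith [(angle_mem_Icc a).1, (angle_mem_Icc b).2]
  rw [upperLimit, alpha_eq_tan hab, tanLimit, if_neg h.ne', if_neg (by linarith), Real.tan_pi_sub]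
  have := Real.tan_nonneg_of_nonneg_of_le_pi_div_two (x := Real.pi - (angle b - angle a))
    (by linarith) (by linarith)
  rw [Real.tan_pi_sub] at this
  rw [← EReal.coe_neg, max_eq_right (EReal.coe_le_coe_iff.2 (by linarith)), EReal.coe_mul]

theorem alpha_pos_iff {a b : EReal} (hab : a < b) :
    0 < alpha a b ↔ angle b - angle a ≤ Real.pi / 2 := by
  have hpi := Real.pi_pos
  have h0 := sub_pos.2 (strictMono_angle hab)
  have hle : angle b - angle a ≤ Real.pi := by
    linarith [(angle_mem_Icc a).1, (angle_mem_Icc b).2]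
  rw [alpha_eq_tan hab]
  split_ifs with h1
  · simp [h1]
  · rw [EReal.coe_pos]
    refine ⟨fun h => ?_, fun h => Real.tan_pos_of_pos_of_lt_pi_div_two h0 (lt_of_le_of_ne h h1)⟩
    by_contra h2
    have := Real.tan_nonneg_of_nonneg_of_le_pi_div_two (x := Real.pi - (angle b - angle a))
      (by linarith) (by linarith)
    rw [Real.tan_pi_sub] at this
    linarith

theorem alpha_eq_zero_imp {a b : EReal} (hab : a < b) (h : alpha a b = 0) :
    a = ⊥ ∧ b = ⊤ := by
  have hpi := Real.pi_pos
  have h0 := sub_pos.2 (strictMono_angle hab)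
  have h1 : ¬ angle b - angle a ≤ Real.pi / 2 := by
    rw [← alpha_pos_iff hab, h]; exact lt_irrefl _
  have ha := (angle_mem_Icc a).1
  have hb := (angle_mem_Icc b).2
  rw [alpha_eq_tan hab, if_neg (by intro h2; exact h1 h2.le)] at h
  have h2 : Real.tan (Real.pi - (angle b - angle a)) = 0 := by
    rw [Real.tan_pi_sub, EReal.coe_eq_zero.1 h, neg_zero]
  have h3 : Real.pi - (angle b - angle a) = 0 := by
    by_contra h4
    have : 0 < Real.pi - (angle b - angle a) := lt_of_le_of_ne (by linarith) (Ne.symm h4)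
    exact (Real.tan_pos_of_pos_of_lt_pi_div_two this (by linarith)).ne' h2
  refine ⟨strictMono_angle.injective ?_, strictMono_angle.injective ?_⟩
  · rw [angle_bot]; linarith
  · rw [angle_top]; linarith

/-- The formulas on the space of coefficient vectors. With `ℓ = angle b - angle a`, the
substitution `s = √n tan t` has upper limit `ℓ` if `α > 0`, and `π - ℓ` otherwise; in the latter
case the symmetry `t ↦ π - t` is used as well. -/
theorem variance_formulas (m : ℕ) {a b : EReal} (hab : a < b) {V E : ℝ}
    (hV : V = variance (numZeros (m + 1) a b) (coeffMeasure (m + 1)))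
    (hE : E = ∫ c, numZeros (m + 1) a b c ∂coeffMeasure (m + 1)) :
    (0 < alpha a b → V = (1 + K (m + 1) a b) * E - L (m + 1) a b) ∧
    (alpha a b = 0 → a = ⊥ ∧ b = ⊤ ∧ V = (1 + KInf (m + 1)) * E ∧ E = Real.sqrt (m + 1 : ℕ)) ∧
    (alpha a b < 0 → V = (1 + KInf (m + 1)) * E +
      (KInf (m + 1) - K (m + 1) a b) * (E - Real.sqrt (m + 1 : ℕ)) - L (m + 1) a b) := by
  have hpi := Real.pi_pos
  have h0 := sub_pos.2 (strictMono_angle hab)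
  have hs : Real.sqrt (m + 1 : ℕ) ^ 2 = (m + 1 : ℕ) := Real.sq_sqrt (by positivity)
  rw [variance_numZeros m hab] at hV
  rw [integral_numZeros m hab] at hE
  have hKI : KInf (m + 1) =
      2 / Real.pi * (Real.sqrt (m + 1 : ℕ) * intF (m + 1) (Real.pi / 2)) := by
    rw [KInf, ← tanLimit_pi_div_two, KUpTo_tanLimit m ⟨by positivity, le_rfl⟩]
  refine ⟨fun h => ?_, fun h => ?_, fun h => ?_⟩
  · have hle := (alpha_pos_iff hab).1 h
    rw [K, L, upperLimit_eq_tanLimit m hab hle, KUpTo_tanLimit m ⟨h0, hle⟩,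
      LUpTo_tanLimit m ⟨h0, hle⟩, hV, hE]
    generalize Real.sqrt (m + 1 : ℕ) = r at hs ⊢
    rw [← hs]
    field_simp
    ring
  · obtain ⟨rfl, rfl⟩ := alpha_eq_zero_imp hab h
    have hl : angle ⊤ - angle ⊥ = Real.pi - 0 := by rw [angle_top, angle_bot]; ring
    have h1 := intF_pi_sub m (θ := 0) ⟨le_rfl, by positivity⟩
    have h2 := intMulF_pi_sub m (θ := 0) ⟨le_rfl, by positivity⟩
    have h3 : intF (m + 1) 0 = 0 := by simp [intF]
    have h4 : intMulF (m + 1) 0 = 0 := by simp [intMulF]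
    rw [hl, h1, h2, h3, h4] at hV
    rw [hl] at hE
    refine ⟨rfl, rfl, ?_, ?_⟩
    · rw [hV, hE, hKI]
      generalize Real.sqrt (m + 1 : ℕ) = r at hs ⊢
      rw [← hs]
      field_simp
      ring
    · rw [hE]
      field_simp
      ring
  · have hgt : Real.pi / 2 < angle b - angle a := by
      rw [← not_le, ← alpha_pos_iff hab]; exact h.le.not_gt
    have hle : angle b - angle a ≤ Real.pi := by
      linarith [(angle_mem_Icc a).1, (angle_mem_Icc b).2]
    have hne : angle b - angle a ≠ Real.pi := by
      intro h1
      rw [alpha_eq_tan hab, if_neg hgt.ne', h1, Real.tan_pi] at h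
      exact lt_irrefl _ h
    have hθ : Real.pi - (angle b - angle a) ∈ Ioc 0 (Real.pi / 2) :=
      ⟨by linarith [lt_of_le_of_ne hle hne], by linarith⟩
    have h1 := intF_pi_sub m (Ioc_subset_Icc_self hθ)
    have h2 := intMulF_pi_sub m (Ioc_subset_Icc_self hθ)
    rw [sub_sub_cancel] at h1 h2
    rw [h1, h2] at hV
    rw [K, L, upperLimit_eq_tanLimit_pi_sub m hab hgt, KUpTo_tanLimit m hθ, LUpTo_tanLimit m hθ,
      hKI, hV, hE]
    generalize Real.sqrt (m + 1 : ℕ) = r at hs ⊢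
    rw [← hs]
    field_simp
    ring

theorem hasLaw_coeffMeasure {Ω : Type*} [MeasurableSpace Ω] {P : Measure Ω}
    [IsProbabilityMeasure P] {n : ℕ} {ω : Fin (n + 1) → Ω → ℝ}
    (hlaw : ∀ j, HasLaw (ω j) (gaussianReal 0 1) P) (hindep : iIndepFun ω P) :
    HasLaw (fun w j => ω j w) (coeffMeasure n) P := by
  refine ⟨aemeasurable_pi_lambda _ fun j => (hlaw j).aemeasurable, ?_⟩
  rw [(iIndepFun_iff_map_fun_eq_pi_map fun j => (hlaw j).aemeasurable).1 hindep, coeffMeasure]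
  congr 1
  ext1 j
  exact (hlaw j).map_eq

end EllipticPolynomial

theorem theorem1p1 {Ω : Type*} [MeasurableSpace Ω] (P : Measure Ω) [IsProbabilityMeasure P]
    (n : ℕ) (hn : 1 ≤ n) (ω : Fin (n + 1) → Ω → ℝ)
    (hlaw : ∀ j, HasLaw (ω j) (gaussianReal 0 1) P) (hindep : iIndepFun ω P)
    (a b : EReal) (hab : a < b)
    (N : Ω → ℝ) (hN : N = fun w => EllipticPolynomial.numZeros n a b (fun j => ω j w)) :
    -- the zero count, its moments and the integrals are genuinely defined
    (∀ᵐ w ∂P, (EllipticPolynomial.zeros n a b (fun j => ω j w)).Finite) ∧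
    MemLp N 2 P ∧
    IntegrableOn (EllipticPolynomial.kIntegrand n) (Set.Ioi 0) ∧
    IntegrableOn (EllipticPolynomial.lIntegrand n) (Set.Ioi 0) ∧
    -- the exact formulas
    (0 < EllipticPolynomial.alpha a b →
      variance N P = (1 + EllipticPolynomial.K n a b) * (∫ w, N w ∂P)
        - EllipticPolynomial.L n a b) ∧
    (EllipticPolynomial.alpha a b = 0 →
      a = ⊥ ∧ b = ⊤ ∧
      variance N P = (1 + EllipticPolynomial.KInf n) * (∫ w, N w ∂P) ∧
      ∫ w, N w ∂P = Real.sqrt n) ∧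
    (EllipticPolynomial.alpha a b < 0 →
      variance N P = (1 + EllipticPolynomial.KInf n) * (∫ w, N w ∂P)
        + (EllipticPolynomial.KInf n - EllipticPolynomial.K n a b)
          * ((∫ w, N w ∂P) - Real.sqrt n)
        - EllipticPolynomial.L n a b) := by
  obtain ⟨m, rfl⟩ : ∃ m, n = m + 1 := ⟨n - 1, by omega⟩
  have hX := EllipticPolynomial.hasLaw_coeffMeasure hlaw hindep
  have hmap := hX.map_eq
  have hmeas := EllipticPolynomial.aemeasurable_numZeros m a b
  rw [← hmap] at hmeas
  subst hN
  refine ⟨?_, ?_, EllipticPolynomial.integrableOn_kIntegrand m,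
    EllipticPolynomial.integrableOn_lIntegrand m,
    EllipticPolynomial.variance_formulas m hab ?_ ?_⟩
  · have h := EllipticPolynomial.ae_ne_zero (m + 1)
    rw [← hmap] at h
    exact (ae_of_ae_map hX.aemeasurable h).mono fun w hw =>
      (EllipticPolynomial.zeros_finite (m + 1) a b hw).1
  · have h := EllipticPolynomial.memLp_numZeros m a b 2
    rw [← hmap, memLp_map_measure_iff hmeas.aestronglyMeasurable hX.aemeasurable] at h
    exact h
  · rw [← hmap, variance_map hmeas hX.aemeasurable]
    rfl
  · rw [← hmap, integral_map hX.aemeasurable hmeas.aestronglyMeasurable]
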